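/- **Conventions.** Let $\mathcal{C}$ be a (strict globular) $\omega$-category that is non-contracting, i.e. $s_1x$ and $t_1x$ are $1$-dimensional for every $x$ of dimension $\geq 1$. Write $\mathcal{C}_n$ for the set of its $n$-dimensional morphisms and $tr^n$ for the set of morphisms of dimension $\leq n$. Let $\mathbb{P}\mathcal{C}$ be the path $\omega$-category: its elements are the morphisms of $\mathcal{C}$ of dimension $\geq 1$, and its $n$-source, $n$-target and composition $*_n$ are $s_{n+1}$, $t_{n+1}$, $*_{n+1}$ of $\mathcal{C}$. Let $h^-:\mathbb{P}\mathcal{C}\to\mathbb{P}^-\mathcal{C}$ be the universal $\omega$-functor out of $\mathbb{P}\mathcal{C}$ that satisfies $h^-(x*_0y)=h^-(x)$ whenever $x,y,x*_0y\in\mathbb{P}\mathcal{C}$ and $x*_0y$ is defined in $\mathcal{C}$. The map $s_0$ of $\mathcal{C}$ induces $s_0:\mathbb{P}^-\mathcal{C}\to\mathcal{C}_0$. Let $\Delta^n$ be the $\omega$-category of the $n$-simplex (the $n$-th oriental, with the convention that the source of the top element $(0<1<\dots<n)$ consists of the faces omitting the first, third, … vertex). Let $\mathcal{N}^{gl^-}_n(\mathcal{C})=\omega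 Cat(\Delta^n,\mathbb{P}^-\mathcal{C})$ for $n\geq 0$, $\mathcal{N}^{gl^-}_{-1}(\mathcal{C})=\mathcal{C}_0$, with the augmentation $x\mapsto s_0(x(0))$ from $\mathcal{N}^{gl^-}_0$, and put $ev(x)=x(0<1<\dots<n)$. Let $C_n=\mathbb{Z}\mathcal{N}^{gl^-}_{n-1}(\mathcal{C})$ $(n\ge 0)$ with the simplicial boundary $\partial=\sum_i(-1)^i\partial_i$ (the augmentation from $C_1$ to $C_0$), and let $M_n\subset C_n$ be the subgroup generated by the thin elements, i.e. those $x\in\mathcal{N}^{gl^-}_{n-1}(\mathcal{C})$, $n\geq 2$, for which $ev(x)$ has dimension $\leq n-2$ in $\mathbb{P}^-\mathcal{C}$ ($M_0=M_1=0$). Then $CR^{gl^-}_n(\mathcal{C})=C_n/(M_n+\partial M_{n+1})$, with the differential induced by $\partial$. For $n\geq 0$ and an element $u$ of dimension $\leq n$ of an $\omega$-category $\mathcal D$, let $\square(u):\Delta^n\to\mathcal D$ be the canonical $n$-simplex with $ev(\square(u))=u$; explicitly, the face of $\Delta^n$ with vertex set $\{0,\dots,j-1\}\cup K$, where $j\ge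 0$ and all elements of $K$ are $>j$, is sent to $d_{j-1}^{(-)^j}u$ if $K=\emptyset$ and to $d_j^{(-)^j}u$ if $K\neq\emptyset$, where $d_p^-=s_p$, $d_p^+=t_p$, and $(-)^j$ is $-$ for even $j$ and $+$ for odd $j$. It is natural in $\mathcal D$, and on elements of dimension $\leq n$ the $(n+1)$-simplex $\square(u)$ is the last degeneracy $\epsilon_n$ of the $n$-simplex $\square(u)$. For $\mathcal D=\mathbb{P}^-\mathcal{C}$ and simplices of dimension $n-1$ this operator is $\square_n^{gl^-}$ $(n\ge1)$, and $\Phi^{gl^-}=\square^{gl^-}\circ ev$ is the folding operator; for $x\in\mathbb{P}\mathcal{C}$ of dimension $\leq n$ in $\mathcal{C}$ one writes $\Phi^{gl^-}(h^-(x)):=\square_n^{gl^-}(h^-(x))\in\mathcal{N}^{gl^-}_{n-1}(\mathcal{C})$, which is $\Phi^{gl^-}$ of any simplex whose evaluation is $h^-(x)$. For $n=0$ and $x\in\mathcal{C}_0$, $\Phi^{gl^-}(h^-(x)):=x$. The formal negative corner complex $CF^-(\mathcal{C})$ has $CF^-_0=\mathbb{Z}\mathcal{C}_0$ and, for $n\geq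 1$, $CF^-_n$ is the abelian group generated by the morphisms $x$ of dimension $\geq 1$ and $\leq n$ subject to: $x=0$ if $x\in tr^{n-1}$; $x*_0y=x$ whenever $x$, $y$ and $x*_0y$ are such morphisms; $x*_ry=x+y$ whenever $x*_ry$ exists and $1\leq r\leq n-1$. The differential is $s_{n-1}-t_{n-1}:CF^-_n\to CF^-_{n-1}$ for $n\geq 2$ and $s_0:CF_1^-\to CF_0^-$. **Theorem.** Let $\mathcal{C}$ be a non-contracting $\omega$-category. 1. For every $n\geq 0$, the group $CR_n^{gl^-}(\mathcal{C})$ is generated by the classes of the $\Phi^{gl^-}(h^-(x))$ for $x\in\mathcal{C}_n$. 2. Let $n\geq 1$ and let $x,y\in\mathbb{P}\mathcal{C}$ be of dimension $\leq n$ (in particular, $x,y\in\mathcal{C}_n$ is allowed). If $x*_0y$ exists and lies in $\mathbb{P}\mathcal{C}$, then $\Phi^{gl^-}(h^-(x*_0y))=\Phi^{gl^-}(h^-(x))$, as elements of $\mathcal{N}^{gl^-}_{n-1}(\mathcal{C})$. 3. Let $n\geq 1$ and let $x,y\in\mathbb{P}\mathcal{C}$ be of dimension $\leq n$. If $x*_ry$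 exists for some $r$ with $1\leq r\leq n-1$, then $\Phi^{gl^-}(h^-(x*_ry))=\Phi^{gl^-}(h^-(x))+\Phi^{gl^-}(h^-(y))$ in $CR_n^{gl^-}(\mathcal{C})$. 4. The operators $\square^{gl^-}$ induce a chain map $CF^-(\mathcal{C})\to CR^{gl^-}(\mathcal{C})$: there is exactly one chain map that is the identity on $\mathcal{C}_0$ in degree $0$ and sends each generator $x$ of $CF_n^-(\mathcal{C})$, $n\geq 1$, to the class of $\square_n^{gl^-}(h^-(x))$. This chain map is natural in $\mathcal{C}$ with respect to the $\omega$-functors that send $1$-dimensional morphisms to $1$-dimensional morphisms. -/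

import Mathlib

open CategoryTheory

universe u v w

namespace Globular

/-! ### Strict globular ω-categories -/

/-- A strict globular ω-category in the one-sorted presentation: `d n false` is the `n`-source `s_n`,
`d n true` is the `n`-target `t_n`, and `comp n x y` is `x *_n y`. The composite is meaningful only
when `t_n x = s_n y`; every axiom and every notion below uses it only in that case. -/
class OmegaCategory (A : Type u) where
  d : ℕ → Bool → A → A
  comp : ℕ → A → A → A
  d_d_of_lt : ∀ {m n : ℕ} (β α : Bool) (x : A), m < n → d m β (d n α x) = d m β x
  d_d_of_le : ∀ {m n : ℕ} (β α : Bool) (x : A), n ≤ m → d m β (d n α x) = d n α x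
  src_comp : ∀ (n : ℕ) (x : A), comp n (d n false x) x = x
  comp_tgt : ∀ (n : ℕ) (x : A), comp n x (d n true x) = x
  d_src : ∀ (n : ℕ) (x y : A), d n true x = d n false y →
    d n false (comp n x y) = d n false x
  d_tgt : ∀ (n : ℕ) (x y : A), d n true x = d n false y →
    d n true (comp n x y) = d n true y
  d_comp : ∀ {m n : ℕ} (α : Bool) (x y : A), m ≠ n → d n true x = d n false y →
    d m α (comp n x y) = comp n (d m α x) (d m α y)
  assoc : ∀ (n : ℕ) (x y z : A), d n true x = d n false y → d n true y = d n false z →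
    comp n (comp n x y) z = comp n x (comp n y z)
  interchange : ∀ {m n : ℕ} (x y z w : A), m ≠ n →
    d n true x = d n false y → d n true z = d n false w →
    d m true x = d m false z → d m true y = d m false w →
    comp m (comp n x y) (comp n z w) = comp n (comp m x z) (comp m y w)
  finite : ∀ x : A, ∃ n, ∀ α, d n α x = x

open OmegaCategory

/-- `x *_n y` is defined. -/
def Composable {A : Type u} [OmegaCategory A] (n : ℕ) (x y : A) : Prop :=
  d n true x = d n false y

/-- `x` has dimension at most `n`, i.e. `x` belongs to `tr^n`. -/
def DimLE {A : Type u} [OmegaCategory A] (n : ℕ) (x : A) : Prop :=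
  ∀ α, d n α x = x

/-- `x` has dimension exactly `n`. -/
def HasDim {A : Type u} [OmegaCategory A] (n : ℕ) (x : A) : Prop :=
  DimLE n x ∧ ∀ m, m < n → ¬ DimLE m x

section basic
variable {A : Type u} [OmegaCategory A]

theorem dimLE_d (n : ℕ) (α : Bool) (x : A) : DimLE n (d n α x) :=
  fun β => d_d_of_le β α x le_rfl

theorem dimLE_of_one {n : ℕ} {α : Bool} {x : A} (h : d n α x = x) : DimLE n x := by
  rw [← h]; exact dimLE_d n α x

theorem DimLE.mono {m n : ℕ} {x : A} (h : DimLE m x) (hmn : m ≤ n) : DimLE n x := by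
  intro α
  rw [← h α, d_d_of_le _ _ _ hmn]

theorem DimLE.d {m : ℕ} {x : A} (h : DimLE m x) (n : ℕ) (α : Bool) :
    DimLE m (d n α x) := by
  rcases le_total n m with h1 | h1
  · exact (dimLE_d n α x).mono h1
  · rw [h.mono h1 α]; exact h

theorem DimLE.comp {m n : ℕ} {x y : A} (hx : DimLE m x) (hy : DimLE m y)
    (h : Composable n x y) : DimLE m (comp n x y) := by
  intro α
  rcases eq_or_ne m n with rfl | hmn
  · have hxy : x = y := by rw [← hx true, ← hy false]; exact h
    subst hxy
    have : OmegaCategory.comp m x x = x := by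
      conv_lhs => rw [← hx false]
      rw [hx false]; nth_rewrite 1 [← hx false]; exact src_comp m x
    rw [this, hx]
  · rw [d_comp α x y hmn h, hx, hy]

end basic

/-- An ω-functor. -/
@[ext]
structure OmegaFunctor (A : Type u) (B : Type v) [OmegaCategory A] [OmegaCategory B] where
  toFun : A → B
  map_d : ∀ n α x, toFun (d n α x) = d n α (toFun x)
  map_comp : ∀ n x y, Composable n x y → toFun (comp n x y) = comp n (toFun x) (toFun y)

namespace OmegaFunctor
variable {A : Type u} {B : Type v} {D : Type w} [OmegaCategory A] [OmegaCategory B]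
  [OmegaCategory D]

theorem composable (f : OmegaFunctor A B) {n : ℕ} {x y : A} (h : Composable n x y) :
    Composable n (f.toFun x) (f.toFun y) := by
  unfold Composable at *
  rw [← f.map_d, ← f.map_d, h]

theorem dimLE (f : OmegaFunctor A B) {n : ℕ} {x : A} (h : DimLE n x) :
    DimLE n (f.toFun x) := fun α => by rw [← f.map_d, h]

/-- Composition of ω-functors (first `f`, then `g`). -/
def trans (f : OmegaFunctor A B) (g : OmegaFunctor B D) : OmegaFunctor A D where
  toFun x := g.toFun (f.toFun x)
  map_d n α x := by rw [f.map_d, g.map_d]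
  map_comp n x y h := by rw [f.map_comp n x y h, g.map_comp _ _ _ (f.composable h)]

end OmegaFunctor

/-! ### Non-contracting ω-categories and the path ω-category -/

/-- `s_1 x` and `t_1 x` are `1`-dimensional for every `x` of dimension at least `1`. -/
class NonContracting (C : Type u) [OmegaCategory C] : Prop where
  hasDim_one : ∀ x : C, ¬ DimLE 0 x → ∀ α, HasDim 1 (d 1 α x)

/-- A non-contracting ω-functor sends `1`-dimensional morphisms to `1`-dimensional ones. -/
def OmegaFunctor.IsNonContracting {C : Type u} {D : Type v} [OmegaCategory C] [OmegaCategory D]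
    (f : OmegaFunctor C D) : Prop :=
  ∀ x : C, HasDim 1 x → HasDim 1 (f.toFun x)

/-- The set `C_0` of objects. -/
@[ext]
structure Obj (C : Type u) [OmegaCategory C] : Type u where
  val : C
  dim : DimLE 0 val

/-- The underlying set of the path ω-category: the morphisms of dimension at least `1`. -/
@[ext]
structure Path (C : Type u) [OmegaCategory C] : Type u where
  val : C
  dim : ¬ DimLE 0 val

section path
variable {C : Type u} [OmegaCategory C]

theorem dimLE_zero_of_d {n : ℕ} {α : Bool} {x : C} [NonContracting C] (hn : 1 ≤ n)
    (h : DimLE 0 (d n α x)) : DimLE 0 x := by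
  by_contra hx
  have h1 := NonContracting.hasDim_one x hx
  rcases Nat.lt_or_ge 1 n with hn1 | hn1
  · refine (h1 α).2 0 Nat.one_pos ?_
    rw [← d_d_of_lt α α x hn1]
    exact h.d 1 α
  · obtain rfl : n = 1 := le_antisymm hn1 hn
    exact (h1 α).2 0 Nat.one_pos h

theorem dimLE_zero_of_comp {n : ℕ} {x y : C} [NonContracting C] (hn : 1 ≤ n)
    (hxy : Composable n x y) (h : DimLE 0 (comp n x y)) : DimLE 0 x := by
  apply dimLE_zero_of_d hn (α := false)
  rw [← d_src n x y hxy]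
  exact h.d n false

open Classical in
/-- Composition in the path ω-category. -/
noncomputable def Path.compOp [NonContracting C] (n : ℕ) (x y : Path C) : Path C :=
  if h : Composable (n + 1) x.val y.val then
    ⟨comp (n + 1) x.val y.val, fun h' => x.dim (dimLE_zero_of_comp (Nat.le_add_left 1 n) h h')⟩
  else x

theorem Path.compOp_val [NonContracting C] {n : ℕ} {x y : Path C}
    (h : Composable (n + 1) x.val y.val) :
    (Path.compOp n x y).val = comp (n + 1) x.val y.val := by
  unfold Path.compOp; rw [dif_pos h]

theorem composable_d {m n : ℕ} (α : Bool) {x y : C} (hmn : m ≠ n) (h : Composable n x y) :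
    Composable n (d m α x) (d m α y) := by
  unfold Composable at *
  rcases Nat.lt_or_gt_of_ne hmn with h1 | h1
  · rw [d_d_of_le _ _ _ h1.le, d_d_of_le _ _ _ h1.le,
      ← d_d_of_lt α true x h1, h, d_d_of_lt _ _ _ h1]
  · rw [d_d_of_lt _ _ _ h1, d_d_of_lt _ _ _ h1, h]

/-- The path ω-category `ℙC`: its `n`-source, `n`-target and `n`-composition are those of `C` in
degree `n + 1`. -/
noncomputable instance [NonContracting C] : OmegaCategory (Path C) where
  d n α x := ⟨d (n + 1) α x.val, fun h => x.dim (dimLE_zero_of_d (Nat.le_add_left 1 n) h)⟩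
  comp := Path.compOp
  d_d_of_lt β α x h := Path.ext (d_d_of_lt β α x.val (by omega))
  d_d_of_le β α x h := Path.ext (d_d_of_le β α x.val (by omega))
  src_comp n x := by
    have h : Composable (n + 1) (d (n + 1) false x.val) x.val := d_d_of_le _ _ _ le_rfl
    exact Path.ext ((Path.compOp_val h).trans (src_comp _ _))
  comp_tgt n x := by
    have h : Composable (n + 1) x.val (d (n + 1) true x.val) := (d_d_of_le _ _ _ le_rfl).symm
    exact Path.ext ((Path.compOp_val h).trans (comp_tgt _ _))
  d_src n x y h := by
    have h : Composable (n + 1) x.val y.val := congrArg Path.val h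
    apply Path.ext
    dsimp only
    rw [Path.compOp_val h]
    exact d_src _ _ _ h
  d_tgt n x y h := by
    have h : Composable (n + 1) x.val y.val := congrArg Path.val h
    apply Path.ext
    dsimp only
    rw [Path.compOp_val h]
    exact d_tgt _ _ _ h
  d_comp {m n} α x y hmn h := by
    have h : Composable (n + 1) x.val y.val := congrArg Path.val h
    have hmn : m + 1 ≠ n + 1 := by omega
    apply Path.ext
    dsimp only
    rw [Path.compOp_val h, Path.compOp_val (composable_d α hmn h)]
    exact d_comp α _ _ hmn h
  assoc n x y z h1 h2 := by
    have h1 : Composable (n + 1) x.val y.val := congrArg Path.val h1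
    have h2 : Composable (n + 1) y.val z.val := congrArg Path.val h2
    have h3 : Composable (n + 1) (Path.compOp n x y).val z.val := by
      rw [Path.compOp_val h1]; exact (d_tgt _ _ _ h1).trans h2
    have h4 : Composable (n + 1) x.val (Path.compOp n y z).val := by
      rw [Path.compOp_val h2]; exact h1.trans (d_src _ _ _ h2).symm
    apply Path.ext
    rw [Path.compOp_val h3, Path.compOp_val h4, Path.compOp_val h1, Path.compOp_val h2]
    exact assoc _ _ _ _ h1 h2
  interchange {m n} x y z w hmn h1 h2 h3 h4 := by
    have h1 : Composable (n + 1) x.val y.val := congrArg Path.val h1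
    have h2 : Composable (n + 1) z.val w.val := congrArg Path.val h2
    have h3 : Composable (m + 1) x.val z.val := congrArg Path.val h3
    have h4 : Composable (m + 1) y.val w.val := congrArg Path.val h4
    have hmn : m + 1 ≠ n + 1 := by omega
    have h5 : Composable (m + 1) (Path.compOp n x y).val (Path.compOp n z w).val := by
      rw [Path.compOp_val h1, Path.compOp_val h2]
      unfold Composable at *
      rw [d_comp _ _ _ hmn h1, d_comp _ _ _ hmn h2, h3, h4]
    have h6 : Composable (n + 1) (Path.compOp m x z).val (Path.compOp m y w).val := by
      rw [Path.compOp_val h3, Path.compOp_val h4]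
      unfold Composable at *
      rw [d_comp _ _ _ hmn.symm h3, d_comp _ _ _ hmn.symm h4, h1, h2]
    apply Path.ext
    rw [Path.compOp_val h5, Path.compOp_val h6, Path.compOp_val h1, Path.compOp_val h2,
      Path.compOp_val h3, Path.compOp_val h4]
    exact interchange _ _ _ _ hmn h1 h2 h3 h4
  finite x := by
    obtain ⟨n, hn⟩ := finite x.val
    refine ⟨n, fun α => Path.ext ?_⟩
    exact DimLE.mono (x := x.val) hn (Nat.le_succ n) α

end path

/-! ### The universal quotient of an ω-category by a relation -/

/-- Formal expressions in the operations of an ω-category, with generators from `A`. -/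
inductive Term (A : Type u) : Type u
  | gen : A → Term A
  | d : ℕ → Bool → Term A → Term A
  | comp : ℕ → Term A → Term A → Term A

/-- `TermRel r a b` says that the expressions `a` and `b` are both well formed and equal in the
ω-category generated by `A`, subject to the operations of `A` and to the relation `r`. In particular
`TermRel r a a` says that `a` is well formed. -/
inductive TermRel {A : Type u} [OmegaCategory A] (r : A → A → Prop) : Term A → Term A → Prop
  | gen (x : A) : TermRel r (.gen x) (.gen x)
  | symm {a b : Term A} : TermRel r a b → TermRel r b a
  | trans {a b c : Term A} : TermRel r a b → TermRel r b c → TermRel r a c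
  | d_congr (n : ℕ) (α : Bool) {a b : Term A} : TermRel r a b → TermRel r (.d n α a) (.d n α b)
  | comp_congr (n : ℕ) {a a' b b' : Term A} : TermRel r (.d n true a) (.d n false b) →
      TermRel r a a' → TermRel r b b' → TermRel r (.comp n a b) (.comp n a' b')
  | d_d_of_lt {m n : ℕ} (β α : Bool) {a : Term A} : TermRel r a a → m < n →
      TermRel r (.d m β (.d n α a)) (.d m β a)
  | d_d_of_le {m n : ℕ} (β α : Bool) {a : Term A} : TermRel r a a → n ≤ m →
      TermRel r (.d m β (.d n α a)) (.d n α a)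
  | src_comp (n : ℕ) {a : Term A} : TermRel r a a → TermRel r (.comp n (.d n false a) a) a
  | comp_tgt (n : ℕ) {a : Term A} : TermRel r a a → TermRel r (.comp n a (.d n true a)) a
  | d_src (n : ℕ) {a b : Term A} : TermRel r a a → TermRel r b b →
      TermRel r (.d n true a) (.d n false b) → TermRel r (.d n false (.comp n a b)) (.d n false a)
  | d_tgt (n : ℕ) {a b : Term A} : TermRel r a a → TermRel r b b →
      TermRel r (.d n true a) (.d n false b) → TermRel r (.d n true (.comp n a b)) (.d n true b)
  | d_comp {m n : ℕ} (α : Bool) {a b : Term A} : m ≠ n → TermRel r a a → TermRel r b b →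
      TermRel r (.d n true a) (.d n false b) →
      TermRel r (.d m α (.comp n a b)) (.comp n (.d m α a) (.d m α b))
  | assoc (n : ℕ) {a b c : Term A} : TermRel r a a → TermRel r b b → TermRel r c c →
      TermRel r (.d n true a) (.d n false b) → TermRel r (.d n true b) (.d n false c) →
      TermRel r (.comp n (.comp n a b) c) (.comp n a (.comp n b c))
  | interchange {m n : ℕ} {a b c e : Term A} : m ≠ n →
      TermRel r a a → TermRel r b b → TermRel r c c → TermRel r e e →
      TermRel r (.d n true a) (.d n false b) → TermRel r (.d n true c) (.d n false e) →
      TermRel r (.d m true a) (.d m false c) → TermRel r (.d m true b) (.d m false e) →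
      TermRel r (.comp m (.comp n a b) (.comp n c e)) (.comp n (.comp m a c) (.comp m b e))
  | gen_d (n : ℕ) (α : Bool) (x : A) : TermRel r (.gen (d n α x)) (.d n α (.gen x))
  | gen_comp (n : ℕ) (x y : A) : Composable n x y →
      TermRel r (.gen (comp n x y)) (.comp n (.gen x) (.gen y))
  | ident (x y : A) : r x y → TermRel r (.gen x) (.gen y)

section quotient
variable {A : Type u} [OmegaCategory A] {r : A → A → Prop}

theorem TermRel.left {a b : Term A} (h : TermRel r a b) : TermRel r a a := h.trans h.symm

theorem TermRel.right {a b : Term A} (h : TermRel r a b) : TermRel r b b := h.symm.trans h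

theorem TermRel.comp_self (n : ℕ) {a b : Term A} (ha : TermRel r a a) (hb : TermRel r b b)
    (h : TermRel r (.d n true a) (.d n false b)) : TermRel r (.comp n a b) (.comp n a b) :=
  .comp_congr n h ha hb

theorem TermRel.composable_d {m n : ℕ} (α : Bool) {a b : Term A} (hmn : m ≠ n)
    (ha : TermRel r a a) (hb : TermRel r b b) (h : TermRel r (.d n true a) (.d n false b)) :
    TermRel r (.d n true (.d m α a)) (.d n false (.d m α b)) := by
  rcases Nat.lt_or_gt_of_ne hmn with h1 | h1
  · refine (TermRel.d_d_of_le _ _ ha h1.le).trans (.trans ?_ (.symm (.d_d_of_le _ _ hb h1.le)))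
    exact ((TermRel.d_d_of_lt α true ha h1).symm.trans (.d_congr _ _ h)).trans
      (.d_d_of_lt α false hb h1)
  · exact ((TermRel.d_d_of_lt true α ha h1).trans h).trans (.symm (.d_d_of_lt false α hb h1))

theorem TermRel.composable_comp {m n : ℕ} {a b c e : Term A} (hmn : m ≠ n)
    (ha : TermRel r a a) (hb : TermRel r b b) (hc : TermRel r c c) (he : TermRel r e e)
    (h1 : TermRel r (.d n true a) (.d n false b)) (h2 : TermRel r (.d n true c) (.d n false e))
    (h3 : TermRel r (.d m true a) (.d m false c)) (h4 : TermRel r (.d m true b) (.d m false e)) :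
    TermRel r (.d m true (.comp n a b)) (.d m false (.comp n c e)) := by
  refine (TermRel.d_comp true hmn ha hb h1).trans
    (.trans (.symm ?_) (TermRel.d_comp false hmn hc he h2).symm)
  exact .comp_congr n (.composable_d false hmn hc he h2) h3.symm h4.symm

/-- Induction on well-formed expressions. -/
theorem TermRel.induct {P : Term A → Prop} (gen : ∀ x, P (.gen x))
    (dstep : ∀ n α a, TermRel r a a → P a → P (.d n α a))
    (cstep : ∀ n a b, TermRel r a a → TermRel r b b → TermRel r (.d n true a) (.d n false b) →
      P a → P b → P (.comp n a b)) {a b : Term A} (h : TermRel r a b) : P a ∧ P b := by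
  induction h with
  | gen x => exact ⟨gen x, gen x⟩
  | symm _ ih => exact ih.symm
  | trans _ _ ih1 ih2 => exact ⟨ih1.1, ih2.2⟩
  | d_congr n α h ih => exact ⟨dstep _ _ _ h.left ih.1, dstep _ _ _ h.right ih.2⟩
  | comp_congr n h ha hb _ iha ihb =>
    refine ⟨cstep n _ _ ha.left hb.left h iha.1 ihb.1,
      cstep n _ _ ha.right hb.right ?_ iha.2 ihb.2⟩
    exact ((TermRel.d_congr n true ha).symm.trans h).trans (.d_congr n false hb)
  | d_d_of_lt β α h _ ih =>
    exact ⟨dstep _ _ _ (.d_congr _ _ h) (dstep _ _ _ h ih.1), dstep _ _ _ h ih.1⟩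
  | d_d_of_le β α h _ ih =>
    exact ⟨dstep _ _ _ (.d_congr _ _ h) (dstep _ _ _ h ih.1), dstep _ _ _ h ih.1⟩
  | src_comp n h ih =>
    exact ⟨cstep n _ _ (.d_congr _ _ h) h (.d_d_of_le _ _ h le_rfl) (dstep _ _ _ h ih.1) ih.1,
      ih.1⟩
  | comp_tgt n h ih =>
    exact ⟨cstep n _ _ h (.d_congr _ _ h) (.symm (.d_d_of_le _ _ h le_rfl)) ih.1
      (dstep _ _ _ h ih.1), ih.1⟩
  | d_src n ha hb h iha ihb =>
    exact ⟨dstep _ _ _ (.comp_self n ha hb h) (cstep _ _ _ ha hb h iha.1 ihb.1),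
      dstep _ _ _ ha iha.1⟩
  | d_tgt n ha hb h iha ihb =>
    exact ⟨dstep _ _ _ (.comp_self n ha hb h) (cstep _ _ _ ha hb h iha.1 ihb.1),
      dstep _ _ _ hb ihb.1⟩
  | d_comp α hmn ha hb h iha ihb =>
    exact ⟨dstep _ _ _ (.comp_self _ ha hb h) (cstep _ _ _ ha hb h iha.1 ihb.1),
      cstep _ _ _ (.d_congr _ _ ha) (.d_congr _ _ hb) (.composable_d α hmn ha hb h)
        (dstep _ _ _ ha iha.1) (dstep _ _ _ hb ihb.1)⟩
  | assoc n ha hb hc h1 h2 iha ihb ihc _ _ =>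
    have h3 := TermRel.comp_self n ha hb h1
    have h4 := TermRel.comp_self n hb hc h2
    exact ⟨cstep n _ _ h3 hc ((TermRel.d_tgt n ha hb h1).trans h2)
        (cstep n _ _ ha hb h1 iha.1 ihb.1) ihc.1,
      cstep n _ _ ha h4 (h1.trans (.symm (.d_src n hb hc h2))) iha.1
        (cstep n _ _ hb hc h2 ihb.1 ihc.1)⟩
  | interchange hmn ha hb hc he h1 h2 h3 h4 iha ihb ihc ihe =>
    exact ⟨cstep _ _ _ (.comp_self _ ha hb h1) (.comp_self _ hc he h2)
        (.composable_comp hmn ha hb hc he h1 h2 h3 h4)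
        (cstep _ _ _ ha hb h1 iha.1 ihb.1) (cstep _ _ _ hc he h2 ihc.1 ihe.1),
      cstep _ _ _ (.comp_self _ ha hc h3) (.comp_self _ hb he h4)
        (.composable_comp hmn.symm ha hc hb he h3 h4 h1 h2)
        (cstep _ _ _ ha hc h3 iha.1 ihc.1) (cstep _ _ _ hb he h4 ihb.1 ihe.1)⟩
  | gen_d n α x => exact ⟨gen _, dstep _ _ _ (.gen x) (gen x)⟩
  | gen_comp n x y h =>
    refine ⟨gen _, cstep n _ _ (.gen x) (.gen y) ?_ (gen x) (gen y)⟩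
    have h1 := TermRel.gen_d (r := r) n true x
    rw [show d n true x = d n false y from h] at h1
    exact h1.symm.trans (.gen_d n false y)
  | ident x y _ => exact ⟨gen x, gen y⟩

/-- A well-formed expression is eventually fixed by the source and target operations. -/
theorem TermRel.fin {a b : Term A} (h : TermRel r a b) :
    ∃ N, ∀ n, N ≤ n → ∀ α, TermRel r (.d n α a) a := by
  refine (TermRel.induct (P := fun a => ∃ N, ∀ n, N ≤ n → ∀ α, TermRel r (.d n α a) a)
    ?_ ?_ ?_ h).1
  · intro x
    obtain ⟨n, hn⟩ := finite x
    refine ⟨n, fun m hm α => ?_⟩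
    have h1 := TermRel.gen_d (r := r) m α x
    rw [DimLE.mono (x := x) hn hm α] at h1
    exact h1.symm
  · exact fun n α a ha _ => ⟨n, fun _ hn β => .d_d_of_le β α ha hn⟩
  · rintro m a b ha hb h ⟨N, hN⟩ ⟨M, hM⟩
    refine ⟨N + M + m + 1, fun n hn α => ?_⟩
    have h1 := TermRel.d_comp (r := r) α (show n ≠ m by omega) ha hb h
    exact h1.trans (.symm (.comp_congr m h (hN n (by omega) α).symm (hM n (by omega) α).symm))

variable (r) in
/-- Equality of well-formed expressions. -/
def termSetoid : Setoid {a : Term A // TermRel r a a} where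
  r a b := TermRel r a.1 b.1
  iseqv := ⟨fun a => a.2, fun h => h.symm, fun h h' => h.trans h'⟩

variable (r) in
/-- The universal ω-category receiving an ω-functor from `A` that identifies `r`-related elements:
well-formed expressions in the elements of `A`, modulo the axioms of ω-categories, the operations
of `A`, and `r`. -/
def UnivQuot : Type u := Quotient (termSetoid r)

namespace UnivQuot

/-- The class of a well-formed expression. -/
def mk (a : Term A) (h : TermRel r a a) : UnivQuot r := Quotient.mk (termSetoid r) ⟨a, h⟩

theorem mk_eq {a b : Term A} {ha : TermRel r a a} {hb : TermRel r b b} :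
    mk a ha = mk b hb ↔ TermRel r a b := by
  exact Quotient.eq (r := termSetoid r)

theorem ind {p : UnivQuot r → Prop} (h : ∀ a ha, p (mk a ha)) (q : UnivQuot r) : p q :=
  Quotient.inductionOn q fun a => h a.1 a.2

/-- Source and target operations. -/
def dOp (n : ℕ) (α : Bool) : UnivQuot r → UnivQuot r :=
  Quotient.map (sa := termSetoid r) (sb := termSetoid r)
    (fun a => ⟨.d n α a.1, .d_congr n α a.2⟩) fun _ _ h => TermRel.d_congr n α h

theorem dOp_mk (n : ℕ) (α : Bool) (a : Term A) (ha : TermRel r a a) :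
    dOp n α (mk a ha) = mk (.d n α a) (.d_congr n α ha) := rfl

theorem mk_out (p : UnivQuot r) : mk p.out.1 p.out.2 = p := Quotient.out_eq p

open Classical in
/-- Composition operations. -/
noncomputable def compOp (n : ℕ) (p q : UnivQuot r) : UnivQuot r :=
  if h : TermRel r (.d n true p.out.1) (.d n false q.out.1) then
    mk (.comp n p.out.1 q.out.1) (.comp_self n p.out.2 q.out.2 h)
  else p

theorem compOp_mk (n : ℕ) {a b : Term A} (ha : TermRel r a a) (hb : TermRel r b b)
    (h : TermRel r (.d n true a) (.d n false b)) :
    compOp n (mk a ha) (mk b hb) = mk (.comp n a b) (.comp_self n ha hb h) := by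
  have h1 : TermRel r (mk a ha).out.1 a := mk_eq.1 (mk_out (mk a ha))
  have h2 : TermRel r (mk b hb).out.1 b := mk_eq.1 (mk_out (mk b hb))
  have h3 : TermRel r (.d n true (mk a ha).out.1) (.d n false (mk b hb).out.1) :=
    ((TermRel.d_congr n true h1).trans h).trans (.symm (.d_congr n false h2))
  unfold compOp
  rw [dif_pos h3, mk_eq]
  exact .comp_congr n h3 h1 h2

noncomputable instance : OmegaCategory (UnivQuot r) where
  d := dOp
  comp := compOp
  d_d_of_lt β α q h := by
    induction q using ind with
    | h a ha => rw [dOp_mk, dOp_mk, dOp_mk, mk_eq]; exact .d_d_of_lt β α ha h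
  d_d_of_le β α q h := by
    induction q using ind with
    | h a ha => rw [dOp_mk, dOp_mk, mk_eq]; exact .d_d_of_le β α ha h
  src_comp n q := by
    induction q using ind with
    | h a ha =>
      rw [dOp_mk, compOp_mk n _ _ (.d_d_of_le _ _ ha le_rfl), mk_eq]; exact .src_comp n ha
  comp_tgt n q := by
    induction q using ind with
    | h a ha =>
      rw [dOp_mk, compOp_mk n _ _ (.symm (.d_d_of_le _ _ ha le_rfl)), mk_eq]; exact .comp_tgt n ha
  d_src n p q h := by
    induction p using ind with
    | h a ha =>
    induction q using ind with
    | h b hb =>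
      rw [dOp_mk, dOp_mk, mk_eq] at h
      rw [compOp_mk n _ _ h, dOp_mk, dOp_mk, mk_eq]; exact .d_src n ha hb h
  d_tgt n p q h := by
    induction p using ind with
    | h a ha =>
    induction q using ind with
    | h b hb =>
      rw [dOp_mk, dOp_mk, mk_eq] at h
      rw [compOp_mk n _ _ h, dOp_mk, dOp_mk, mk_eq]; exact .d_tgt n ha hb h
  d_comp {m n} α p q hmn h := by
    induction p using ind with
    | h a ha =>
    induction q using ind with
    | h b hb =>
      rw [dOp_mk, dOp_mk, mk_eq] at h
      have h' := TermRel.composable_d α hmn ha hb h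
      rw [compOp_mk n _ _ h, dOp_mk, dOp_mk, dOp_mk, compOp_mk n _ _ h', mk_eq]
      exact .d_comp α hmn ha hb h
  assoc n p q s h1 h2 := by
    induction p using ind with
    | h a ha =>
    induction q using ind with
    | h b hb =>
    induction s using ind with
    | h c hc =>
      rw [dOp_mk, dOp_mk, mk_eq] at h1 h2
      rw [compOp_mk n _ _ h1, compOp_mk n _ _ h2,
        compOp_mk n _ _ ((TermRel.d_tgt n ha hb h1).trans h2),
        compOp_mk n _ _ (h1.trans (.symm (.d_src n hb hc h2))), mk_eq]
      exact .assoc n ha hb hc h1 h2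
  interchange {m n} p q s t hmn h1 h2 h3 h4 := by
    induction p using ind with
    | h a ha =>
    induction q using ind with
    | h b hb =>
    induction s using ind with
    | h c hc =>
    induction t using ind with
    | h e he =>
      rw [dOp_mk, dOp_mk, mk_eq] at h1 h2 h3 h4
      rw [compOp_mk n _ _ h1, compOp_mk n _ _ h2, compOp_mk m _ _ h3, compOp_mk m _ _ h4,
        compOp_mk m _ _ (.composable_comp hmn ha hb hc he h1 h2 h3 h4),
        compOp_mk n _ _ (.composable_comp hmn.symm ha hc hb he h3 h4 h1 h2), mk_eq]
      exact .interchange hmn ha hb hc he h1 h2 h3 h4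
  finite q := by
    induction q using ind with
    | h a ha =>
      obtain ⟨N, hN⟩ := ha.fin
      exact ⟨N, fun α => by rw [dOp_mk, mk_eq]; exact hN N le_rfl α⟩

variable (r) in
/-- The canonical ω-functor to the quotient. -/
noncomputable def proj : OmegaFunctor A (UnivQuot r) where
  toFun x := mk (.gen x) (.gen x)
  map_d n α x := mk_eq.2 (.gen_d n α x)
  map_comp n x y h := by
    have h1 := TermRel.gen_d (r := r) n true x
    rw [show d n true x = d n false y from h] at h1
    change _ = compOp n _ _
    rw [compOp_mk n _ _ (h1.symm.trans (.gen_d n false y)), mk_eq]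
    exact .gen_comp n x y h

theorem proj_eq {x y : A} (h : r x y) : (proj r).toFun x = (proj r).toFun y :=
  mk_eq.2 (.ident x y h)

variable {B : Type v} [OmegaCategory B]

/-- Evaluation of an expression in `B`. -/
def realize (f : A → B) : Term A → B
  | .gen x => f x
  | .d n α a => OmegaCategory.d n α (realize f a)
  | .comp n a b => OmegaCategory.comp n (realize f a) (realize f b)

theorem realize_eq (f : OmegaFunctor A B) (hf : ∀ x y, r x y → f.toFun x = f.toFun y)
    {a b : Term A} (h : TermRel r a b) : realize f.toFun a = realize f.toFun b := by
  induction h with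
  | gen x => rfl
  | symm _ ih => exact ih.symm
  | trans _ _ ih1 ih2 => exact ih1.trans ih2
  | d_congr n α _ ih => simp only [realize, ih]
  | comp_congr n _ _ _ _ ih1 ih2 => simp only [realize, ih1, ih2]
  | d_d_of_lt β α _ h => exact OmegaCategory.d_d_of_lt β α _ h
  | d_d_of_le β α _ h => exact OmegaCategory.d_d_of_le β α _ h
  | src_comp n _ => exact OmegaCategory.src_comp n _
  | comp_tgt n _ => exact OmegaCategory.comp_tgt n _
  | d_src n _ _ _ _ _ ih => exact OmegaCategory.d_src n _ _ ih
  | d_tgt n _ _ _ _ _ ih => exact OmegaCategory.d_tgt n _ _ ih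
  | d_comp α hmn _ _ _ _ _ ih => exact OmegaCategory.d_comp α _ _ hmn ih
  | assoc n _ _ _ _ _ _ _ _ ih1 ih2 => exact OmegaCategory.assoc n _ _ _ ih1 ih2
  | interchange hmn _ _ _ _ _ _ _ _ _ _ _ _ ih1 ih2 ih3 ih4 =>
    exact OmegaCategory.interchange _ _ _ _ hmn ih1 ih2 ih3 ih4
  | gen_d n α x => exact f.map_d n α x
  | gen_comp n x y h => exact f.map_comp n x y h
  | ident x y h => exact hf x y h

/-- The ω-functor on the quotient induced by an ω-functor that identifies `r`-related elements. -/
def lift (f : OmegaFunctor A B) (hf : ∀ x y, r x y → f.toFun x = f.toFun y) :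
    OmegaFunctor (UnivQuot r) B where
  toFun := Quotient.lift (s := termSetoid r) (fun a => realize f.toFun a.1)
    fun _ _ h => realize_eq f hf h
  map_d n α q := by
    induction q using ind with
    | h a ha => rfl
  map_comp n p q h := by
    induction p using ind with
    | h a ha =>
    induction q using ind with
    | h b hb =>
      change dOp _ _ _ = dOp _ _ _ at h
      rw [dOp_mk, dOp_mk, mk_eq] at h
      change Quotient.lift _ _ (compOp _ _ _) = _
      rw [compOp_mk n _ _ h]
      rfl

theorem lift_proj (f : OmegaFunctor A B) (hf : ∀ x y, r x y → f.toFun x = f.toFun y) :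
    (proj r).trans (lift f hf) = f := rfl

/-- Every element of the quotient is obtained from images of elements of `A` by finitely many
compositions, sources and targets. -/
theorem induct {P : UnivQuot r → Prop} (gen : ∀ x, P ((proj r).toFun x))
    (dstep : ∀ n α q, P q → P (OmegaCategory.d n α q))
    (cstep : ∀ n p q, Composable n p q → P p → P q → P (OmegaCategory.comp n p q))
    (q : UnivQuot r) : P q := by
  have key : ∀ a b, TermRel r a b → (∀ ha : TermRel r a a, P (mk a ha)) ∧
      (∀ hb : TermRel r b b, P (mk b hb)) := by
    intro a b h
    refine TermRel.induct (P := fun a => ∀ ha : TermRel r a a, P (mk a ha)) ?_ ?_ ?_ h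
    · exact fun x _ => gen x
    · exact fun n α a ha ih _ => dstep n α _ (ih ha)
    · intro n a b ha hb h iha ihb hab
      have h1 := cstep n (mk a ha) (mk b hb) (mk_eq.2 h) (iha ha) (ihb hb)
      rwa [show OmegaCategory.comp n (mk a ha) (mk b hb) = mk (.comp n a b) hab from
        compOp_mk n ha hb h] at h1
  induction q using ind with
  | h a ha => exact (key a a ha).1 ha

theorem hom_ext {f g : OmegaFunctor (UnivQuot r) B} (h : (proj r).trans f = (proj r).trans g) :
    f = g := by
  apply OmegaFunctor.ext
  funext q
  induction q using induct with
  | gen x => exact congrFun (congrArg OmegaFunctor.toFun h) x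
  | dstep n α q ih => rw [f.map_d, g.map_d, ih]
  | cstep n p q hpq ihp ihq => rw [f.map_comp _ _ _ hpq, g.map_comp _ _ _ hpq, ihp, ihq]

end UnivQuot
end quotient
end Globular

namespace Globular

open OmegaCategory

/-! ### The negative semi-path ω-category -/

section semipath
variable {C : Type u} [OmegaCategory C]

/-- The pairs `(x, x *_0 y)` with `x`, `y` and `x *_0 y` in `ℙC`. -/
def StartRel (x z : Path C) : Prop :=
  ∃ y : Path C, Composable 0 x.val y.val ∧ z.val = comp 0 x.val y.val

/-- The equivalence relation `R^-`: the reflexive, symmetric and transitive closure of the set of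
pairs `(x, x *_0 y)`. -/
def RMinus (x z : Path C) : Prop := Relation.EqvGen StartRel x z

variable (C) in
/-- The negative semi-path ω-category `ℙ^-C`: the universal ω-category receiving an ω-functor from
`ℙC` that identifies `R^-`-equivalent elements. It is the pushout of `F(Uℙ C) → F(Uℙ C / R^-)` along
`F(Uℙ C) → ℙC`, where `F` is the free ω-category on a globular set and `U` is the forgetful functor,
because ω-functors out of either are the ω-functors out of `ℙC` that are constant on `R^-`-classes.
As for `ℙC`, its degree `n` corresponds to degree `n + 1` in `C`. -/
abbrev SemiPath [NonContracting C] : Type u := UnivQuot (RMinus (C := C))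

variable (C) in
/-- The canonical ω-functor `h^- : ℙC → ℙ^-C`. -/
noncomputable def hMinus [NonContracting C] : OmegaFunctor (Path C) (SemiPath C) :=
  UnivQuot.proj (RMinus (C := C))

theorem hMinus_eq [NonContracting C] {x z : Path C} (h : RMinus x z) :
    (hMinus C).toFun x = (hMinus C).toFun z := UnivQuot.proj_eq h

/-- The ω-functor out of `ℙ^-C` induced by an ω-functor out of `ℙC` that is constant on
`R^-`-classes. -/
noncomputable def SemiPath.lift [NonContracting C] {B : Type v} [OmegaCategory B]
    (f : OmegaFunctor (Path C) B) (hf : ∀ x z, RMinus x z → f.toFun x = f.toFun z) :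
    OmegaFunctor (SemiPath C) B := UnivQuot.lift f hf

theorem SemiPath.lift_hMinus [NonContracting C] {B : Type v} [OmegaCategory B]
    (f : OmegaFunctor (Path C) B) (hf : ∀ x z, RMinus x z → f.toFun x = f.toFun z) :
    (hMinus C).trans (SemiPath.lift f hf) = f := rfl

theorem SemiPath.hom_ext [NonContracting C] {B : Type v} [OmegaCategory B]
    {f g : OmegaFunctor (SemiPath C) B} (h : (hMinus C).trans f = (hMinus C).trans g) : f = g :=
  UnivQuot.hom_ext h

theorem eq_of_rMinus {X : Type v} {f : Path C → X} (hf : ∀ x z, StartRel x z → f x = f z)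
    {x z : Path C} (h : RMinus x z) : f x = f z := by
  induction h with
  | rel x z h => exact hf x z h
  | refl x => rfl
  | symm _ _ _ ih => exact ih.symm
  | trans _ _ _ _ _ ih1 ih2 => exact ih1.trans ih2

/-- A set viewed as an ω-category with only `0`-dimensional morphisms. -/
structure Disc (X : Type u) : Type u where
  val : X

instance (X : Type u) : OmegaCategory (Disc X) where
  d _ _ x := x
  comp _ x _ := x
  d_d_of_lt _ _ _ _ := rfl
  d_d_of_le _ _ _ _ := rfl
  src_comp _ _ := rfl
  comp_tgt _ _ := rfl
  d_src _ _ _ _ := rfl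
  d_tgt _ _ _ h := h
  d_comp _ _ _ _ _ := rfl
  assoc _ _ _ _ _ _ := rfl
  interchange _ _ _ _ _ _ _ _ _ := rfl
  finite _ := ⟨0, fun _ => rfl⟩

/-- The `0`-source of a morphism, as an object. -/
def srcObj (x : C) : Obj C := ⟨d 0 false x, dimLE_d 0 false x⟩

variable (C) in
/-- The `0`-source of `C` as an ω-functor from `ℙC` to the set `C_0`. -/
def srcFunctor [NonContracting C] : OmegaFunctor (Path C) (Disc (Obj C)) where
  toFun x := ⟨srcObj x.val⟩
  map_d n α x := congrArg Disc.mk (Obj.ext (d_d_of_lt false α x.val (Nat.succ_pos n)))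
  map_comp n x y h := by
    have h : Composable (n + 1) x.val y.val := congrArg Path.val h
    refine congrArg Disc.mk (Obj.ext ?_)
    change d 0 false (Path.compOp n x y).val = d 0 false x.val
    rw [Path.compOp_val h, ← d_d_of_lt false false _ (Nat.succ_pos n), d_src _ _ _ h,
      d_d_of_lt false false _ (Nat.succ_pos n)]

theorem srcObj_eq {x z : Path C} (h : RMinus x z) : srcObj x.val = srcObj z.val := by
  refine eq_of_rMinus (f := fun x : Path C => srcObj x.val) ?_ h
  rintro x z ⟨y, hxy, hz⟩
  exact Obj.ext (by change d 0 false x.val = d 0 false z.val; rw [hz, d_src _ _ _ hxy])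

variable (C) in
/-- The ω-functor `ℙ^-C → C_0` induced by the `0`-source of `C`. -/
noncomputable def SemiPath.srcFun [NonContracting C] : OmegaFunctor (SemiPath C) (Disc (Obj C)) :=
  SemiPath.lift (srcFunctor C) fun _ _ h => congrArg Disc.mk (srcObj_eq h)

/-- The map `s_0 : ℙ^-C → C_0` induced by the `0`-source of `C`. -/
noncomputable def SemiPath.src [NonContracting C] (q : SemiPath C) : Obj C :=
  ((SemiPath.srcFun C).toFun q).val

theorem SemiPath.src_d [NonContracting C] (n : ℕ) (α : Bool) (q : SemiPath C) :
    SemiPath.src (d n α q) = SemiPath.src q := by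
  unfold SemiPath.src
  rw [OmegaFunctor.map_d]
  rfl

/-! ### Functoriality -/

variable {D : Type u} [OmegaCategory D]

theorem hasDim_one_of_dimLE {x : C} (h1 : DimLE 1 x) (h0 : ¬ DimLE 0 x) : HasDim 1 x :=
  ⟨h1, fun m hm => by obtain rfl : m = 0 := by omega
                      exact h0⟩

/-- The action of a non-contracting ω-functor on morphisms of dimension at least `1`. -/
def OmegaFunctor.pathFun [NonContracting C] (f : OmegaFunctor C D) (hf : f.IsNonContracting)
    (x : Path C) : Path D :=
  ⟨f.toFun x.val, fun h => by
    have h1 := hf _ (NonContracting.hasDim_one x.val x.dim false)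
    rw [f.map_d] at h1
    exact h1.2 0 Nat.one_pos (h.d 1 false)⟩

/-- The ω-functor `ℙf : ℙC → ℙD`. -/
noncomputable def OmegaFunctor.path [NonContracting C] [NonContracting D] (f : OmegaFunctor C D)
    (hf : f.IsNonContracting) : OmegaFunctor (Path C) (Path D) where
  toFun := f.pathFun hf
  map_d n α x := Path.ext (f.map_d (n + 1) α x.val)
  map_comp n x y h := by
    have h : Composable (n + 1) x.val y.val := congrArg Path.val h
    apply Path.ext
    change f.toFun (Path.compOp n x y).val = (Path.compOp n (f.pathFun hf x) (f.pathFun hf y)).val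
    rw [Path.compOp_val h, Path.compOp_val (f.composable h), f.map_comp _ _ _ h]
    rfl

theorem OmegaFunctor.pathFun_startRel [NonContracting C] (f : OmegaFunctor C D)
    (hf : f.IsNonContracting) {x z : Path C} (h : StartRel x z) :
    StartRel (f.pathFun hf x) (f.pathFun hf z) := by
  obtain ⟨y, hxy, hz⟩ := h
  refine ⟨f.pathFun hf y, f.composable hxy, ?_⟩
  change f.toFun z.val = _
  rw [hz, f.map_comp _ _ _ hxy]
  rfl

/-- The ω-functor `ℙ^-f : ℙ^-C → ℙ^-D`. -/
noncomputable def OmegaFunctor.semiPath [NonContracting C] [NonContracting D]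
    (f : OmegaFunctor C D) (hf : f.IsNonContracting) : OmegaFunctor (SemiPath C) (SemiPath D) :=
  SemiPath.lift ((f.path hf).trans (hMinus D)) fun _ _ h =>
    eq_of_rMinus (f := fun x => (hMinus D).toFun (f.pathFun hf x))
      (fun _ _ h => hMinus_eq (.rel _ _ (f.pathFun_startRel hf h))) h

/-- The action of an ω-functor on objects. -/
def OmegaFunctor.obj (f : OmegaFunctor C D) (a : Obj C) : Obj D := ⟨f.toFun a.val, f.dimLE a.dim⟩

theorem OmegaFunctor.src_semiPath [NonContracting C] [NonContracting D] (f : OmegaFunctor C D)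
    (hf : f.IsNonContracting) (q : SemiPath C) :
    SemiPath.src ((f.semiPath hf).toFun q) = f.obj (SemiPath.src q) := by
  let g : OmegaFunctor (Disc (Obj C)) (Disc (Obj D)) :=
    ⟨fun a => ⟨f.obj a.val⟩, fun _ _ _ => rfl, fun _ _ _ _ => rfl⟩
  have h : (f.semiPath hf).trans (SemiPath.srcFun D) = (SemiPath.srcFun C).trans g := by
    apply SemiPath.hom_ext
    apply OmegaFunctor.ext
    funext x
    refine congrArg Disc.mk (Obj.ext ?_)
    change d 0 false (f.toFun x.val) = f.toFun (d 0 false x.val)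
    rw [f.map_d]
  exact congrArg Disc.val (congrFun (congrArg OmegaFunctor.toFun h) q)

end semipath
end Globular

namespace Globular

open OmegaCategory

/-! ### Augmented directed complexes and their ω-categories -/

/-- An augmented directed complex: an augmented chain complex of abelian groups with a submonoid
of positive chains in each degree. -/
structure ADC : Type 1 where
  K : ℕ → Type
  [group : ∀ p, AddCommGroup (K p)]
  pos : ∀ p, AddSubmonoid (K p)
  bd : ∀ p, K (p + 1) →+ K p
  aug : K 0 →+ ℤ
  bd_bd : ∀ p c, bd p (bd (p + 1) c) = 0
  aug_bd : ∀ c, aug (bd 0 c) = 0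

attribute [instance] ADC.group

/-- A morphism of augmented directed complexes. -/
structure ADC.Hom (K L : ADC) where
  app : ∀ p, K.K p →+ L.K p
  bd_app : ∀ p c, L.bd p (app (p + 1) c) = app p (K.bd p c)
  aug_app : ∀ c, L.aug (app 0 c) = K.aug c
  pos_app : ∀ p c, c ∈ K.pos p → app p c ∈ L.pos p

/-- The elements of the ω-category of an augmented directed complex: double sequences of positive
chains `(x_p^-, x_p^+)`, eventually zero, with `x_0^±` of augmentation `1` and
`∂ x_{p+1}^± = x_p^+ - x_p^-`. The chain `x_p^α` records the `p`-dimensional part of `d_p^α x`. -/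
@[ext]
structure ADC.Cell (K : ADC) where
  x : ∀ p : ℕ, Bool → K.K p
  pos : ∀ p α, x p α ∈ K.pos p
  aug : ∀ α, K.aug (x 0 α) = 1
  bd : ∀ p α, K.bd p (x (p + 1) α) = x p true - x p false
  fin : ∃ N, ∀ p, N ≤ p → ∀ α, x p α = 0

namespace ADC.Cell
variable {K : ADC}

/-- `d_n^γ x = (x_0^-, x_0^+, …, x_{n-1}^-, x_{n-1}^+, x_n^γ, x_n^γ, 0, 0, …)`. -/
def dOp (n : ℕ) (γ : Bool) (x : K.Cell) : K.Cell where
  x p α := if p < n then x.x p α else if p = n then x.x p γ else 0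
  pos p α := by
    split_ifs
    · exact x.pos p α
    · exact x.pos p γ
    · exact zero_mem _
  aug α := by
    by_cases h : 0 < n
    · simp [h, x.aug]
    · simp [show n = 0 by omega, x.aug]
  bd p α := by
    rcases lt_trichotomy (p + 1) n with h | h | h
    · simp [h, show p < n by omega, x.bd]
    · subst h; simp [x.bd]
    · by_cases h2 : p = n
      · subst h2; simp
      · simp [show ¬ p < n by omega, show ¬ p + 1 < n by omega, h2, show ¬ p + 1 = n by omega]
  fin := ⟨n + 1, fun p hp α => by simp [show ¬ p < n by omega, show ¬ p = n by omega]⟩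

/-- `x *_n y = x - d_n^+ x + y`, computed degreewise. -/
def compCell (n : ℕ) (x y : K.Cell) (h : dOp n true x = dOp n false y) : K.Cell where
  x p α := x.x p α - (dOp n true x).x p α + y.x p α
  pos p α := by
    rcases lt_trichotomy p n with h1 | h1 | h1
    · simpa [dOp, h1] using y.pos p α
    · subst h1
      have h2 : x.x p true = y.x p false := by
        simpa [dOp] using congrFun (congrFun (congrArg ADC.Cell.x h) p) true
      cases α
      · simpa [dOp, h2] using x.pos p false
      · simpa [dOp] using y.pos p true
    · simpa [dOp, show ¬ p < n by omega, show ¬ p = n by omega] using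
        add_mem (x.pos p α) (y.pos p α)
  aug α := by simp [x.aug, y.aug, (dOp n true x).aug]
  bd p α := by
    simp only [map_add, map_sub, x.bd, y.bd, (dOp n true x).bd]
    abel
  fin := by
    obtain ⟨N, hN⟩ := x.fin
    obtain ⟨M, hM⟩ := y.fin
    refine ⟨N + M + n + 1, fun p hp α => ?_⟩
    simp [hN p (by omega), hM p (by omega), dOp, show ¬ p < n by omega, show ¬ p = n by omega]

open Classical in
/-- Composition of composable elements. -/
noncomputable def compOp (n : ℕ) (x y : K.Cell) : K.Cell :=
  if h : dOp n true x = dOp n false y then compCell n x y h else x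

theorem compOp_x {n : ℕ} {x y : K.Cell} (h : dOp n true x = dOp n false y) (p : ℕ) (α : Bool) :
    (compOp n x y).x p α = x.x p α - (dOp n true x).x p α + y.x p α := by
  unfold compOp; rw [dif_pos h]; rfl

theorem dOp_x (n : ℕ) (γ : Bool) (x : K.Cell) (p : ℕ) (α : Bool) :
    (dOp n γ x).x p α = if p < n then x.x p α else if p = n then x.x p γ else 0 := rfl

theorem ext' {x y : K.Cell} (h : ∀ p α, x.x p α = y.x p α) : x = y :=
  ADC.Cell.ext (funext fun p => funext fun α => h p α)

theorem composable_iff {n : ℕ} {x y : K.Cell} : dOp n true x = dOp n false y ↔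
    (∀ p < n, ∀ α, x.x p α = y.x p α) ∧ x.x n true = y.x n false := by
  constructor
  · intro h
    refine ⟨fun p hp α => ?_, ?_⟩
    · simpa [dOp, hp] using congrFun (congrFun (congrArg ADC.Cell.x h) p) α
    · simpa [dOp] using congrFun (congrFun (congrArg ADC.Cell.x h) n) true
  · rintro ⟨h1, h2⟩
    refine ext' fun p α => ?_
    rw [dOp_x, dOp_x]
    split_ifs with h3 h4
    · exact h1 p h3 α
    · subst h4; exact h2
    · rfl

/-- The components of a composite. -/
theorem compOp_x' {n : ℕ} {x y : K.Cell} (h : dOp n true x = dOp n false y) (p : ℕ) (α : Bool) :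
    (compOp n x y).x p α = if p < n then x.x p α else
      if p = n then (if α then y.x p true else x.x p false) else x.x p α + y.x p α := by
  rw [compOp_x h, dOp_x]
  obtain ⟨h1, h2⟩ := composable_iff.1 h
  split_ifs with h3 h4 h5
  · rw [h1 p h3 α]; abel
  · subst h4; subst h5; abel
  · subst h4
    obtain rfl : α = false := by simpa using h5
    rw [h2]; abel
  · abel

noncomputable instance : OmegaCategory K.Cell where
  d := dOp
  comp := compOp
  d_d_of_lt {m n} β α x h := ext' fun p γ => by
    simp only [dOp_x]; split_ifs <;> first | rfl | omega
  d_d_of_le {m n} β α x h := ext' fun p γ => by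
    simp only [dOp_x]; split_ifs <;> first | rfl | omega
  src_comp n x := by
    have h : dOp n true (dOp n false x) = dOp n false x := ext' fun p γ => by
      simp only [dOp_x]; split_ifs <;> rfl
    refine ext' fun p α => ?_
    rw [compOp_x h, h]; abel
  comp_tgt n x := by
    have h : dOp n true x = dOp n false (dOp n true x) := ext' fun p γ => by
      simp only [dOp_x]; split_ifs <;> rfl
    refine ext' fun p α => ?_
    rw [compOp_x h]; abel
  d_src n x y h := ext' fun p α => by
    simp only [dOp_x, compOp_x' h]; split_ifs <;> first | rfl | omega | simp_all
  d_tgt n x y h := ext' fun p α => by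
    have h' := composable_iff.1 h
    simp only [dOp_x, compOp_x' h]
    split_ifs with h1 h2 <;> first | rfl | omega | exact h'.1 p h1 α
  d_comp {m n} α x y hmn h := by
    obtain ⟨h1, h2⟩ := composable_iff.1 h
    have h' : dOp n true (dOp m α x) = dOp n false (dOp m α y) := by
      rw [composable_iff]
      refine ⟨fun p hp β => ?_, ?_⟩
      · simp only [dOp_x, h1 p hp]
      · rcases Nat.lt_or_gt_of_ne hmn with h3 | h3
        · simp [dOp_x, show ¬ n < m by omega, show ¬ n = m by omega]
        · simp [dOp_x, h3, h2]
    refine ext' fun p β => ?_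
    rw [compOp_x' h', dOp_x, dOp_x, dOp_x, dOp_x, dOp_x, compOp_x' h, compOp_x' h]
    rcases lt_trichotomy p m with h3 | h3 | h3 <;> rcases lt_trichotomy p n with h4 | h4 | h4
    · simp [h3, h4]
    · subst h4; simp [h3]
    · simp [h3, show ¬ p < n by omega, show ¬ p = n by omega]
    · subst h3; simp [h4]
    · omega
    · subst h3; simp [show ¬ p < n by omega, show ¬ p = n by omega]
    · simp [h4, show ¬ p < m by omega, show ¬ p = m by omega]
    · subst h4; simp [show ¬ p < m by omega, show ¬ p = m by omega]
    · simp [show ¬ p < m by omega, show ¬ p = m by omega, show ¬ p < n by omega,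
        show ¬ p = n by omega]
  assoc n x y z h1 h2 := by
    obtain ⟨h3, h4⟩ := composable_iff.1 h1
    obtain ⟨h5, h6⟩ := composable_iff.1 h2
    have h7 : dOp n true (compOp n x y) = dOp n false z := by
      rw [composable_iff]
      exact ⟨fun p hp α => by simp [compOp_x' h1, hp, h3 p hp, h5 p hp],
        by simp [compOp_x' h1, h6]⟩
    have h8 : dOp n true x = dOp n false (compOp n y z) := by
      rw [composable_iff]
      exact ⟨fun p hp α => by simp [compOp_x' h2, hp, h3 p hp],
        by simp [compOp_x' h2, h4]⟩
    refine ext' fun p α => ?_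
    simp only [compOp_x' h7, compOp_x' h8, compOp_x' h1, compOp_x' h2]
    rcases lt_trichotomy p n with h | h | h
    · simp [h]
    · subst h; cases α <;> simp
    · simp [show ¬ p < n by omega, show ¬ p = n by omega, add_assoc]
  interchange {m n} x y z w hmn h1 h2 h3 h4 := by
    have key : ∀ {m n : ℕ} {x y z w : K.Cell}, m ≠ n → dOp n true x = dOp n false y →
        dOp n true z = dOp n false w → dOp m true x = dOp m false z →
        dOp m true y = dOp m false w →
        dOp m true (compOp n x y) = dOp m false (compOp n z w) := by
      intro m n x y z w hmn h1 h2 h3 h4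
      rw [composable_iff]
      have h3' := composable_iff.1 h3
      have h4' := composable_iff.1 h4
      refine ⟨fun p hp α => by rw [compOp_x' h1, compOp_x' h2, h3'.1 p hp, h3'.1 p hp,
        h4'.1 p hp, h4'.1 p hp], ?_⟩
      rw [compOp_x' h1, compOp_x' h2]
      rcases Nat.lt_or_gt_of_ne hmn with h | h
      · simp [h, h3'.2]
      · simp [show ¬ m < n by omega, show ¬ m = n by omega, h3'.2, h4'.2]
    have h5 := key hmn h1 h2 h3 h4
    have h6 := key hmn.symm h3 h4 h1 h2
    refine ext' fun p α => ?_
    simp only [compOp_x' h5, compOp_x' h6, compOp_x' h1, compOp_x' h2, compOp_x' h3, compOp_x' h4]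
    rcases lt_trichotomy p m with h | h | h <;> rcases lt_trichotomy p n with h' | h' | h'
    · simp [h, h']
    · subst h'; simp [h]
    · simp [h, show ¬ p < n by omega, show ¬ p = n by omega]
    · subst h; simp [h']
    · omega
    · subst h
      cases α <;> simp [show ¬ p < n by omega, show ¬ p = n by omega]
    · simp [h', show ¬ p < m by omega, show ¬ p = m by omega]
    · subst h'
      cases α <;> simp [show ¬ p < m by omega, show ¬ p = m by omega]
    · simp only [show ¬ p < m by omega, show ¬ p = m by omega, show ¬ p < n by omega,
        show ¬ p = n by omega, if_false]
      abel
  finite x := by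
    obtain ⟨N, hN⟩ := x.fin
    refine ⟨N, fun α => ext' fun p β => ?_⟩
    rw [dOp_x]
    split_ifs with h1 h2
    · rfl
    · subst h2; rw [hN p le_rfl, hN p le_rfl]
    · rw [hN p (by omega)]

/-- The ω-functor induced by a morphism of augmented directed complexes. -/
def map {L : ADC} (f : ADC.Hom K L) : OmegaFunctor K.Cell L.Cell where
  toFun x :=
    { x := fun p α => f.app p (x.x p α)
      pos := fun p α => f.pos_app p _ (x.pos p α)
      aug := fun α => by rw [f.aug_app, x.aug]
      bd := fun p α => by rw [f.bd_app, x.bd, map_sub]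
      fin := by
        obtain ⟨N, hN⟩ := x.fin
        exact ⟨N, fun p hp α => by rw [hN p hp, map_zero]⟩ }
  map_d n γ x := ext' fun p α => by
    change f.app p ((dOp n γ x).x p α) = (dOp n γ _).x p α
    rw [dOp_x, dOp_x]
    split_ifs <;> simp
  map_comp n x y h := ext' fun p α => by
    have h' := composable_iff.1 h
    change f.app p ((compOp n x y).x p α) = (compOp n _ _).x p α
    rw [compOp_x' h, compOp_x' (by
      rw [composable_iff]
      exact ⟨fun p hp α => by simp only [h'.1 p hp α], by simp only [h'.2]⟩)]
    split_ifs <;> simp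

theorem map_x {L : ADC} (f : ADC.Hom K L) (x : K.Cell) (p : ℕ) (α : Bool) :
    ((map f).toFun x).x p α = f.app p (x.x p α) := rfl

end ADC.Cell

/-! ### The ω-category of the simplex -/

/-- The `p`-dimensional faces of the `n`-simplex. -/
abbrev Face (n p : ℕ) : Type := {σ : Finset (Fin (n + 1)) // σ.card = p + 1}

namespace Simplex
variable {n m : ℕ}

/-- The chain `τ` in dimension `p`, or `0` if `τ` is not a `p`-dimensional face. -/
noncomputable def e (p : ℕ) (τ : Finset (Fin (n + 1))) : Face n p →₀ ℤ :=
  if h : τ.card = p + 1 then Finsupp.single ⟨τ, h⟩ 1 else 0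

/-- The sign of the face of `σ` obtained by removing the vertex `v`: the faces that omit the first,
third, fifth, … vertex form the source and get the sign `-1`, the others form the target. -/
def sgn (σ : Finset (Fin (n + 1))) (v : Fin (n + 1)) : ℤ :=
  (-1) ^ ((σ.filter (· < v)).card + 1)

/-- The boundary operator on chains of the simplex. -/
noncomputable def bd (n p : ℕ) : (Face n (p + 1) →₀ ℤ) →ₗ[ℤ] (Face n p →₀ ℤ) :=
  Finsupp.linearCombination ℤ fun σ => ∑ v ∈ σ.1, sgn σ.1 v • e p (σ.1.erase v)

theorem e_of_card {p : ℕ} {τ : Finset (Fin (n + 1))} (h : τ.card = p + 1) :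
    e p τ = Finsupp.single ⟨τ, h⟩ 1 := dif_pos h

theorem e_of_card_ne {p : ℕ} {τ : Finset (Fin (n + 1))} (h : τ.card ≠ p + 1) :
    e p τ = 0 := dif_neg h

theorem bd_e {p : ℕ} {τ : Finset (Fin (n + 1))} (h : τ.card = p + 2) :
    bd n p (e (p + 1) τ) = ∑ v ∈ τ, sgn τ v • e p (τ.erase v) := by
  rw [e_of_card h, bd, Finsupp.linearCombination_single, one_smul]

theorem sgn_mul_sgn {σ : Finset (Fin (n + 1))} {v w : Fin (n + 1)} (hv : v ∈ σ)
    (h : v < w) : sgn σ v * sgn (σ.erase v) w = - (sgn σ w * sgn (σ.erase w) v) := by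
  unfold sgn
  have h1 : ((σ.erase v).filter (· < w)).card + 1 = (σ.filter (· < w)).card := by
    rw [Finset.filter_erase, Finset.card_erase_add_one]
    simp [hv, h]
  have h2 : (σ.erase w).filter (· < v) = σ.filter (· < v) := by
    rw [Finset.filter_erase, Finset.erase_eq_of_notMem]
    simp [h.le]
  rw [h2, h1]
  ring

theorem bd_bd (p : ℕ) (c : Face n (p + 2) →₀ ℤ) : bd n p (bd n (p + 1) c) = 0 := by
  suffices h : (bd n p).comp (bd n (p + 1)) = 0 from LinearMap.congr_fun h c
  refine Finsupp.lhom_ext' fun σ => LinearMap.ext_ring ?_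
  obtain ⟨σ, hσ⟩ := σ
  simp only [LinearMap.comp_apply, Finsupp.lsingle_apply, LinearMap.zero_apply]
  rw [← e_of_card hσ, bd_e hσ, map_sum]
  have h1 : ∀ v ∈ σ, bd n p (sgn σ v • e (p + 1) (σ.erase v)) =
      ∑ w ∈ σ, if w = v then 0 else
        (sgn σ v * sgn (σ.erase v) w) • e p ((σ.erase v).erase w) := by
    intro v hv
    rw [map_smul, bd_e (by rw [Finset.card_erase_of_mem hv, hσ]; rfl), Finset.smul_sum,
      ← Finset.filter_ne', Finset.sum_filter]
    refine Finset.sum_congr rfl fun w _ => ?_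
    by_cases hwv : w = v
    · simp [hwv]
    · rw [if_pos hwv, if_neg hwv, smul_smul, Finset.filter_ne']
  rw [Finset.sum_congr rfl h1]
  set S := ∑ v ∈ σ, ∑ w ∈ σ, if w = v then 0 else
        (sgn σ v * sgn (σ.erase v) w) • e p ((σ.erase v).erase w) with hS
  have h2 : S = -S := by
    conv_lhs => rw [hS, Finset.sum_comm]
    rw [hS, ← Finset.sum_neg_distrib]
    refine Finset.sum_congr rfl fun v hv => ?_
    rw [← Finset.sum_neg_distrib]
    refine Finset.sum_congr rfl fun w hw => ?_
    rcases lt_trichotomy v w with h | h | h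
    · rw [if_neg h.ne, if_neg h.ne', Finset.erase_right_comm, sgn_mul_sgn hv h, neg_smul, neg_neg]
    · simp [h]
    · rw [if_neg h.ne, if_neg h.ne', Finset.erase_right_comm, sgn_mul_sgn hw h, neg_smul]
  exact self_eq_neg.1 h2

/-- The augmentation: the sum of the coefficients. -/
noncomputable def aug (n : ℕ) : (Face n 0 →₀ ℤ) →ₗ[ℤ] ℤ :=
  Finsupp.linearCombination ℤ fun _ => 1

theorem aug_e {τ : Finset (Fin (n + 1))} (h : τ.card = 1) : aug n (e 0 τ) = 1 := by
  rw [e_of_card h, aug, Finsupp.linearCombination_single, one_smul]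

theorem aug_bd (c : Face n 1 →₀ ℤ) : aug n (bd n 0 c) = 0 := by
  suffices h : (aug n).comp (bd n 0) = 0 from LinearMap.congr_fun h c
  refine Finsupp.lhom_ext' fun σ => LinearMap.ext_ring ?_
  obtain ⟨σ, hσ⟩ := σ
  simp only [LinearMap.comp_apply, Finsupp.lsingle_apply, LinearMap.zero_apply]
  rw [← e_of_card hσ, bd_e hσ, map_sum]
  have h1 : ∀ v ∈ σ, aug n (sgn σ v • e 0 (σ.erase v)) = sgn σ v := by
    intro v hv
    rw [map_smul, aug_e (by rw [Finset.card_erase_of_mem hv, hσ]), smul_eq_mul, mul_one]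
  rw [Finset.sum_congr rfl h1]
  obtain ⟨a, b, hab, rfl⟩ := Finset.card_eq_two.1 hσ
  rw [Finset.sum_pair hab]
  rcases lt_or_gt_of_ne hab with h | h
  · simp [sgn, Finset.filter_insert, Finset.filter_singleton, h, h.not_gt]
  · simp [sgn, Finset.filter_insert, Finset.filter_singleton, h, h.not_gt]

/-- The augmented directed complex of the `n`-simplex: its basis in degree `p` consists of the
`p`-dimensional faces, and the positive chains are those with nonnegative coefficients. -/
noncomputable def adc (n : ℕ) : ADC where
  K p := Face n p →₀ ℤ
  pos _ :=
    { carrier := {c | ∀ σ, 0 ≤ c σ}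
      add_mem' := fun ha hb σ => add_nonneg (ha σ) (hb σ)
      zero_mem' := fun _ => le_rfl }
  bd p := (bd n p).toAddMonoidHom
  aug := (aug n).toAddMonoidHom
  bd_bd := bd_bd
  aug_bd := aug_bd

end Simplex

/-- The `n`-simplex `Δ^n` as an ω-category (the `n`-th oriental). An element `X` of dimension `k`
corresponds to the set of all subfaces of the faces occurring in its chains; the atom of a face has
as source the composite of the faces that omit its first, third, fifth, … vertex. -/
abbrev Oriental (n : ℕ) : Type := (Simplex.adc n).Cell

end Globular

namespace Globular

open OmegaCategory

namespace Simplex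
variable {n m k : ℕ}

/-- The map on chains induced by a monotone map of vertices; a face on which the map is not
injective goes to `0`. -/
noncomputable def push (f : Fin (n + 1) →o Fin (m + 1)) (p : ℕ) :
    (Face n p →₀ ℤ) →ₗ[ℤ] (Face m p →₀ ℤ) :=
  Finsupp.linearCombination ℤ fun σ => e p (σ.1.image f)

theorem push_e (f : Fin (n + 1) →o Fin (m + 1)) {p : ℕ} {τ : Finset (Fin (n + 1))}
    (h : τ.card = p + 1) : push f p (e p τ) = e p (τ.image f) := by
  rw [e_of_card h, push, Finsupp.linearCombination_single, one_smul]

theorem bd_push (f : Fin (n + 1) →o Fin (m + 1)) (p : ℕ) (c : Face n (p + 1) →₀ ℤ) :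
    bd m p (push f (p + 1) c) = push f p (bd n p c) := by
  suffices h : (bd m p).comp (push f (p + 1)) = (push f p).comp (bd n p) from
    LinearMap.congr_fun h c
  refine Finsupp.lhom_ext' fun σ => LinearMap.ext_ring ?_
  obtain ⟨σ, hσ⟩ := σ
  simp only [LinearMap.comp_apply, Finsupp.lsingle_apply]
  rw [← e_of_card hσ, bd_e hσ, push_e f hσ, map_sum]
  have h1 : ∀ v ∈ σ, push f p (sgn σ v • e p (σ.erase v)) =
      sgn σ v • e p ((σ.erase v).image f) := by
    intro v hv
    rw [map_smul, push_e f (by rw [Finset.card_erase_of_mem hv, hσ]; rfl)]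
  rw [Finset.sum_congr rfl h1]
  by_cases hf : Set.InjOn f σ
  · rw [bd_e (by rw [Finset.card_image_of_injOn hf, hσ]), Finset.sum_image hf]
    refine Finset.sum_congr rfl fun v hv => ?_
    have h2 : (σ.image f).erase (f v) = (σ.erase v).image f := by
      ext w
      simp only [Finset.mem_erase, Finset.mem_image]
      constructor
      · rintro ⟨hw, u, hu, rfl⟩
        exact ⟨u, ⟨fun h => hw (by rw [h]), hu⟩, rfl⟩
      · rintro ⟨u, ⟨huv, hu⟩, rfl⟩
        exact ⟨fun h => huv (hf hu hv h), u, hu, rfl⟩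
    have h3 : (σ.image f).filter (· < f v) = (σ.filter (· < v)).image f := by
      ext w
      simp only [Finset.mem_filter, Finset.mem_image]
      constructor
      · rintro ⟨⟨u, hu, rfl⟩, h⟩
        exact ⟨u, ⟨hu, f.monotone.reflect_lt h⟩, rfl⟩
      · rintro ⟨u, ⟨hu, h⟩, rfl⟩
        exact ⟨⟨u, hu, rfl⟩, lt_of_le_of_ne (f.monotone h.le) fun h' => h.ne (hf hu hv h')⟩
    rw [h2]
    unfold sgn
    rw [h3, Finset.card_image_of_injOn (hf.mono (Finset.coe_subset.2 (Finset.filter_subset _ _)))]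
  · rw [e_of_card_ne, map_zero]
    swap
    · intro h
      exact hf (Finset.card_image_iff.1 (h.trans hσ.symm))
    -- two consecutive vertices with the same image
    obtain ⟨a, ha, b, hb, hab, hfab, hcons⟩ : ∃ a ∈ σ, ∃ b ∈ σ, a < b ∧ f a = f b ∧
        ∀ c ∈ σ, a < c → b ≤ c := by
      have h2 : ∃ a ∈ σ, ∃ b ∈ σ, a < b ∧ f a = f b := by
        by_contra hcon
        push Not at hcon
        refine hf fun a ha b hb h => ?_
        rcases lt_trichotomy a b with h' | h' | h'
        · exact absurd h (hcon a ha b hb h')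
        · exact h'
        · exact absurd h.symm (hcon b hb a ha h')
      obtain ⟨a, ha, b, hb, hab, hfab⟩ := h2
      have hne : (σ.filter (a < ·)).Nonempty := ⟨b, by simp [hb, hab]⟩
      have hmem := Finset.min'_mem _ hne
      rw [Finset.mem_filter] at hmem
      refine ⟨a, ha, (σ.filter (a < ·)).min' hne, hmem.1, hmem.2, ?_, ?_⟩
      · refine le_antisymm (f.monotone hmem.2.le) ?_
        rw [hfab]
        exact f.monotone (Finset.min'_le _ _ (by simp [hb, hab]))
      · exact fun c hc hac => Finset.min'_le _ _ (by simp [hc, hac])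
    have h3 : ∀ v ∈ σ, v ≠ a → v ≠ b → sgn σ v • e p ((σ.erase v).image f) = 0 := by
      intro v hv hva hvb
      rw [e_of_card_ne, smul_zero]
      have hcard : (σ.erase v).card = p + 1 := by rw [Finset.card_erase_of_mem hv, hσ]; rfl
      intro h
      have hinj := Finset.card_image_iff.1 (h.trans hcard.symm)
      exact hab.ne (hinj (by simp [ha, hva.symm]) (by simp [hb, hvb.symm]) hfab)
    rw [← Finset.sum_subset (s₁ := {a, b}) (by simp [Finset.insert_subset_iff, ha, hb])
      (fun v hv hv' => h3 v hv (fun h => hv' (by simp [h])) fun h => hv' (by simp [h])),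
      Finset.sum_pair hab.ne]
    have h4 : (σ.erase a).image f = σ.image f := by
      ext w
      simp only [Finset.mem_erase, Finset.mem_image]
      constructor
      · rintro ⟨u, ⟨_, hu⟩, rfl⟩; exact ⟨u, hu, rfl⟩
      · rintro ⟨u, hu, rfl⟩
        by_cases hua : u = a
        · exact ⟨b, ⟨hab.ne', hb⟩, by rw [hua, hfab]⟩
        · exact ⟨u, ⟨hua, hu⟩, rfl⟩
    have h5 : (σ.erase b).image f = σ.image f := by
      ext w
      simp only [Finset.mem_erase, Finset.mem_image]
      constructor
      · rintro ⟨u, ⟨_, hu⟩, rfl⟩; exact ⟨u, hu, rfl⟩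
      · rintro ⟨u, hu, rfl⟩
        by_cases hub : u = b
        · exact ⟨a, ⟨hab.ne, ha⟩, by rw [hub, hfab]⟩
        · exact ⟨u, ⟨hub, hu⟩, rfl⟩
    have h6 : σ.filter (· < b) = insert a (σ.filter (· < a)) := by
      ext c
      simp only [Finset.mem_filter, Finset.mem_insert]
      constructor
      · rintro ⟨hc, hcb⟩
        rcases lt_trichotomy c a with h | h | h
        · exact Or.inr ⟨hc, h⟩
        · exact Or.inl h
        · exact absurd (hcons c hc h) (not_le.2 hcb)
      · rintro (rfl | ⟨hc, h⟩)
        · exact ⟨ha, hab⟩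
        · exact ⟨hc, h.trans hab⟩
    have h7 : sgn σ b = - sgn σ a := by
      unfold sgn
      rw [h6, Finset.card_insert_of_notMem (by simp), pow_succ]
      ring
    rw [h4, h5, h7, neg_smul, add_neg_cancel]

theorem aug_push (f : Fin (n + 1) →o Fin (m + 1)) (c : Face n 0 →₀ ℤ) :
    aug m (push f 0 c) = aug n c := by
  suffices h : (aug m).comp (push f 0) = aug n from LinearMap.congr_fun h c
  refine Finsupp.lhom_ext' fun σ => LinearMap.ext_ring ?_
  obtain ⟨σ, hσ⟩ := σ
  simp only [LinearMap.comp_apply, Finsupp.lsingle_apply]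
  rw [← e_of_card hσ, push_e f hσ, aug_e hσ, aug_e]
  obtain ⟨a, rfl⟩ := Finset.card_eq_one.1 hσ
  simp

theorem e_nonneg (p : ℕ) (τ : Finset (Fin (n + 1))) (σ : Face n p) : 0 ≤ e p τ σ := by
  unfold e
  split_ifs
  · rw [Finsupp.single_apply]; split_ifs <;> simp
  · simp

theorem linearCombination_nonneg {p : ℕ} {g : Face n p → (Face m p →₀ ℤ)}
    (hg : ∀ σ τ, 0 ≤ g σ τ) {c : Face n p →₀ ℤ} (hc : ∀ σ, 0 ≤ c σ) (τ : Face m p) :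
    0 ≤ Finsupp.linearCombination ℤ g c τ := by
  rw [Finsupp.linearCombination_apply, Finsupp.sum, Finsupp.finsetSum_apply]
  exact Finset.sum_nonneg fun σ _ => mul_nonneg (hc σ) (hg σ τ)

/-- The morphism of augmented directed complexes induced by a monotone map of vertices. -/
noncomputable def pushHom (f : Fin (n + 1) →o Fin (m + 1)) : ADC.Hom (adc n) (adc m) where
  app p := (push f p).toAddMonoidHom
  bd_app := bd_push f
  aug_app := aug_push f
  pos_app _ _ hc := linearCombination_nonneg (fun _ _ => e_nonneg _ _ _) hc

theorem push_id (p : ℕ) : push (OrderHom.id : Fin (n + 1) →o Fin (n + 1)) p = LinearMap.id := by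
  refine Finsupp.lhom_ext' fun σ => LinearMap.ext_ring ?_
  obtain ⟨σ, hσ⟩ := σ
  simp only [LinearMap.comp_apply, Finsupp.lsingle_apply, LinearMap.id_apply]
  rw [← e_of_card hσ, push_e _ hσ]
  simp

theorem push_comp (f : Fin (n + 1) →o Fin (m + 1)) (g : Fin (m + 1) →o Fin (k + 1)) (p : ℕ) :
    push (g.comp f) p = (push g p).comp (push f p) := by
  refine Finsupp.lhom_ext' fun σ => LinearMap.ext_ring ?_
  obtain ⟨σ, hσ⟩ := σ
  simp only [LinearMap.comp_apply, Finsupp.lsingle_apply]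
  rw [← e_of_card hσ, push_e _ hσ, push_e _ hσ]
  by_cases h : (σ.image f).card = p + 1
  · rw [push_e _ h, Finset.image_image]; rfl
  · rw [e_of_card_ne h, map_zero, e_of_card_ne]
    intro h'
    apply h
    rw [← hσ]
    refine Finset.card_image_iff.2 fun a ha b hb hab => ?_
    refine Finset.card_image_iff.1 (h'.trans hσ.symm) ha hb ?_
    exact congrArg g hab

/-- The ω-functor `Δ^n → Δ^m` induced by a monotone map of vertices. -/
noncomputable def map (f : Fin (n + 1) →o Fin (m + 1)) : OmegaFunctor (Oriental n) (Oriental m) :=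
  ADC.Cell.map (pushHom f)

/-- Parity condition describing the faces that occur in `d_p^α` of the top element: below every
missing vertex there is an even (if `α = -`), respectively odd (if `α = +`), number of vertices. -/
def Alt (α : Bool) (τ : Finset (Fin (n + 1))) : Prop :=
  ∀ i, i ∉ τ → (α = true ↔ Odd (τ.filter (· < i)).card)

open Classical in
/-- The chain of `p`-faces in `d_p^α` of the top element. -/
noncomputable def topChain (n p : ℕ) (α : Bool) : Face n p →₀ ℤ :=
  ∑ τ : Finset (Fin (n + 1)), if Alt α τ then e p τ else 0

theorem alt_insert {τ : Finset (Fin (n + 1))} {v : Fin (n + 1)} (hv : v ∉ τ) (β : Bool) :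
    Alt β (insert v τ) ↔ ∀ i, i ∉ τ → (i < v → (β = true ↔ Odd (τ.filter (· < i)).card)) ∧
      (v < i → ((!β) = true ↔ Odd (τ.filter (· < i)).card)) := by
  have h1 : ∀ i, i < v → (insert v τ).filter (· < i) = τ.filter (· < i) := fun i hi => by
    rw [Finset.filter_insert, if_neg hi.not_gt]
  have h2 : ∀ i, v < i → ((insert v τ).filter (· < i)).card = (τ.filter (· < i)).card + 1 :=
    fun i hi => by
      rw [Finset.filter_insert, if_pos hi, Finset.card_insert_of_notMem (by simp [hv])]
  have h3 : ∀ k : ℕ, (β = true ↔ Odd (k + 1)) ↔ ((!β) = true ↔ Odd k) := by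
    intro k
    rw [Nat.odd_add_one]
    cases β <;> simp
  constructor
  · intro h i hi
    refine ⟨fun hiv => ?_, fun hiv => ?_⟩
    · rw [← h1 i hiv]; exact h i (by simp [hiv.ne, hi])
    · rw [← h3, ← h2 i hiv]; exact h i (by simp [hiv.ne', hi])
  · intro h i hi
    rw [Finset.mem_insert, not_or] at hi
    rcases lt_or_gt_of_ne hi.1 with hiv | hiv
    · rw [h1 i hiv]; exact (h i hi.2).1 hiv
    · rw [h2 i hiv, h3]; exact (h i hi.2).2 hiv

open Classical in
theorem alt_sum (β : Bool) (τ : Finset (Fin (n + 1))) :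
    (∑ v : Fin (n + 1), if v ∈ τ then (0 : ℤ) else
      if Alt β (insert v τ) then sgn (insert v τ) v else 0) =
      (if Alt true τ then 1 else 0) - (if Alt false τ then 1 else 0) := by
  let A : ℕ → Prop := fun k => ∀ i : Fin (n + 1), i ∉ τ →
    ((i : ℕ) < k → (β = true ↔ Odd (τ.filter (· < i)).card)) ∧
    (k ≤ i → ((!β) = true ↔ Odd (τ.filter (· < i)).card))
  let g : ℕ → ℤ := fun k => if A k then 1 else 0
  let s : ℤ := if β then -1 else 1
  have h1 : ∀ v : Fin (n + 1), (if v ∈ τ then (0 : ℤ) else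
      if Alt β (insert v τ) then sgn (insert v τ) v else 0) = s * (g v - g (v + 1)) := by
    intro v
    by_cases hv : v ∈ τ
    · have : A v ↔ A (v + 1) := by
        refine forall_congr' fun i => forall_congr' fun hi => ?_
        have hne : (i : ℕ) ≠ v := fun h => hi (by rwa [Fin.ext h])
        rw [show (i : ℕ) < v ↔ (i : ℕ) < v + 1 by omega, show (v : ℕ) ≤ i ↔ (v : ℕ) + 1 ≤ i by omega]
      simp [hv, g, this]
    · rw [if_neg hv]
      have hs : sgn (insert v τ) v = (-1) ^ ((τ.filter (· < v)).card + 1) := by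
        unfold sgn
        rw [Finset.filter_insert, if_neg (lt_irrefl v)]
      have e1 : A v ↔ Alt β (insert v τ) ∧ ((!β) = true ↔ Odd (τ.filter (· < v)).card) := by
        rw [alt_insert hv]
        constructor
        · intro h
          exact ⟨fun i hi => ⟨fun hiv => (h i hi).1 hiv, fun hiv => (h i hi).2 (le_of_lt hiv)⟩,
            (h v hv).2 le_rfl⟩
        · rintro ⟨h, h'⟩ i hi
          refine ⟨fun hiv => (h i hi).1 hiv, fun hiv => ?_⟩
          rcases eq_or_lt_of_le (show v ≤ i from hiv) with rfl | h2
          · exact h'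
          · exact (h i hi).2 h2
      have e2 : A (v + 1) ↔ Alt β (insert v τ) ∧ (β = true ↔ Odd (τ.filter (· < v)).card) := by
        rw [alt_insert hv]
        constructor
        · intro h
          exact ⟨fun i hi => ⟨fun hiv => (h i hi).1 (Nat.lt_succ_of_lt hiv),
            fun hiv => (h i hi).2 hiv⟩, (h v hv).1 (Nat.lt_succ_self _)⟩
        · rintro ⟨h, h'⟩ i hi
          refine ⟨fun hiv => ?_, fun hiv => (h i hi).2 hiv⟩
          rcases eq_or_lt_of_le (show i ≤ v from Nat.lt_succ_iff.1 hiv) with rfl | h2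
          · exact h'
          · exact (h i hi).1 h2
      simp only [g, e1, e2, hs, s]
      by_cases ha : Alt β (insert v τ)
      · rcases Nat.even_or_odd (τ.filter (· < v)).card with ho | ho
        · have ho' := Nat.not_odd_iff_even.2 ho
          cases β <;> simp [ha, ho', pow_succ, ho.neg_one_pow]
        · cases β <;> simp [ha, ho, pow_succ, ho.neg_one_pow]
      · simp [ha]
  rw [Finset.sum_congr rfl fun v _ => h1 v, ← Finset.mul_sum,
    Fin.sum_univ_eq_sum_range (fun k => g k - g (k + 1)) (n + 1), Finset.sum_range_sub']
  have e0 : A 0 ↔ Alt (!β) τ :=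
    forall_congr' fun i => forall_congr' fun hi => by simp
  have e1 : A (n + 1) ↔ Alt β τ :=
    forall_congr' fun i => forall_congr' fun hi => by
      simp [i.is_lt, show ¬ (n + 1 ≤ (i : ℕ)) from not_le.2 i.is_lt]
  simp only [g, e0, e1, s]
  cases β <;> simp

theorem bd_topChain (p : ℕ) (β : Bool) :
    bd n p (topChain n (p + 1) β) = topChain n p true - topChain n p false := by
  classical
  unfold topChain
  rw [map_sum, ← Finset.sum_sub_distrib]
  have h1 : ∀ σ : Finset (Fin (n + 1)), bd n p (if Alt β σ then e (p + 1) σ else 0) =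
      ∑ v, if v ∈ σ then (if Alt β σ then sgn σ v • e p (σ.erase v) else 0) else 0 := by
    intro σ
    rw [← Finset.sum_filter (p := fun v => v ∈ σ), Finset.filter_univ_mem]
    split_ifs
    · by_cases hc : σ.card = p + 2
      · exact bd_e hc
      · rw [e_of_card_ne hc, map_zero]
        refine (Finset.sum_eq_zero fun v hv => ?_).symm
        rw [e_of_card_ne, smul_zero]
        intro h
        have := Finset.card_erase_add_one hv
        omega
    · simp
  rw [Finset.sum_congr rfl fun σ _ => h1 σ, Finset.sum_comm]
  have h2 : ∀ v : Fin (n + 1), (∑ σ : Finset (Fin (n + 1)),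
      if v ∈ σ then (if Alt β σ then sgn σ v • e p (σ.erase v) else 0) else 0) =
      ∑ τ : Finset (Fin (n + 1)), (if v ∈ τ then (0 : ℤ) else
        if Alt β (insert v τ) then sgn (insert v τ) v else 0) • e p τ := by
    intro v
    have : ∀ τ : Finset (Fin (n + 1)), (if v ∈ τ then (0 : ℤ) else
        if Alt β (insert v τ) then sgn (insert v τ) v else 0) • e p τ =
        if v ∉ τ then (if Alt β (insert v τ) then sgn (insert v τ) v • e p τ else 0) else 0 := by
      intro τ; split_ifs <;> simp_all
    rw [Finset.sum_congr rfl fun τ _ => this τ, ← Finset.sum_filter (p := fun τ => v ∈ τ),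
      ← Finset.sum_filter (p := fun τ => v ∉ τ)]
    refine Finset.sum_nbij' (fun σ => σ.erase v) (fun τ => insert v τ) ?_ ?_ ?_ ?_ ?_
    · intro σ _; simp
    · intro τ _; simp
    · intro σ hσ; exact Finset.insert_erase (by simpa using hσ)
    · intro τ hτ; exact Finset.erase_insert (by simpa using hτ)
    · intro σ hσ
      rw [Finset.insert_erase (by simpa using hσ)]
  rw [Finset.sum_congr rfl fun v _ => h2 v, Finset.sum_comm]
  refine Finset.sum_congr rfl fun τ _ => ?_
  rw [← Finset.sum_smul, alt_sum, sub_smul]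
  split_ifs <;> simp

theorem topChain_zero (α : Bool) :
    topChain n 0 α = e 0 {if α then 0 else Fin.last n} := by
  classical
  unfold topChain
  rw [Finset.sum_eq_single ({if α then 0 else Fin.last n} : Finset (Fin (n + 1)))]
  · rw [if_pos]
    intro i hi
    rw [Finset.mem_singleton] at hi
    rw [Finset.filter_singleton]
    cases α
    · have : ¬ Fin.last n < i := not_lt.2 (Fin.le_last i)
      simp [this]
    · have : (0 : Fin (n + 1)) < i := Fin.pos_of_ne_zero hi
      simp [this]
  · intro τ _ hτ
    split_ifs with ha
    · by_cases hc : τ.card = 1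
      · exfalso
        obtain ⟨v, rfl⟩ := Finset.card_eq_one.1 hc
        refine hτ ?_
        rw [Finset.singleton_inj]
        cases α
        · by_contra hv
          have hv : v ≠ Fin.last n := by simpa using hv
          have h1 := ha (Fin.last n) (by simpa using hv.symm)
          rw [Finset.filter_singleton, if_pos (lt_of_le_of_ne (Fin.le_last v) hv)] at h1
          simp at h1
        · by_contra hv
          have hv : v ≠ 0 := by simpa using hv
          have h1 := ha 0 (by simpa using hv.symm)
          rw [Finset.filter_singleton, if_neg (Fin.not_lt_zero v)] at h1
          simp at h1
      · rw [e_of_card_ne hc]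
    · rfl
  · simp

theorem aug_topChain (α : Bool) : aug n (topChain n 0 α) = 1 := by
  rw [topChain_zero, aug_e (Finset.card_singleton _)]

theorem topChain_eq_zero {p : ℕ} (hp : n < p) (α : Bool) : topChain n p α = 0 := by
  refine Finset.sum_eq_zero fun τ _ => ?_
  have h1 : τ.card ≤ n + 1 := by simpa using Finset.card_le_univ τ
  rw [e_of_card_ne (by omega), ite_self]

/-- The top element `(0 < 1 < … < n)` of `Δ^n`. -/
noncomputable def top (n : ℕ) : Oriental n where
  x := topChain n
  pos p α σ := by
    unfold topChain
    rw [Finsupp.finsetSum_apply]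
    refine Finset.sum_nonneg fun τ _ => ?_
    split_ifs
    · exact e_nonneg _ _ _
    · simp
  aug := aug_topChain
  bd := bd_topChain
  fin := ⟨n + 1, fun _ hp α => topChain_eq_zero hp α⟩

/-- The top element of `Δ^n` has the `n`-dimensional face as its `n`-dimensional part. -/
theorem topChain_self (n : ℕ) (α : Bool) : topChain n n α = e n Finset.univ := by
  classical
  unfold topChain
  rw [Finset.sum_eq_single Finset.univ,
    if_pos (show Alt α Finset.univ from fun i hi => absurd (Finset.mem_univ i) hi)]
  · intro τ _ hτ
    rw [e_of_card_ne, ite_self]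
    intro h
    exact hτ ((Finset.card_eq_iff_eq_univ τ).1 (by simpa using h))
  · simp

end Simplex
end Globular

namespace Globular

open OmegaCategory

/-! ### The simplicial nerve -/

/-- The `n`-simplices of the simplicial nerve of `D`: the ω-functors `Δ^n → D`. -/
abbrev Nerve (D : Type u) [OmegaCategory D] (n : ℕ) : Type u := OmegaFunctor (Oriental n) D

namespace Nerve
variable {D : Type u} [OmegaCategory D] {n m k : ℕ}

/-- The simplicial operator associated with a monotone map. -/
noncomputable def pull (f : Fin (n + 1) →o Fin (m + 1)) (x : Nerve D m) : Nerve D n :=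
  (Simplex.map f).trans x

/-- The face operator `∂_i`. -/
noncomputable def face (i : Fin (n + 2)) (x : Nerve D (n + 1)) : Nerve D n :=
  pull (Fin.succAboveOrderEmb i).toOrderHom x

/-- The degeneracy operator `ε_i`. -/
noncomputable def degen (i : Fin (n + 1)) (x : Nerve D n) : Nerve D (n + 1) :=
  pull i.predAboveOrderHom x

/-- Evaluation on the top element: `ev(x) = x(0 < 1 < … < n)`. -/
noncomputable def ev (x : Nerve D n) : D := x.toFun (Simplex.top n)

theorem pull_pull (f : Fin (n + 1) →o Fin (m + 1)) (g : Fin (m + 1) →o Fin (k + 1))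
    (x : Nerve D k) : pull f (pull g x) = pull (g.comp f) x := by
  apply OmegaFunctor.ext
  funext c
  refine congrArg x.toFun (ADC.Cell.ext' fun p α => ?_)
  exact (LinearMap.congr_fun (Simplex.push_comp f g p) (c.x p α)).symm

theorem pull_id (x : Nerve D n) : pull OrderHom.id x = x := by
  apply OmegaFunctor.ext
  funext c
  refine congrArg x.toFun (ADC.Cell.ext' fun p α => ?_)
  exact LinearMap.congr_fun (Simplex.push_id p) (c.x p α)

/-- The simplicial identity `∂_i ∂_{j+1} = ∂_j ∂_i` for `i ≤ j`. -/
theorem face_face {i j : Fin (n + 2)} (H : i ≤ j) (x : Nerve D (n + 2)) :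
    face i (face j.succ x) = face j (face i.castSucc x) := by
  unfold face
  rw [pull_pull, pull_pull]
  congr 1
  have h := congrArg SimplexCategory.Hom.toOrderHom (SimplexCategory.δ_comp_δ H)
  exact h

end Nerve

/-! ### The globe and the operators `□` -/

namespace Globe

/-- The augmented directed complex of the infinite-dimensional globe: two basis elements
`e_p^-`, `e_p^+` in each degree, with `∂ e_{p+1}^± = e_p^+ - e_p^-`. -/
def adc : ADC where
  K _ := Bool → ℤ
  pos _ :=
    { carrier := {c | ∀ α, 0 ≤ c α}
      add_mem' := fun ha hb α => add_nonneg (ha α) (hb α)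
      zero_mem' := fun _ => le_rfl }
  bd _ :=
    { toFun := fun c α => if α then c false + c true else -(c false + c true)
      map_zero' := by ext α; simp
      map_add' := fun c c' => by ext α; cases α <;> simp <;> ring }
  aug :=
    { toFun := fun c => c false + c true
      map_zero' := by simp
      map_add' := fun c c' => by simp only [Pi.add_apply]; ring }
  bd_bd p c := by ext α; cases α <;> simp
  aug_bd c := by simp

theorem bd_apply (p : ℕ) (c : Bool → ℤ) (α : Bool) :
    (adc.bd p c : Bool → ℤ) α = if α then c false + c true else -(c false + c true) := rfl

/-- The components of the element `e_p^α` of the globe. -/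
def atomX (p : ℕ) (α : Bool) (q : ℕ) (β : Bool) : Bool → ℤ :=
  if q < p then Pi.single β 1 else if q = p then Pi.single α 1 else 0

/-- The element `e_p^α` of the globe. -/
def atom (p : ℕ) (α : Bool) : adc.Cell where
  x := atomX p α
  pos q β γ := by
    unfold atomX
    split_ifs
    · rw [Pi.single_apply]; split_ifs <;> simp
    · rw [Pi.single_apply]; split_ifs <;> simp
    · simp
  aug β := by
    change atomX p α 0 β false + atomX p α 0 β true = 1
    unfold atomX
    split_ifs
    · cases β <;> simp
    · cases α <;> simp
    · omega
  bd q β := by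
    funext γ
    rw [bd_apply]
    change _ = atomX p α q true γ - atomX p α q false γ
    unfold atomX
    rcases lt_trichotomy (q + 1) p with h | h | h
    · simp only [h, show q < p by omega, if_true]
      cases β <;> cases γ <;> simp
    · simp only [h, show q < p by omega, lt_irrefl, if_true, if_false]
      cases α <;> cases γ <;> simp
    · simp only [show ¬ q + 1 < p by omega, show ¬ q + 1 = p by omega, show ¬ q < p by omega,
        if_false]
      simp
  fin := ⟨p + 1, fun q hq β => by
    change atomX p α q β = 0
    unfold atomX
    simp [show ¬ q < p by omega, show ¬ q = p by omega]⟩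

theorem atom_x (p : ℕ) (α : Bool) (q : ℕ) (β : Bool) : (atom p α).x q β = atomX p α q β := rfl

theorem single_ne (α : Bool) : (Pi.single α 1 : Bool → ℤ) ≠ 0 := by
  intro h
  have := congrFun h α
  simp at this

theorem single_inj {α β : Bool} (h : (Pi.single α 1 : Bool → ℤ) = Pi.single β 1) : α = β := by
  by_contra hne
  have := congrFun h α
  rw [Pi.single_eq_same, Pi.single_eq_of_ne hne] at this
  exact one_ne_zero this

theorem atom_inj {p q : ℕ} {α β : Bool} (h : atom p α = atom q β) : p = q ∧ α = β := by
  have hx : ∀ k γ, atomX p α k γ = atomX q β k γ := fun k γ =>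
    congrFun (congrFun (congrArg ADC.Cell.x h) k) γ
  have hpq : p = q := by
    rcases lt_trichotomy p q with h1 | h1 | h1
    · have h2 := hx q true
      simp only [atomX, show ¬ q < p by omega, show ¬ q = p by omega, lt_irrefl, if_false,
        if_true] at h2
      exact absurd h2.symm (single_ne _)
    · exact h1
    · have h2 := hx p true
      simp only [atomX, show ¬ p < q by omega, show ¬ p = q by omega, lt_irrefl, if_false,
        if_true] at h2
      exact absurd h2 (single_ne _)
  subst hpq
  refine ⟨rfl, ?_⟩
  have h2 := hx p true
  simp only [atomX, lt_irrefl, if_false, if_true] at h2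
  exact single_inj h2

/-- Every element of the globe is one of the `e_p^α`. -/
theorem exists_atom (x : adc.Cell) : ∃ p α, x = atom p α := by
  let y : ℕ → Bool → Bool → ℤ := x.x
  have hpos : ∀ q β γ, 0 ≤ y q β γ := x.pos
  have haug : ∀ β, y 0 β false + y 0 β true = 1 := x.aug
  have hbd : ∀ q β γ, (if γ then y (q + 1) β false + y (q + 1) β true else
      -(y (q + 1) β false + y (q + 1) β true)) = y q true γ - y q false γ :=
    fun q β γ => congrFun (x.bd q β) γ
  have hbd' : ∀ q β, y (q + 1) β false + y (q + 1) β true = y q true true - y q false true :=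
    fun q β => hbd q β true
  have hstep : ∀ q, (∀ β, y q β false + y q β true = 1) →
      (∃ α, ∀ β, y q β = Pi.single α 1) ∧ (∀ β, y (q + 1) β = 0) ∨
      (∀ β, y q β = Pi.single β 1) ∧ ∀ β, y (q + 1) β false + y (q + 1) β true = 1 := by
    intro q h
    have h3 := h false
    have h4 := h true
    have p1 := hpos q false false
    have p2 := hpos q false true
    have p3 := hpos q true false
    have p4 := hpos q true true
    have p5 := hpos (q + 1) false false
    have p6 := hpos (q + 1) false true
    have p7 := hpos (q + 1) true false
    have p8 := hpos (q + 1) true true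
    have h5 := hbd' q false
    have h6 := hbd' q true
    have hz : ∀ β, y (q + 1) β false + y (q + 1) β true = 0 → y (q + 1) β = 0 := by
      intro β hβ
      have q1 := hpos (q + 1) β false
      have q2 := hpos (q + 1) β true
      funext γ
      change _ = (0 : ℤ)
      cases γ <;> omega
    rcases (show y q false true = 0 ∨ y q false true = 1 by omega) with h7 | h7
    · rcases (show y q true true = 0 ∨ y q true true = 1 by omega) with h8 | h8
      · refine Or.inl ⟨⟨false, fun β => ?_⟩, fun β => hz β ?_⟩
        · funext γ; cases β <;> cases γ <;> simp <;> omega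
        · cases β <;> omega
      · refine Or.inr ⟨fun β => ?_, fun β => ?_⟩
        · funext γ; cases β <;> cases γ <;> simp <;> omega
        · cases β <;> omega
    · have h8 : y q true true = 1 := by omega
      refine Or.inl ⟨⟨true, fun β => ?_⟩, fun β => hz β ?_⟩
      · funext γ; cases β <;> cases γ <;> simp <;> omega
      · cases β <;> omega
  have hzero : ∀ q, (∀ β, y q β = 0) → ∀ β, y (q + 1) β = 0 := by
    intro q h β
    have h1 := hbd' q β
    rw [h true, h false] at h1
    simp only [Pi.zero_apply, sub_zero] at h1
    have q1 := hpos (q + 1) β false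
    have q2 := hpos (q + 1) β true
    funext γ
    change _ = (0 : ℤ)
    cases γ <;> omega
  obtain ⟨N, hN⟩ := x.fin
  have key : ∃ p, (∀ β, y p β false + y p β true = 1) ∧ (∀ q < p, ∀ β, y q β = Pi.single β 1) ∧
      ¬ ∀ β, y (p + 1) β false + y (p + 1) β true = 1 := by
    by_contra hcon
    push Not at hcon
    have hall : ∀ p, (∀ β, y p β false + y p β true = 1) ∧
        ∀ q < p, ∀ β, y q β = Pi.single β 1 := by
      intro p
      induction p with
      | zero => exact ⟨haug, fun q hq => absurd hq (Nat.not_lt_zero q)⟩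
      | succ p ih =>
        have h1 := hcon p ih.1 ih.2
        refine ⟨h1, fun q hq β => ?_⟩
        rcases Nat.lt_succ_iff_lt_or_eq.1 hq with h2 | rfl
        · exact ih.2 q h2 β
        · rcases hstep q ih.1 with ⟨_, h3⟩ | ⟨h3, _⟩
          · have := h1 true
            rw [h3 true] at this
            simp at this
          · exact h3 β
    have h1 := (hall N).1 true
    rw [show y N true = 0 from hN N le_rfl true] at h1
    simp at h1
  obtain ⟨p, hp1, hp2, hp3⟩ := key
  rcases hstep p hp1 with ⟨⟨α, hα⟩, h0⟩ | ⟨_, h3⟩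
  · refine ⟨p, α, ADC.Cell.ext' fun q β => ?_⟩
    rw [atom_x]
    unfold atomX
    split_ifs with h1 h2
    · exact hp2 q h1 β
    · subst h2; exact hα β
    · have hge : ∀ k, ∀ β, y (p + 1 + k) β = 0 := by
        intro k
        induction k with
        | zero => exact h0
        | succ k ih => exact hzero _ ih
      obtain ⟨k, rfl⟩ := Nat.exists_eq_add_of_le (show p + 1 ≤ q by omega)
      exact hge k β
  · exact absurd h3 hp3

/-- The dimension of an element of the globe. -/
noncomputable def deg (x : adc.Cell) : ℕ := (exists_atom x).choose

/-- The sign of an element of the globe. -/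
noncomputable def sign (x : adc.Cell) : Bool := (exists_atom x).choose_spec.choose

theorem eq_atom (x : adc.Cell) : x = atom (deg x) (sign x) :=
  (exists_atom x).choose_spec.choose_spec

theorem deg_atom (p : ℕ) (α : Bool) : deg (atom p α) = p :=
  (atom_inj (eq_atom (atom p α))).1.symm

theorem sign_atom (p : ℕ) (α : Bool) : sign (atom p α) = α :=
  (atom_inj (eq_atom (atom p α))).2.symm

theorem d_atom (n : ℕ) (γ : Bool) (p : ℕ) (α : Bool) :
    d n γ (atom p α) = if p ≤ n then atom p α else atom n γ := by
  refine ADC.Cell.ext' fun q β => ?_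
  change (ADC.Cell.dOp n γ (atom p α)).x q β = _
  rw [ADC.Cell.dOp_x]
  split_ifs with h1 h2 h3 h4 h5
  · rfl
  · rw [atom_x, atom_x]; simp [atomX, h1, show q < p by omega]; rfl
  · subst h3; rw [atom_x, atom_x]
    rcases eq_or_lt_of_le h4 with h | h
    · simp [atomX, h]; rfl
    · simp [atomX, show ¬ q < p by omega, show ¬ q = p by omega]; rfl
  · subst h3; rw [atom_x, atom_x]; simp [atomX, show q < p by omega]; rfl
  · rw [atom_x]; simp [atomX, show ¬ q < p by omega, show ¬ q = p by omega]; rfl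
  · rw [atom_x]; simp [atomX, h1, h3]; rfl

variable {D : Type u} [OmegaCategory D]

/-- The ω-functor from the globe to `D` that sends `e_p^α` to `d_p^α u`. -/
noncomputable def eval (u : D) : OmegaFunctor adc.Cell D where
  toFun x := d (deg x) (sign x) u
  map_d n γ x := by
    obtain ⟨p, α, rfl⟩ := exists_atom x
    rw [d_atom, deg_atom, sign_atom]
    split_ifs with h
    · rw [deg_atom, sign_atom, d_d_of_le _ _ _ h]
    · rw [deg_atom, sign_atom, d_d_of_lt _ _ _ (by omega)]
  map_comp n x y h := by
    have hl : ∀ {A : Type u} [OmegaCategory A] {a b : A}, d n true a = d n false b →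
        DimLE n a → comp n a b = b := by
      intro A _ a b hab ha
      rw [← ha true, hab]; exact src_comp n b
    have hl0 : ∀ {a b : adc.Cell}, d n true a = d n false b →
        DimLE n a → comp n a b = b := by
      intro a b hab ha
      rw [← ha true, hab]; exact src_comp n b
    have hr : ∀ {a b : D}, d n true a = d n false b →
        DimLE n b → comp n a b = a := by
      intro a b hab hb
      rw [← hb false, ← hab]; exact comp_tgt n a
    have hr0 : ∀ {a b : adc.Cell}, d n true a = d n false b →
        DimLE n b → comp n a b = a := by
      intro a b hab hb
      rw [← hb false, ← hab]; exact comp_tgt n a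
    have h : d n true x = d n false y := h
    have h' : d n true (d (deg x) (sign x) u) = d n false (d (deg y) (sign y) u) := by
      obtain ⟨p, α, rfl⟩ := exists_atom x
      obtain ⟨q, β, rfl⟩ := exists_atom y
      rw [d_atom, d_atom] at h
      rw [deg_atom, sign_atom, deg_atom, sign_atom]
      split_ifs at h with h1 h2 h2
      · obtain ⟨rfl, rfl⟩ := atom_inj h
        rw [d_d_of_le _ _ _ h1, d_d_of_le _ _ _ h1]
      · obtain ⟨rfl, rfl⟩ := atom_inj h
        rw [d_d_of_le _ _ _ h1, d_d_of_lt _ _ _ (by omega)]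
      · obtain ⟨rfl, rfl⟩ := atom_inj h
        rw [d_d_of_le _ _ _ h2, d_d_of_lt _ _ _ (by omega)]
      · exact absurd (atom_inj h).2 (by simp)
    by_cases h1 : deg x ≤ n
    · have e1 : DimLE n x := fun γ => by
        conv_lhs => rw [eq_atom x, d_atom, if_pos h1]
        exact (eq_atom x).symm
      have e2 : DimLE n (d (deg x) (sign x) u) := (dimLE_d _ _ _).mono h1
      rw [hl0 h e1, hl h' e2]
    · have h2 : deg y ≤ n := by
        by_contra h2
        rw [eq_atom x, eq_atom y, d_atom, d_atom, if_neg h1, if_neg h2] at h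
        exact absurd (atom_inj h).2 (by simp)
      have e1 : DimLE n y := fun γ => by
        conv_lhs => rw [eq_atom y, d_atom, if_pos h2]
        exact (eq_atom y).symm
      have e2 : DimLE n (d (deg y) (sign y) u) := (dimLE_d _ _ _).mono h2
      rw [hr0 h e1, hr h' e2]

theorem eval_atom (u : D) (p : ℕ) (α : Bool) : (eval u).toFun (atom p α) = d p α u := by
  change d (deg (atom p α)) (sign (atom p α)) u = _
  rw [deg_atom, sign_atom]

end Globe

namespace Simplex
variable {n : ℕ}

open Classical in
/-- The image of a `p`-dimensional face under the collapse of a simplex onto the globe: it is zero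
unless the face contains the vertices `0, …, p - 1`. The face `{0, …, p}` goes to `e_p^-` or `e_p^+`
according as `p + 1` is even or odd, and the face `{0, …, p - 1, k}` with `k > p` goes to `e_p^-` or
`e_p^+` according as `p` is even or odd. -/
noncomputable def label (p : ℕ) (σ : Finset (Fin (n + 1))) : Bool → ℤ :=
  if ∀ i : Fin (n + 1), (i : ℕ) < p → i ∈ σ then
    Pi.single (if ∃ i ∈ σ, (i : ℕ) = p then decide (Odd (p + 1)) else decide (Odd p)) 1
  else 0

/-- The collapse on chains. -/
noncomputable def collapseApp (n p : ℕ) : (Face n p →₀ ℤ) →ₗ[ℤ] (Bool → ℤ) :=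
  Finsupp.linearCombination ℤ fun σ => label p σ.1

theorem collapseApp_e {p : ℕ} {τ : Finset (Fin (n + 1))} (h : τ.card = p + 1) :
    collapseApp n p (e p τ) = label p τ := by
  rw [e_of_card h, collapseApp, Finsupp.linearCombination_single, one_smul]

/-- The boundary of the globe as a linear map. -/
def globeBd : (Bool → ℤ) →ₗ[ℤ] (Bool → ℤ) where
  toFun c α := if α then c false + c true else -(c false + c true)
  map_add' c c' := by ext α; cases α <;> simp <;> ring
  map_smul' r c := by ext α; cases α <;> simp <;> ring

theorem globeBd_single (β : Bool) :
    globeBd (Pi.single β 1) = Pi.single true 1 - Pi.single false 1 := by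
  funext α
  cases α <;> cases β <;> simp [globeBd]

theorem card_below {p : ℕ} (hp : p ≤ n + 1) :
    (Finset.univ.filter fun i : Fin (n + 1) => (i : ℕ) < p).card = p := by
  rw [Fin.card_filter_val_lt]
  omega

theorem globeBd_label (p : ℕ) {σ : Finset (Fin (n + 1))} (hσ : σ.card = p + 2) :
    globeBd (label (p + 1) σ) = ∑ v ∈ σ, sgn σ v • label p (σ.erase v) := by
  have hn : p + 2 ≤ n + 1 := by simpa [hσ] using Finset.card_le_univ σ
  by_cases h : ∀ i : Fin (n + 1), (i : ℕ) < p → i ∈ σ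
  · -- the two vertices of `σ` that are at least `p`
    have hlow : σ.filter (fun i : Fin (n + 1) => (i : ℕ) < p) =
        Finset.univ.filter fun i : Fin (n + 1) => (i : ℕ) < p := by
      ext i
      simp only [Finset.mem_filter, Finset.mem_univ, true_and]
      exact ⟨fun h' => h'.2, fun h' => ⟨h i h', h'⟩⟩
    have hT : (σ.filter fun i : Fin (n + 1) => ¬ (i : ℕ) < p).card = 2 := by
      have h1 := Finset.card_filter_add_card_filter_not (s := σ) (fun i : Fin (n + 1) => (i : ℕ) < p)
      rw [hlow, card_below (by omega), hσ] at h1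
      omega
    obtain ⟨k, l, hkl, hTkl⟩ : ∃ k l : Fin (n + 1), k < l ∧
        σ.filter (fun i : Fin (n + 1) => ¬ (i : ℕ) < p) = {k, l} := by
      obtain ⟨a, b, hab, hT⟩ := Finset.card_eq_two.1 hT
      rcases lt_or_gt_of_ne hab with h1 | h1
      · exact ⟨a, b, h1, hT⟩
      · exact ⟨b, a, h1, by rw [hT, Finset.pair_comm]⟩
    have hmem : ∀ i, i ∈ σ ↔ (i : ℕ) < p ∨ i = k ∨ i = l := by
      intro i
      have h1 := Finset.ext_iff.1 hTkl i
      simp only [Finset.mem_filter, Finset.mem_insert, Finset.mem_singleton] at h1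
      by_cases hi : (i : ℕ) < p
      · exact ⟨fun _ => Or.inl hi, fun _ => h i hi⟩
      · constructor
        · exact fun h2 => Or.inr (h1.1 ⟨h2, hi⟩)
        · rintro (h2 | h2)
          · exact absurd h2 hi
          · exact (h1.2 h2).1
    have hk : p ≤ (k : ℕ) := by
      have h1 : k ∈ σ.filter fun i : Fin (n + 1) => ¬ (i : ℕ) < p := by rw [hTkl]; simp
      exact not_lt.1 (Finset.mem_filter.1 h1).2
    have hkσ : k ∈ σ := (hmem k).2 (Or.inr (Or.inl rfl))
    have hlσ : l ∈ σ := (hmem l).2 (Or.inr (Or.inr rfl))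
    have hkl' : (k : ℕ) < l := hkl
    have hz : ∀ v ∈ σ, v ∉ ({k, l} : Finset (Fin (n + 1))) →
        sgn σ v • label p (σ.erase v) = 0 := by
      intro v hv hv'
      simp only [Finset.mem_insert, Finset.mem_singleton, not_or] at hv'
      have hvp : (v : ℕ) < p := by
        rcases (hmem v).1 hv with h1 | h1 | h1
        · exact h1
        · exact absurd h1 hv'.1
        · exact absurd h1 hv'.2
      have : label p (σ.erase v) = 0 := if_neg fun h1 => by simpa using h1 v hvp
      rw [this, smul_zero]
    rw [← Finset.sum_subset (s₁ := {k, l})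
      (by simp [Finset.insert_subset_iff, hkσ, hlσ]) hz, Finset.sum_pair hkl.ne]
    have hfk : σ.filter (· < k) = Finset.univ.filter fun i : Fin (n + 1) => (i : ℕ) < p := by
      ext i
      simp only [Finset.mem_filter, Finset.mem_univ, true_and, hmem]
      constructor
      · rintro ⟨h1 | rfl | rfl, h2⟩
        · exact h1
        · exact absurd h2 (lt_irrefl _)
        · exact absurd h2 hkl.not_gt
      · exact fun h1 => ⟨Or.inl h1, Fin.lt_def.2 (by omega)⟩
    have hfl : σ.filter (· < l) =
        insert k (Finset.univ.filter fun i : Fin (n + 1) => (i : ℕ) < p) := by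
      ext i
      simp only [Finset.mem_filter, Finset.mem_univ, true_and, hmem, Finset.mem_insert]
      constructor
      · rintro ⟨h1 | rfl | rfl, h2⟩
        · exact Or.inr h1
        · exact Or.inl rfl
        · exact absurd h2 (lt_irrefl _)
      · rintro (rfl | h1)
        · exact ⟨Or.inr (Or.inl rfl), hkl⟩
        · exact ⟨Or.inl h1, Fin.lt_def.2 (by omega)⟩
    have hsk : sgn σ k = (-1) ^ (p + 1) := by
      unfold sgn; rw [hfk, card_below (by omega)]
    have hsl : sgn σ l = (-1) ^ (p + 2) := by
      unfold sgn
      rw [hfl, Finset.card_insert_of_notMem (by simp [hk]), card_below (by omega)]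
    have hlk : label p (σ.erase k) = Pi.single (decide (Odd p)) 1 := by
      unfold label
      rw [if_pos, if_neg]
      · rintro ⟨i, hi, hip⟩
        rw [Finset.mem_erase, hmem] at hi
        rcases hi.2 with h1 | h1 | h1
        · omega
        · exact hi.1 h1
        · subst h1; omega
      · intro i hi
        rw [Finset.mem_erase]
        exact ⟨fun h1 => by subst h1; omega, h i hi⟩
    have hll : label p (σ.erase l) =
        Pi.single (if (k : ℕ) = p then decide (Odd (p + 1)) else decide (Odd p)) 1 := by
      unfold label
      rw [if_pos]
      · congr 1
        refine if_congr ?_ rfl rfl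
        constructor
        · rintro ⟨i, hi, hip⟩
          rw [Finset.mem_erase, hmem] at hi
          rcases hi.2 with h1 | h1 | h1
          · omega
          · rw [← h1, hip]
          · exact absurd h1 hi.1
        · exact fun h1 => ⟨k, Finset.mem_erase.2 ⟨hkl.ne, hkσ⟩, h1⟩
      · intro i hi
        rw [Finset.mem_erase]
        exact ⟨fun h1 => by subst h1; omega, h i hi⟩
    rw [hsk, hsl, hlk, hll]
    by_cases hkp : (k : ℕ) = p
    · have hl1 : ∃ β, label (p + 1) σ = Pi.single β 1 := by
        refine ⟨_, if_pos fun i hi => ?_⟩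
        rw [hmem]
        rcases Nat.lt_succ_iff_lt_or_eq.1 hi with h1 | h1
        · exact Or.inl h1
        · exact Or.inr (Or.inl (Fin.ext (h1.trans hkp.symm)))
      obtain ⟨β, hβ⟩ := hl1
      rw [hβ, globeBd_single, if_pos hkp]
      rcases Nat.even_or_odd p with ho | ho
      · have h1 : ¬ Odd p := Nat.not_odd_iff_even.2 ho
        have h2 : Odd (p + 1) := ho.add_one
        rw [decide_eq_false h1, decide_eq_true h2, pow_succ, pow_succ, pow_succ, ho.neg_one_pow]
        simp
        abel
      · have h2 : ¬ Odd (p + 1) := Nat.not_odd_iff_even.2 ho.add_one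
        rw [decide_eq_true ho, decide_eq_false h2, pow_succ, pow_succ, pow_succ, ho.neg_one_pow]
        simp
        abel
    · rw [if_neg hkp]
      have hl0 : label (p + 1) σ = 0 := by
        refine if_neg fun h1 => ?_
        have h2 := h1 ⟨p, by omega⟩ (Nat.lt_succ_self p)
        rw [hmem] at h2
        rcases h2 with h3 | h3 | h3
        · exact absurd h3 (lt_irrefl p)
        · exact hkp (by rw [← h3])
        · have : p = (l : ℕ) := by rw [← h3]
          omega
      rw [hl0, map_zero, ← add_smul, pow_succ (-1 : ℤ) (p + 1)]
      simp
  · push Not at h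
    obtain ⟨i, hip, hi⟩ := h
    have h0 : label (p + 1) σ = 0 := if_neg fun h1 => hi (h1 i (by omega))
    rw [h0, map_zero]
    refine (Finset.sum_eq_zero fun v _ => ?_).symm
    have : label p (σ.erase v) = 0 :=
      if_neg fun h1 => hi (Finset.mem_of_mem_erase (h1 i hip))
    rw [this, smul_zero]

theorem label_nonneg (p : ℕ) (σ : Finset (Fin (n + 1))) (α : Bool) : 0 ≤ label p σ α := by
  classical
  unfold label
  split_ifs
  all_goals first | (rw [Pi.single_apply]; split_ifs <;> simp) | simp

/-- The collapse of the `n`-simplex onto the globe, as a morphism of augmented directed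
complexes. -/
noncomputable def collapse (n : ℕ) : ADC.Hom (adc n) Globe.adc where
  app p := (collapseApp n p).toAddMonoidHom
  bd_app p c := by
    change globeBd (collapseApp n (p + 1) c) = collapseApp n p (bd n p c)
    suffices h : globeBd.comp (collapseApp n (p + 1)) = (collapseApp n p).comp (bd n p) from
      LinearMap.congr_fun h c
    refine Finsupp.lhom_ext' fun σ => LinearMap.ext_ring ?_
    obtain ⟨σ, hσ⟩ := σ
    simp only [LinearMap.comp_apply, Finsupp.lsingle_apply]
    rw [← e_of_card hσ, bd_e hσ, collapseApp_e hσ, map_sum, globeBd_label p hσ]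
    refine Finset.sum_congr rfl fun v hv => ?_
    rw [map_smul, collapseApp_e (by rw [Finset.card_erase_of_mem hv, hσ]; rfl)]
  aug_app c := by
    change collapseApp n 0 c false + collapseApp n 0 c true = aug n c
    let s : (Bool → ℤ) →ₗ[ℤ] ℤ := LinearMap.proj (R := ℤ) (φ := fun _ : Bool => ℤ) false +
      LinearMap.proj (R := ℤ) (φ := fun _ : Bool => ℤ) true
    suffices h : s.comp (collapseApp n 0) = aug n from LinearMap.congr_fun h c
    refine Finsupp.lhom_ext' fun σ => LinearMap.ext_ring ?_
    obtain ⟨σ, hσ⟩ := σ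
    simp only [LinearMap.comp_apply, Finsupp.lsingle_apply]
    rw [← e_of_card hσ, collapseApp_e hσ, aug_e hσ]
    have : ∃ β, label 0 σ = Pi.single β 1 := ⟨_, if_pos fun i hi => absurd hi (Nat.not_lt_zero _)⟩
    obtain ⟨β, hβ⟩ := this
    rw [hβ]
    cases β <;> simp [s]
  pos_app p c hc := by
    intro α
    let c' : Face n p →₀ ℤ := c
    change 0 ≤ Finsupp.linearCombination ℤ (fun σ : Face n p => label p σ.1) c' α
    rw [Finsupp.linearCombination_apply, Finsupp.sum, Finset.sum_apply]
    exact Finset.sum_nonneg fun σ _ => mul_nonneg (hc σ) (label_nonneg p σ.1 α)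

theorem collapse_top (n : ℕ) :
    ∃ β, (ADC.Cell.map (collapse n)).toFun (top n) = Globe.atom n β := by
  obtain ⟨p, α, hp⟩ := Globe.exists_atom ((ADC.Cell.map (collapse n)).toFun (top n))
  rw [hp]
  have h1 : ∃ β, ∀ γ, Globe.atomX p α n γ = Pi.single β 1 := by
    have : ∃ β, label n (Finset.univ : Finset (Fin (n + 1))) = Pi.single β 1 :=
      ⟨_, if_pos fun i _ => Finset.mem_univ i⟩
    obtain ⟨β, hβ⟩ := this
    refine ⟨β, fun γ => ?_⟩
    rw [← Globe.atom_x, ← hp]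
    change collapseApp n n (topChain n n γ) = _
    rw [topChain_self, collapseApp_e (by simp), hβ]
  obtain ⟨β, hβ⟩ := h1
  have h2 : n = p := by
    rcases lt_trichotomy n p with h | h | h
    · have h3 := hβ true
      have h4 := hβ false
      simp only [Globe.atomX, h, if_true] at h3 h4
      exact absurd ((Globe.single_inj h3).trans (Globe.single_inj h4).symm) (by simp)
    · exact h
    · have h3 := hβ true
      simp only [Globe.atomX, show ¬ n < p by omega, show ¬ n = p by omega, if_false] at h3
      exact absurd h3.symm (Globe.single_ne β)
  exact ⟨α, by rw [h2]⟩

end Simplex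

section box
variable {D : Type u} [OmegaCategory D]

/-- The `n`-simplex `□(u) : Δ^n → D` of an element `u` of dimension at most `n`. It takes the value
`u` on the top element, a face with initial segment exactly `{0, …, j - 1}` (with `j ≤ n` missing)
is sent to `d_{j-1}^{(-)^j} u` if it has no further vertex and to `d_j^{(-)^j} u` otherwise, where
`(-)^j` is `-` for even `j` and `+` for odd `j`. It satisfies `ev □(u) = u`, it is natural in `D`,
and on elements `u` of dimension at most `n` the `(n + 1)`-simplex of `u` is the degeneracy `ε_n` of
its `n`-simplex. -/
noncomputable def box (n : ℕ) (u : D) : Nerve D n :=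
  (ADC.Cell.map (Simplex.collapse n)).trans (Globe.eval u)

theorem ev_box {n : ℕ} {u : D} (hu : DimLE n u) : Nerve.ev (box n u) = u := by
  obtain ⟨β, hβ⟩ := Simplex.collapse_top n
  change (Globe.eval u).toFun ((ADC.Cell.map (Simplex.collapse n)).toFun (Simplex.top n)) = u
  rw [hβ, Globe.eval_atom, hu]

theorem box_trans {E : Type u} [OmegaCategory E] (n : ℕ) (u : D) (f : OmegaFunctor D E) :
    (box n u).trans f = box n (f.toFun u) := by
  apply OmegaFunctor.ext
  funext c
  exact f.map_d _ _ u

theorem box_succ {n : ℕ} {u : D} (hu : DimLE n u) :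
    box (n + 1) u = Nerve.degen (Fin.last n) (box n u) := by
  apply OmegaFunctor.ext
  funext c
  let z := (ADC.Cell.map (Simplex.collapse (n + 1))).toFun c
  let z' := (ADC.Cell.map (Simplex.collapse n)).toFun
    ((Simplex.map (Fin.last n).predAboveOrderHom).toFun c)
  change (Globe.eval u).toFun z = (Globe.eval u).toFun z'
  have hlow : ∀ q < n, ∀ β, z.x q β = z'.x q β := by
    intro q hq β
    change Simplex.collapseApp (n + 1) q (c.x q β) =
      Simplex.collapseApp n q (Simplex.push _ q (c.x q β))
    suffices h : Simplex.collapseApp (n + 1) q = (Simplex.collapseApp n q).comp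
        (Simplex.push (Fin.last n).predAboveOrderHom q) from LinearMap.congr_fun h _
    refine Finsupp.lhom_ext' fun σ => LinearMap.ext_ring ?_
    obtain ⟨σ, hσ⟩ := σ
    simp only [LinearMap.comp_apply, Finsupp.lsingle_apply]
    rw [← Simplex.e_of_card hσ, Simplex.collapseApp_e hσ, Simplex.push_e _ hσ]
    have himg : ∀ i : Fin (n + 2), (i : ℕ) < n + 1 →
        (((Fin.last n).predAboveOrderHom i : Fin (n + 1)) : ℕ) = i := by
      intro i hi
      change ((Fin.last n).predAbove i : ℕ) = i
      rw [Fin.predAbove_of_le_castSucc _ _ (Fin.le_def.2 (by simpa using Nat.lt_succ_iff.1 hi))]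
      rfl
    have himg' : (((Fin.last n).predAboveOrderHom (Fin.last (n + 1)) : Fin (n + 1)) : ℕ) = n := by
      change ((Fin.last n).predAbove (Fin.last (n + 1)) : ℕ) = n
      simp
    have hval : ∀ i : Fin (n + 2), (((Fin.last n).predAboveOrderHom i : Fin (n + 1)) : ℕ) =
        if (i : ℕ) = n + 1 then n else i := by
      intro i
      split_ifs with h
      · rw [show i = Fin.last (n + 1) from Fin.ext h]; exact himg'
      · exact himg i (by omega)
    by_cases hinj : (σ.image (Fin.last n).predAboveOrderHom).card = q + 1
    · rw [Simplex.collapseApp_e hinj]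
      have hmem : ∀ (j : ℕ), j < n → ((∃ i ∈ σ, (i : ℕ) = j) ↔
          ∃ i ∈ σ.image (Fin.last n).predAboveOrderHom, (i : ℕ) = j) := by
        intro j hj
        constructor
        · rintro ⟨i, hi, hij⟩
          refine ⟨_, Finset.mem_image_of_mem _ hi, ?_⟩
          rw [hval, if_neg (by omega), hij]
        · rintro ⟨i, hi, hij⟩
          obtain ⟨k, hk, rfl⟩ := Finset.mem_image.1 hi
          refine ⟨k, hk, ?_⟩
          rw [hval] at hij
          split_ifs at hij with h
          · omega
          · exact hij
      have hall : ∀ {m : ℕ} (τ : Finset (Fin (m + 1))), q ≤ m + 1 →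
          ((∀ i : Fin (m + 1), (i : ℕ) < q → i ∈ τ) ↔ ∀ j < q, ∃ i ∈ τ, (i : ℕ) = j) := by
        intro m τ hq
        constructor
        · exact fun h j hj => ⟨⟨j, by omega⟩, h _ hj, rfl⟩
        · intro h i hi
          obtain ⟨k, hk, hki⟩ := h i hi
          rwa [← Fin.ext hki]
      unfold Simplex.label
      refine if_congr ?_ ?_ rfl
      · rw [hall _ (by omega), hall _ (by omega)]
        exact forall_congr' fun j => forall_congr' fun hj => hmem j (by omega)
      · congr 1
        exact if_congr (hmem q hq) rfl rfl
    · rw [Simplex.e_of_card_ne hinj, map_zero]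
      refine if_neg fun h => hinj ?_
      rw [← hσ]
      refine Finset.card_image_iff.2 fun a ha b hb hab => ?_
      have hab' := congrArg Fin.val hab
      rw [hval, hval] at hab'
      -- `σ` cannot contain both of the last two vertices
      have hcon : ∀ a b : Fin (n + 2), a ∈ σ → b ∈ σ → (a : ℕ) = n + 1 → (b : ℕ) = n → False := by
        intro a b ha hb han hbn
        have h1 : insert a (insert b (Finset.univ.filter fun i : Fin (n + 1 + 1) => (i : ℕ) < q)) ⊆ σ := by
          intro i hi
          simp only [Finset.mem_insert, Finset.mem_filter, Finset.mem_univ, true_and] at hi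
          rcases hi with rfl | rfl | hi
          · exact ha
          · exact hb
          · exact h i hi
        have h2 := Finset.card_le_card h1
        rw [Finset.card_insert_of_notMem, Finset.card_insert_of_notMem,
          Simplex.card_below (by omega), hσ] at h2
        · omega
        · simp; omega
        · have hne : a ≠ b := fun h' => by rw [h'] at han; omega
          simp [hne]; omega
      have hb' := b.is_lt
      have ha' := a.is_lt
      split_ifs at hab' with h1 h2 h2
      · exact Fin.ext (h1.trans h2.symm)
      · exact (hcon a b ha hb h1 hab'.symm).elim
      · exact (hcon b a hb ha h2 hab').elim
      · exact Fin.ext hab'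
  obtain ⟨p, α, hz⟩ := Globe.exists_atom z
  obtain ⟨p', α', hz'⟩ := Globe.exists_atom z'
  rw [hz, hz'] at hlow
  rw [hz, hz', Globe.eval_atom, Globe.eval_atom]
  simp only [Globe.atom_x] at hlow
  have aux : ∀ {p p' : ℕ} {α α' : Bool}, p < p' → p < n →
      (∀ q < n, ∀ β, Globe.atomX p α q β = Globe.atomX p' α' q β) → False := by
    intro p p' α α' h1 h2 h
    have h3 := h p h2 true
    have h4 := h p h2 false
    simp only [Globe.atomX, lt_irrefl, if_false, h1, if_true] at h3 h4
    exact absurd ((Globe.single_inj h3).symm.trans (Globe.single_inj h4)) (by simp)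
  by_cases hp : p < n
  · rcases lt_trichotomy p p' with h | h | h
    · exact (aux h hp hlow).elim
    · subst h
      have h3 := hlow p hp true
      simp only [Globe.atomX, lt_irrefl, if_false, if_true] at h3
      rw [Globe.single_inj h3]
    · exact (aux h (by omega) fun q hq β => (hlow q hq β).symm).elim
  · by_cases hp' : p' < n
    · exact (aux (by omega) hp' fun q hq β => (hlow q hq β).symm).elim
    · rw [hu.mono (not_lt.1 hp), hu.mono (not_lt.1 hp')]

end box
end Globular

namespace Globular

open OmegaCategory

/-! ### The reduced branching semi-globular complex -/

/-- The folding operator `Φ = □ ∘ ev` on simplices. -/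
noncomputable def Nerve.folding {D : Type u} [OmegaCategory D] {n : ℕ} (x : Nerve D n) :
    Nerve D n :=
  box n (Nerve.ev x)

section reduced
variable (C : Type u) [OmegaCategory C] [NonContracting C]

/-- The simplices of the augmented simplicial nerve `N^{gl-}(C)`, shifted by one: the objects of `C`
in degree `0` (the simplices of dimension `-1`) and the `n`-simplices of the simplicial nerve of
`ℙ^-C` in degree `n + 1`. -/
def Gens : ℕ → Type u
  | 0 => Obj C
  | n + 1 => Nerve (SemiPath C) n

/-- The unreduced chain groups. -/
abbrev Chains (n : ℕ) : Type u := FreeAbelianGroup (Gens C n)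

variable {C} in
/-- An object of `C` as a chain of degree `0`. -/
def Chains.ofObj (a : Obj C) : Chains C 0 := FreeAbelianGroup.of (α := Gens C 0) a

variable {C} in
/-- An `n`-simplex of the nerve of `ℙ^-C` as a chain of degree `n + 1`. -/
def Chains.ofSimplex {n : ℕ} (x : Nerve (SemiPath C) n) : Chains C (n + 1) :=
  FreeAbelianGroup.of (α := Gens C (n + 1)) x

/-- The simplicial boundary of a simplex: `s_0` in degree `1` and `∑ (-1)^i ∂_i` above. -/
noncomputable def bdSimplex : ∀ n : ℕ, Nerve (SemiPath C) n → Chains C n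
  | 0, x => Chains.ofObj (SemiPath.src (Nerve.ev x))
  | n + 1, x => ∑ i : Fin (n + 2), (-1 : ℤ) ^ (i : ℕ) • Chains.ofSimplex (Nerve.face i x)

/-- The simplicial boundary. -/
noncomputable def bd (n : ℕ) : Chains C (n + 1) →+ Chains C n :=
  FreeAbelianGroup.lift (α := Gens C (n + 1)) (bdSimplex C n)

variable {C}

theorem bd_ofSimplex {n : ℕ} (x : Nerve (SemiPath C) n) :
    bd C n (Chains.ofSimplex x) = bdSimplex C n x :=
  FreeAbelianGroup.lift_apply_of (α := Gens C (n + 1)) _ _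

theorem Chains.hom_ext {A : Type v} [AddCommGroup A] {n : ℕ} {f g : Chains C (n + 1) →+ A}
    (h : ∀ x : Nerve (SemiPath C) n, f (Chains.ofSimplex x) = g (Chains.ofSimplex x)) : f = g :=
  FreeAbelianGroup.lift_ext _ _ h

theorem Nerve.ev_face_zero {D : Type u} [OmegaCategory D] (i : Fin 2) (x : Nerve D 1) :
    ∃ α, Nerve.ev (Nerve.face i x) = d 0 α (Nerve.ev x) := by
  refine ⟨decide (i = 1), ?_⟩
  unfold Nerve.ev
  rw [← x.map_d]
  refine congrArg x.toFun (ADC.Cell.ext' fun p β => ?_)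
  change Simplex.push _ p (Simplex.topChain 0 p β) =
    (ADC.Cell.dOp 0 (decide (i = 1)) (Simplex.top 1)).x p β
  rw [ADC.Cell.dOp_x]
  rcases Nat.eq_zero_or_pos p with rfl | hp
  · rw [if_neg (lt_irrefl 0), if_pos rfl]
    change _ = Simplex.topChain 1 0 (decide (i = 1))
    rw [Simplex.topChain_zero, Simplex.topChain_zero, Simplex.push_e _ (Finset.card_singleton _),
      Finset.image_singleton]
    congr 2
    fin_cases i <;> cases β <;> rfl
  · rw [if_neg (Nat.not_lt_zero p), if_neg hp.ne', Simplex.topChain_eq_zero hp, map_zero]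
    rfl

theorem bd_bd (n : ℕ) (c : Chains C (n + 2)) : bd C n (bd C (n + 1) c) = 0 := by
  suffices h : (bd C n).comp (bd C (n + 1)) = 0 from DFunLike.congr_fun h c
  refine Chains.hom_ext fun x => ?_
  change bd C n (bd C (n + 1) (Chains.ofSimplex x)) = 0
  rw [bd_ofSimplex, bdSimplex, map_sum]
  simp only [map_zsmul, bd_ofSimplex]
  cases n with
  | zero =>
    have h : ∀ i : Fin 2, bdSimplex C 0 (Nerve.face i x) =
        Chains.ofObj (SemiPath.src (Nerve.ev x)) := by
      intro i
      obtain ⟨α, hα⟩ := Nerve.ev_face_zero i x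
      rw [bdSimplex, hα, SemiPath.src_d]
    rw [Fin.sum_univ_two, h 0, h 1]
    simp
  | succ n =>
    simp only [bdSimplex]
    simp only [Finset.smul_sum, smul_smul]
    rw [Finset.sum_comm, ← Finset.sum_product']
    let P := Fin (n + 2) × Fin (n + 3)
    let S : Finset P := {ij : P | (ij.2 : ℕ) ≤ (ij.1 : ℕ)}
    rw [Finset.univ_product_univ, ← Finset.sum_add_sum_compl S, ← eq_neg_iff_add_eq_zero,
      ← Finset.sum_neg_distrib]
    let φ : ∀ ij : P, ij ∈ S → P := fun ij hij =>
      (Fin.castLT ij.2 (lt_of_le_of_lt (Finset.mem_filter.mp hij).right (Fin.is_lt ij.1)),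
        ij.1.succ)
    apply Finset.sum_bij φ
    · intro ij hij
      simp_rw [S, φ, Finset.compl_filter, Finset.mem_filter_univ, Fin.val_succ,
        Fin.val_castLT] at hij ⊢
      lia
    · rintro ⟨i, j⟩ hij ⟨i', j'⟩ hij' h
      rw [Prod.mk_inj]
      exact ⟨by simpa [φ] using! congr_arg Prod.snd h,
        by simpa [φ, Fin.castSucc_castLT] using! congr_arg Fin.castSucc (congr_arg Prod.fst h)⟩
    · rintro ⟨i', j'⟩ hij'
      simp_rw [S, Finset.compl_filter, Finset.mem_filter_univ, not_le] at hij'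
      refine ⟨(j'.pred <| ?_, Fin.castSucc i'), ?_, ?_⟩
      · rintro rfl
        simp only [Fin.val_zero, not_lt_zero] at hij'
      · simpa [S] using! Nat.le_sub_one_of_lt hij'
      · simp only [φ, Fin.castLT_castSucc, Fin.succ_pred]
    · rintro ⟨i, j⟩ hij
      dsimp only
      rw [← neg_smul]
      congr 1
      · simp only [φ, Fin.val_succ, pow_add, pow_one, mul_neg, neg_mul, neg_neg, mul_one]
        apply mul_comm
      · have hij' : (j : ℕ) ≤ i := by simpa [S] using hij
        have h := Nerve.face_face (i := Fin.castLT j (lt_of_le_of_lt hij' i.is_lt)) (j := i)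
          (Fin.le_def.2 hij') x
        rw [Fin.castSucc_castLT] at h
        exact congrArg Chains.ofSimplex h.symm

variable (C)

/-- The subgroup `M_n` generated by the thin elements: the simplices `x` in degree `n` whose
evaluation has dimension smaller than the dimension `n - 1` of the simplex. -/
def thin : ∀ n : ℕ, AddSubgroup (Chains C n)
  | 0 => ⊥
  | 1 => ⊥
  | n + 2 => AddSubgroup.closure
      {c | ∃ x : Nerve (SemiPath C) (n + 1), DimLE n (Nerve.ev x) ∧
        c = Chains.ofSimplex x}

/-- The subgroup `M_n + ∂ M_{n+1}`. -/
noncomputable def reducedRel (n : ℕ) : AddSubgroup (Chains C n) := thin C n ⊔ (thin C (n + 1)).map (bd C n)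

/-- The group `CR_n^{gl-}(C) = C_n^{gl-}(C) / (M_n + ∂ M_{n+1})`. -/
abbrev CRGroup (n : ℕ) : Type u := Chains C n ⧸ reducedRel C n

/-- The differential of the reduced complex. -/
noncomputable def CRd (n : ℕ) : CRGroup C (n + 1) →+ CRGroup C n :=
  QuotientAddGroup.map (reducedRel C (n + 1)) (reducedRel C n) (bd C n) (by
    refine sup_le (fun c hc => ?_) ?_
    · exact AddSubgroup.mem_sup_right (AddSubgroup.mem_map_of_mem _ hc)
    · rintro _ ⟨c, _, rfl⟩
      rw [AddSubgroup.mem_comap, bd_bd]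
      exact zero_mem _)

theorem CRd_CRd (n : ℕ) : (CRd C n).comp (CRd C (n + 1)) = 0 := by
  refine AddMonoidHom.ext fun c => ?_
  obtain ⟨c, rfl⟩ := QuotientAddGroup.mk_surjective c
  change ((bd C n (bd C (n + 1) c) : Chains C n) : CRGroup C n) = 0
  rw [bd_bd]
  rfl

/-- The reduced branching semi-globular complex `CR^{gl-}(C)`. -/
noncomputable def CR : ChainComplex AddCommGrpCat.{u} ℕ :=
  ChainComplex.of (fun n => AddCommGrpCat.of (CRGroup C n)) (fun n => AddCommGrpCat.ofHom (CRd C n))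
    fun n => by
      rw [← AddCommGrpCat.ofHom_comp, CRd_CRd]
      rfl

theorem CR_d (n : ℕ) : (CR C).d (n + 1) n = AddCommGrpCat.ofHom (CRd C n) :=
  ChainComplex.of_d (fun n => AddCommGrpCat.of (CRGroup C n))
    (fun n => AddCommGrpCat.ofHom (CRd C n)) n

variable {C}

/-- The class of an object of `C` in `CR_0^{gl-}(C)`. -/
noncomputable def CR.ofObj (a : Obj C) : CRGroup C 0 :=
  QuotientAddGroup.mk (Chains.ofObj a)

/-- The class of an `n`-simplex of the branching semi-globular nerve in `CR_{n+1}^{gl-}(C)`. -/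
noncomputable def CR.ofSimplex {n : ℕ} (x : Nerve (SemiPath C) n) : CRGroup C (n + 1) :=
  QuotientAddGroup.mk (Chains.ofSimplex x)

/-- The simplex `□_{n+1}^{gl-}(h^-(x))` for `x` in `ℙC`, which is also denoted by
`Φ^{gl-}(h^-(x))` when `x` is an `(n + 1)`-dimensional morphism of `C`. -/
noncomputable def boxMinus (n : ℕ) (x : Path C) : Nerve (SemiPath C) n :=
  box n ((hMinus C).toFun x)

/-- `□_{n+1}^{gl-}(h^-(x))` is the value of the folding operator on every simplex whose evaluation is
`h^-(x)`. -/
theorem folding_eq_boxMinus {n : ℕ} {x : Path C} {s : Nerve (SemiPath C) n}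
    (h : Nerve.ev s = (hMinus C).toFun x) : Nerve.folding s = boxMinus n x := by
  unfold Nerve.folding boxMinus
  rw [h]

/-- For `x` of dimension at most `n + 1` in `C`, such simplices exist. -/
theorem ev_boxMinus {n : ℕ} {x : Path C} (h : DimLE (n + 1) x.val) :
    Nerve.ev (boxMinus n x) = (hMinus C).toFun x :=
  ev_box ((hMinus C).dimLE fun α => Path.ext (h α))

end reduced

/-! ### The formal negative corner complex -/

section formal
variable (C : Type u) [OmegaCategory C]

/-- Generators of the formal corner complex: objects in degree `0`, and in degree `n + 1` the
morphisms of `C` of dimension at least `1` and at most `n + 1`. (Those of dimension at most `n` will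
be set to zero.) -/
def CFGens : ℕ → Type u
  | 0 => Obj C
  | n + 1 => {x : Path C // DimLE (n + 1) x.val}

/-- Relations of the formal corner complex in degree `n + 1`: the morphisms of dimension at most `n`
are zero, `x *_0 y = x`, and `x *_r y = x + y` for `1 ≤ r ≤ n`. -/
def CFRel : ∀ n : ℕ, Set (FreeAbelianGroup (CFGens C n))
  | 0 => ∅
  | n + 1 =>
    {c | ∃ x : {x : Path C // DimLE (n + 1) x.val}, DimLE n x.1.val ∧
      c = FreeAbelianGroup.of (α := CFGens C (n + 1)) x} ∪
    {c | ∃ x y z : {x : Path C // DimLE (n + 1) x.val}, Composable 0 x.1.val y.1.val ∧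
      z.1.val = comp 0 x.1.val y.1.val ∧
      c = FreeAbelianGroup.of (α := CFGens C (n + 1)) z -
        FreeAbelianGroup.of (α := CFGens C (n + 1)) x} ∪
    {c | ∃ r : ℕ, 1 ≤ r ∧ r ≤ n ∧ ∃ x y z : {x : Path C // DimLE (n + 1) x.val},
      Composable r x.1.val y.1.val ∧ z.1.val = comp r x.1.val y.1.val ∧
      c = FreeAbelianGroup.of (α := CFGens C (n + 1)) z -
        (FreeAbelianGroup.of (α := CFGens C (n + 1)) x +
          FreeAbelianGroup.of (α := CFGens C (n + 1)) y)}

/-- The group `CF_n^-(C)`. -/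
abbrev CFGroup (n : ℕ) : Type u :=
  FreeAbelianGroup (CFGens C n) ⧸ AddSubgroup.closure (CFRel C n)

variable {C}

/-- The class of an object of `C` in `CF_0^-(C)`. -/
def CF.ofObj (a : Obj C) : CFGroup C 0 :=
  QuotientAddGroup.mk (FreeAbelianGroup.of (α := CFGens C 0) a)

/-- The class in `CF_{n+1}^-(C)` of a morphism of `C` of dimension at least `1` and at most
`n + 1`. -/
def CF.ofPath {n : ℕ} (x : Path C) (hx : DimLE (n + 1) x.val) : CFGroup C (n + 1) :=
  QuotientAddGroup.mk (FreeAbelianGroup.of (α := CFGens C (n + 1)) ⟨x, hx⟩)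

theorem CF.eq_zero {n : ℕ} {c : FreeAbelianGroup (CFGens C n)} (h : c ∈ CFRel C n) :
    (QuotientAddGroup.mk c : CFGroup C n) = 0 :=
  (QuotientAddGroup.eq_zero_iff c).2 (AddSubgroup.subset_closure h)

theorem CF.ofPath_lower {n : ℕ} {x : Path C} (hx : DimLE (n + 1) x.val) (h : DimLE n x.val) :
    CF.ofPath x hx = 0 :=
  CF.eq_zero (Or.inl (Or.inl ⟨⟨x, hx⟩, h, rfl⟩))

theorem CF.ofPath_comp_zero {n : ℕ} {x y z : Path C} (hx : DimLE (n + 1) x.val)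
    (hy : DimLE (n + 1) y.val) (hz : DimLE (n + 1) z.val) (h : Composable 0 x.val y.val)
    (h' : z.val = comp 0 x.val y.val) : CF.ofPath z hz = CF.ofPath x hx :=
  sub_eq_zero.1 (CF.eq_zero (Or.inl (Or.inr ⟨⟨x, hx⟩, ⟨y, hy⟩, ⟨z, hz⟩, h, h', rfl⟩)))

theorem CF.ofPath_comp {n r : ℕ} (h1 : 1 ≤ r) (hr : r ≤ n) {x y z : Path C}
    (hx : DimLE (n + 1) x.val) (hy : DimLE (n + 1) y.val) (hz : DimLE (n + 1) z.val)
    (h : Composable r x.val y.val) (h' : z.val = comp r x.val y.val) :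
    CF.ofPath z hz = CF.ofPath x hx + CF.ofPath y hy :=
  sub_eq_zero.1 (CF.eq_zero (Or.inr ⟨r, h1, hr, ⟨x, hx⟩, ⟨y, hy⟩, ⟨z, hz⟩, h, h', rfl⟩))

/-- Homomorphisms out of `CF_{n+1}^-(C)`. -/
noncomputable def CF.desc {A : Type v} [AddCommGroup A] {n : ℕ}
    (g : {x : Path C // DimLE (n + 1) x.val} → A)
    (h0 : ∀ x, DimLE n x.1.val → g x = 0)
    (h1 : ∀ x y z : {x : Path C // DimLE (n + 1) x.val}, Composable 0 x.1.val y.1.val → z.1.val = comp 0 x.1.val y.1.val → g z = g x)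
    (h2 : ∀ r, 1 ≤ r → r ≤ n → ∀ x y z : {x : Path C // DimLE (n + 1) x.val}, Composable r x.1.val y.1.val →
      z.1.val = comp r x.1.val y.1.val → g z = g x + g y) : CFGroup C (n + 1) →+ A :=
  QuotientAddGroup.lift _ (FreeAbelianGroup.lift (α := CFGens C (n + 1)) g) (by
    have hof := fun x => FreeAbelianGroup.lift_apply_of (α := CFGens C (n + 1)) g x
    rw [AddSubgroup.closure_le]
    rintro c ((⟨x, hx, rfl⟩ | ⟨x, y, z, h, h', rfl⟩) | ⟨r, hr1, hr2, x, y, z, h, h', rfl⟩)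
    · exact (hof x).trans (h0 x hx)
    · refine (map_sub _ _ _).trans (sub_eq_zero.2 ?_)
      exact (hof z).trans ((h1 x y z h h').trans (hof x).symm)
    · refine (map_sub _ _ _).trans (sub_eq_zero.2 ?_)
      refine (hof z).trans ((h2 r hr1 hr2 x y z h h').trans ?_)
      exact (congrArg₂ (· + ·) (hof x) (hof y)).symm.trans (map_add _ _ _).symm)

theorem CF.desc_ofPath {A : Type v} [AddCommGroup A] {n : ℕ}
    (g : {x : Path C // DimLE (n + 1) x.val} → A) (h0) (h1) (h2) (x : Path C)
    (hx : DimLE (n + 1) x.val) :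
    CF.desc (C := C) g h0 h1 h2 (CF.ofPath x hx) = g ⟨x, hx⟩ :=
  FreeAbelianGroup.lift_apply_of (α := CFGens C (n + 1)) g ⟨x, hx⟩

theorem CF.hom_ext {A : Type v} [AddCommGroup A] {n : ℕ} {f g : CFGroup C (n + 1) →+ A}
    (h : ∀ x hx, f (CF.ofPath x hx) = g (CF.ofPath x hx)) : f = g := by
  refine QuotientAddGroup.addMonoidHom_ext _ (FreeAbelianGroup.lift_ext _ _ fun x => ?_)
  exact h x.1 x.2

variable (C) [NonContracting C]

/-- The differential of the formal corner complex: `s_0` from degree `1` to degree `0` and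
`s_{n+1} - t_{n+1}` from degree `n + 2` to degree `n + 1`. (The degrees of `ℙC` are shifted by
one.) -/
noncomputable def CFd : ∀ n : ℕ, CFGroup C (n + 1) →+ CFGroup C n
  | 0 => CF.desc (fun x => CF.ofObj (srcObj x.1.val))
      (fun x hx => absurd hx x.1.dim)
      (fun x y z h h' => congrArg CF.ofObj (Obj.ext (by
        change d 0 false z.1.val = d 0 false x.1.val
        rw [h', d_src _ _ _ h])))
      (fun r h1 h2 => absurd h1 (by omega))
  | n + 1 => CF.desc
      (fun x => CF.ofPath (d n false x.1) (dimLE_d (n + 1) false x.1.val) -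
        CF.ofPath (d n true x.1) (dimLE_d (n + 1) true x.1.val))
      (fun x hx => by
        have h : ∀ α, d n α x.1 = x.1 := fun α => Path.ext (hx α)
        simp only [h, sub_self])
      (fun x y z h h' => by
        have key : ∀ α, CF.ofPath (d n α z.1) (dimLE_d (n + 1) α z.1.val) =
            CF.ofPath (d n α x.1) (dimLE_d (n + 1) α x.1.val) := fun α =>
          CF.ofPath_comp_zero _ (dimLE_d (n + 1) α y.1.val) _ (y := d n α y.1) (composable_d α (Nat.succ_ne_zero n) h) (by
            change d (n + 1) α z.1.val = comp 0 (d (n + 1) α x.1.val) (d (n + 1) α y.1.val)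
            rw [h', d_comp α _ _ (Nat.succ_ne_zero n) h])
        rw [key, key])
      (fun r hr1 hr2 x y z h h' => by
        rcases Nat.lt_or_eq_of_le hr2 with hr | rfl
        · have key : ∀ α, CF.ofPath (d n α z.1) (dimLE_d (n + 1) α z.1.val) =
              CF.ofPath (d n α x.1) (dimLE_d (n + 1) α x.1.val) +
              CF.ofPath (d n α y.1) (dimLE_d (n + 1) α y.1.val) := fun α =>
            CF.ofPath_comp hr1 (by omega) _ _ _ (composable_d α (by omega) h) (by
              change d (n + 1) α z.1.val = _
              rw [h', d_comp α _ _ (by omega) h]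
              rfl)
          rw [key, key]
          abel
        · have e1 : d n false z.1 = d n false x.1 := Path.ext (by
            change d (n + 1) false z.1.val = d (n + 1) false x.1.val
            rw [h', d_src _ _ _ h])
          have e2 : d n true z.1 = d n true y.1 := Path.ext (by
            change d (n + 1) true z.1.val = d (n + 1) true y.1.val
            rw [h', d_tgt _ _ _ h])
          have e3 : d n true x.1 = d n false y.1 := Path.ext h
          simp only [e1, e2, e3]
          abel)

theorem CFd_zero (x : Path C) (hx : DimLE 1 x.val) :
    CFd C 0 (CF.ofPath x hx) = CF.ofObj (srcObj x.val) := by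
  unfold CFd
  rw [CF.desc_ofPath]

theorem CFd_succ (n : ℕ) (x : Path C) (hx : DimLE (n + 2) x.val) :
    CFd C (n + 1) (CF.ofPath x hx) =
      CF.ofPath (d n false x) (dimLE_d (n + 1) false x.val) -
        CF.ofPath (d n true x) (dimLE_d (n + 1) true x.val) := by
  unfold CFd
  rw [CF.desc_ofPath]

theorem CFd_CFd (n : ℕ) : (CFd C n).comp (CFd C (n + 1)) = 0 := by
  refine CF.hom_ext fun x hx => ?_
  change CFd C n (CFd C (n + 1) (CF.ofPath x hx)) = 0
  rw [CFd_succ, map_sub]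
  cases n with
  | zero =>
    rw [CFd_zero, CFd_zero, sub_eq_zero]
    exact congrArg CF.ofObj (Obj.ext ((d_d_of_lt false false x.val Nat.one_pos).trans
      (d_d_of_lt false true x.val Nat.one_pos).symm))
  | succ n =>
    rw [CFd_succ, CFd_succ]
    simp only [d_d_of_lt _ _ x (Nat.lt_succ_self n), sub_self]

/-- The formal negative corner complex `CF^-(C)`. -/
noncomputable def CF : ChainComplex AddCommGrpCat.{u} ℕ :=
  ChainComplex.of (fun n => AddCommGrpCat.of (CFGroup C n)) (fun n => AddCommGrpCat.ofHom (CFd C n))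
    fun n => by
      rw [← AddCommGrpCat.ofHom_comp, CFd_CFd]
      rfl

theorem CF_d (n : ℕ) : (CF C).d (n + 1) n = AddCommGrpCat.ofHom (CFd C n) :=
  ChainComplex.of_d (fun n => AddCommGrpCat.of (CFGroup C n))
    (fun n => AddCommGrpCat.ofHom (CFd C n)) n

end formal

/-! ### Functoriality of the two complexes -/

section functoriality
variable {C D : Type u} [OmegaCategory C] [NonContracting C] [OmegaCategory D]

theorem OmegaFunctor.dimLE_pathFun (f : OmegaFunctor C D) (hf : f.IsNonContracting) {n : ℕ}
    {x : Path C} (h : DimLE n x.val) : DimLE n (f.pathFun hf x).val := f.dimLE h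

/-- The action of a non-contracting ω-functor on the groups of the formal corner complex. -/
noncomputable def CF.mapGroup (f : OmegaFunctor C D) (hf : f.IsNonContracting) :
    ∀ n : ℕ, CFGroup C n →+ CFGroup D n
  | 0 => QuotientAddGroup.map _ _ (FreeAbelianGroup.map (β := CFGens D 0) f.obj)
      ((AddSubgroup.closure_le _).2 (Set.empty_subset _))
  | _ + 1 => CF.desc (fun x => CF.ofPath (f.pathFun hf x.1) (f.dimLE_pathFun hf x.2))
      (fun _ hx => CF.ofPath_lower _ (f.dimLE hx))
      (fun _ y _ h h' => CF.ofPath_comp_zero _ (y := f.pathFun hf y.1) (f.dimLE_pathFun hf y.2) _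
        (f.composable h)
        ((congrArg f.toFun h').trans (f.map_comp _ _ _ h)))
      (fun _ h1 h2 _ _ _ h h' => CF.ofPath_comp h1 h2 _ _ _ (f.composable h)
        ((congrArg f.toFun h').trans (f.map_comp _ _ _ h)))

theorem CF.mapGroup_ofPath (f : OmegaFunctor C D) (hf : f.IsNonContracting) {n : ℕ} (x : Path C)
    (hx : DimLE (n + 1) x.val) :
    CF.mapGroup f hf (n + 1) (CF.ofPath x hx) = CF.ofPath (f.pathFun hf x) (f.dimLE_pathFun hf hx) := by
  unfold CF.mapGroup
  rw [CF.desc_ofPath]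

theorem CF.mapGroup_ofObj (f : OmegaFunctor C D) (hf : f.IsNonContracting) (a : Obj C) :
    CF.mapGroup f hf 0 (CF.ofObj a) = CF.ofObj (f.obj a) :=
  congrArg QuotientAddGroup.mk (FreeAbelianGroup.map_of_apply (β := CFGens D 0) (f := f.obj) a)

variable [NonContracting D]

/-- The action of a non-contracting ω-functor on the simplices of the branching semi-globular
nerve. -/
noncomputable def gensMap (f : OmegaFunctor C D) (hf : f.IsNonContracting) :
    ∀ n : ℕ, Gens C n → Gens D n
  | 0, a => f.obj a
  | _ + 1, x => OmegaFunctor.trans x (f.semiPath hf)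

/-- The action of a non-contracting ω-functor on chains. -/
noncomputable def chainsMap (f : OmegaFunctor C D) (hf : f.IsNonContracting) (n : ℕ) :
    Chains C n →+ Chains D n :=
  FreeAbelianGroup.map (gensMap f hf n)

theorem chainsMap_ofObj (f : OmegaFunctor C D) (hf : f.IsNonContracting) (a : Obj C) :
    chainsMap f hf 0 (Chains.ofObj a) = Chains.ofObj (f.obj a) := rfl

theorem chainsMap_ofSimplex (f : OmegaFunctor C D) (hf : f.IsNonContracting) {n : ℕ}
    (x : Nerve (SemiPath C) n) :
    chainsMap f hf (n + 1) (Chains.ofSimplex x) =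
      Chains.ofSimplex (OmegaFunctor.trans x (f.semiPath hf)) := rfl

theorem bd_chainsMap (f : OmegaFunctor C D) (hf : f.IsNonContracting) (n : ℕ)
    (c : Chains C (n + 1)) :
    bd D n (chainsMap f hf (n + 1) c) = chainsMap f hf n (bd C n c) := by
  suffices h : (bd D n).comp (chainsMap f hf (n + 1)) = (chainsMap f hf n).comp (bd C n) from
    DFunLike.congr_fun h c
  refine Chains.hom_ext fun x => ?_
  change bd D n (chainsMap f hf (n + 1) (Chains.ofSimplex x)) =
    chainsMap f hf n (bd C n (Chains.ofSimplex x))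
  rw [chainsMap_ofSimplex, bd_ofSimplex, bd_ofSimplex]
  cases n with
  | zero =>
    rw [bdSimplex, bdSimplex, chainsMap_ofObj]
    exact congrArg Chains.ofObj (f.src_semiPath hf _)
  | succ n =>
    rw [bdSimplex, bdSimplex, map_sum]
    simp only [map_zsmul, chainsMap_ofSimplex]
    rfl

theorem thin_le (f : OmegaFunctor C D) (hf : f.IsNonContracting) (n : ℕ) :
    thin C n ≤ (thin D n).comap (chainsMap f hf n) := by
  match n with
  | 0 => exact bot_le
  | 1 => exact bot_le
  | n + 2 =>
    refine (AddSubgroup.closure_le _).2 ?_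
    rintro _ ⟨x, hx, rfl⟩
    refine AddSubgroup.subset_closure ⟨x.trans (f.semiPath hf), (f.semiPath hf).dimLE hx, ?_⟩
    exact chainsMap_ofSimplex f hf x

theorem reducedRel_le (f : OmegaFunctor C D) (hf : f.IsNonContracting) (n : ℕ) :
    reducedRel C n ≤ (reducedRel D n).comap (chainsMap f hf n) := by
  refine sup_le (fun c hc => AddSubgroup.mem_sup_left (thin_le f hf n hc)) ?_
  rintro _ ⟨c, hc, rfl⟩
  refine AddSubgroup.mem_sup_right ⟨_, thin_le f hf (n + 1) hc, ?_⟩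
  exact bd_chainsMap f hf n c

/-- The action of a non-contracting ω-functor on the groups of the reduced complex. -/
noncomputable def CR.mapGroup (f : OmegaFunctor C D) (hf : f.IsNonContracting) (n : ℕ) :
    CRGroup C n →+ CRGroup D n :=
  QuotientAddGroup.map _ _ (chainsMap f hf n) (reducedRel_le f hf n)

theorem CRd_mapGroup (f : OmegaFunctor C D) (hf : f.IsNonContracting) (n : ℕ) :
    (CRd D n).comp (CR.mapGroup f hf (n + 1)) = (CR.mapGroup f hf n).comp (CRd C n) := by
  refine AddMonoidHom.ext fun c => ?_
  obtain ⟨c, rfl⟩ := QuotientAddGroup.mk_surjective c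
  exact congrArg QuotientAddGroup.mk (bd_chainsMap f hf n c)

/-- The morphism `CR^{gl-}(f)`. -/
noncomputable def CR.map (f : OmegaFunctor C D) (hf : f.IsNonContracting) : CR C ⟶ CR D :=
  ChainComplex.ofHom (fun n => AddCommGrpCat.ofHom (CR.mapGroup f hf n)) fun n => by
    rw [CR_d, CR_d]
    exact congrArg AddCommGrpCat.ofHom (CRd_mapGroup f hf n)

theorem CFd_mapGroup (f : OmegaFunctor C D) (hf : f.IsNonContracting) (n : ℕ) :
    (CFd D n).comp (CF.mapGroup f hf (n + 1)) = (CF.mapGroup f hf n).comp (CFd C n) := by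
  refine CF.hom_ext fun x hx => ?_
  change CFd D n (CF.mapGroup f hf (n + 1) (CF.ofPath x hx)) =
    CF.mapGroup f hf n (CFd C n (CF.ofPath x hx))
  rw [CF.mapGroup_ofPath]
  cases n with
  | zero =>
    rw [CFd_zero, CFd_zero, CF.mapGroup_ofObj]
    exact congrArg CF.ofObj (Obj.ext (f.map_d 0 false x.val).symm)
  | succ n =>
    rw [CFd_succ, CFd_succ, map_sub, CF.mapGroup_ofPath, CF.mapGroup_ofPath]
    have h : ∀ α, d n α (f.pathFun hf x) = f.pathFun hf (d n α x) := fun α =>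
      Path.ext (f.map_d (n + 1) α x.val).symm
    simp only [h]

/-- The morphism `CF^-(f)`. -/
noncomputable def CF.map (f : OmegaFunctor C D) (hf : f.IsNonContracting) : CF C ⟶ CF D :=
  ChainComplex.ofHom (fun n => AddCommGrpCat.ofHom (CF.mapGroup f hf n)) fun n => by
    rw [CF_d, CF_d]
    exact congrArg AddCommGrpCat.ofHom (CFd_mapGroup f hf n)

/-- A chain map `CF^-(C) → CR^{gl-}(C)` is induced by the operators `□^{gl-}` if it is the identity
on objects and sends `x` to the class of `□^{gl-}(h^-(x))` in each positive degree. -/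
def IsInducedByBox (F : CF C ⟶ CR C) : Prop :=
  (∀ a : Obj C, (F.f 0).hom (CF.ofObj a) = CR.ofObj a) ∧
  ∀ (n : ℕ) (x : Path C) (hx : DimLE (n + 1) x.val),
    (F.f (n + 1)).hom (CF.ofPath x hx) = CR.ofSimplex (boxMinus n x)

end functoriality
end Globular

open CategoryTheory Globular

namespace Globular

open OmegaCategory

/-! ### Chains on the faces of a simplex and their signs. -/

namespace Simplex
variable {n m k N : ℕ}

/-! Classes in the reduced complex are compared by one principle. If a thin simplex has two
consecutive faces and all its other faces are thin, then its boundary, which is zero in the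
quotient, says that these two faces have the same class (`CR.ofSimplex_face_eq`). The proof consists
in building enough thin simplices of this kind, and one with three relevant faces for additivity.

Generation. The identity of `Δ^n` is joined by a chain of such moves, called links, to an
endomorphism that factors through the collapse of `Δ^n` onto the globe
(`Simplex.exists_eqvGen_linked_collapse`). This happens at the level of augmented directed
complexes, so composing with an arbitrary simplex shows that every simplex has the class of some
`□(u)` (`CR.exists_ofSimplex_eq_box`). The links come from the contraction of the simplex onto its
last vertex, a chain homotopy with positive coefficients. Applied only to the faces whose vertices
are all at least `k`, it produces a folding of `Δ^n`, `foldHom`. The folding at the last vertex is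
the identity, foldings at `k` and `k + 1` are linked for `k ≥ 1`, and the folding at `1` factors
through the suspension of the face opposite to `0` (`toSusp_trans_ofSusp`). Taking cones preserves
links, and the cone of a collapse is the next collapse up to the map from the globe to its
suspension, so induction on `n` applies.

Additivity of `□` on `r`-composites (`CR.ofSimplex_box_comp`). Two `r`-composable elements define an
ω-functor on the pushout of two globes along an `r`-cell. An element of this pushout is encoded by
its images under the two collapses, a pair of elements of the globe satisfying `PairRel`; so two
maps from a simplex to the globe with related values give a simplex of the nerve. If `w` has
dimension at most `r + 1`, letting the second map vary interpolates between `□(u)` and `□` of the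
composite of `u` and `w`. For `n ≥ r + 2` all other faces that occur are thin, so whiskering by `w`
does not change the class. For `n = r + 1` exactly one more face survives, namely `□(w)`, and it
gives the sum. The general case follows by induction on `n - r` from `u *_r v = (u *_r s_{r+1} v)
*_{r+1} (t_{r+1} u *_r v)`.

Conclusion. `ℙ^-C` is generated by the image of `h^-` under sources, targets and compositions, so
additivity reduces the classes of the `□(u)` to those of the `□(h^-(x))`. The statement on `*_0` is
the defining property of `h^-`. Of the faces of `□(u)`, the last two are `□` of the source and of
the target of `u`, and the others are thin; so `□` intertwines the two differentials. Naturality of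
the chain map is naturality of `□`. -/

theorem addHom_ext_e {A : Type*} [AddCommGroup A] {p : ℕ} {f g : (Face n p →₀ ℤ) →+ A}
    (h : ∀ τ : Finset (Fin (n + 1)), τ.card = p + 1 → f (e p τ) = g (e p τ)) : f = g := by
  refine Finsupp.addHom_ext fun σ y => ?_
  have h1 : (Finsupp.single σ y : Face n p →₀ ℤ) = y • e p σ.1 := by
    rw [e_of_card σ.2, Finsupp.smul_single, smul_eq_mul, mul_one]
  rw [h1, map_zsmul, map_zsmul, h σ.1 σ.2]

theorem linearMap_ext_e {A : Type*} [AddCommGroup A] {p : ℕ} {f g : (Face n p →₀ ℤ) →ₗ[ℤ] A}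
    (h : ∀ τ : Finset (Fin (n + 1)), τ.card = p + 1 → f (e p τ) = g (e p τ)) : f = g :=
  LinearMap.toAddMonoidHom_injective (addHom_ext_e h)

theorem sgn_eq_neg_one {σ : Finset (Fin (n + 1))} {v : Fin (n + 1)} (h : ∀ j ∈ σ, v ≤ j) :
    sgn σ v = -1 := by
  unfold sgn
  rw [Finset.filter_eq_empty_iff.2 fun j hj => not_lt.2 (h j hj)]
  simp

theorem sgn_insert {σ : Finset (Fin (n + 1))} {v w : Fin (n + 1)} (hw : w ∉ σ) (h : w < v) :
    sgn (insert w σ) v = - sgn σ v := by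
  unfold sgn
  rw [Finset.filter_insert, if_pos h, Finset.card_insert_of_notMem (by simp [hw])]
  ring

/-! ### The contraction of the simplex onto its last vertex -/

/-- The map `v ↦ max v i` on vertices. -/
def maxHom (i : Fin (n + 1)) : Fin (n + 1) →o Fin (n + 1) :=
  ⟨fun v => max v i, fun _ _ h => max_le_max h le_rfl⟩

theorem maxHom_apply (i v : Fin (n + 1)) : maxHom i v = max v i := rfl

open Classical in
/-- The elementary homotopy that adds the vertex `i + 1` to the faces with first vertex `i`. -/
noncomputable def addVertex (i : Fin n) (p : ℕ) : (Face n p →₀ ℤ) →ₗ[ℤ] (Face n (p + 1) →₀ ℤ) :=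
  Finsupp.linearCombination ℤ fun σ =>
    if i.castSucc ∈ σ.1 ∧ ∀ j ∈ σ.1, i.castSucc ≤ j then e (p + 1) (insert i.succ σ.1) else 0

open Classical in
theorem addVertex_e (i : Fin n) {p : ℕ} {τ : Finset (Fin (n + 1))} (h : τ.card = p + 1) :
    addVertex i p (e p τ) = if i.castSucc ∈ τ ∧ ∀ j ∈ τ, i.castSucc ≤ j
      then e (p + 1) (insert i.succ τ) else 0 := by
  rw [e_of_card h, addVertex, Finsupp.linearCombination_single, one_smul]

theorem addVertex_e_of_notMem (i : Fin n) {p : ℕ} {τ : Finset (Fin (n + 1))}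
    (h : i.castSucc ∉ τ) : addVertex i p (e p τ) = 0 := by
  by_cases hc : τ.card = p + 1
  · rw [addVertex_e i hc, if_neg fun h' => h h'.1]
  · rw [e_of_card_ne hc, map_zero]

theorem e_insert_of_mem {p : ℕ} {τ : Finset (Fin (n + 1))} {v : Fin (n + 1)} (h : τ.card = p + 1)
    (hv : v ∈ τ) : (e (p + 1) (insert v τ) : Face n (p + 1) →₀ ℤ) = 0 := by
  rw [Finset.insert_eq_of_mem hv, e_of_card_ne (by omega)]

/-- Among the vertices `≥ i`, only `i` itself is moved by `max · (i + 1)`. If `i + 1` already lies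
in `τ`, the set on the right has too few elements and `e` takes its default value `0`, as it must
for a degenerate face. -/
theorem push_maxHom_succ (i : Fin n) {p : ℕ} {τ : Finset (Fin (n + 1))} (h : τ.card = p + 1)
    (hi : ∀ j ∈ τ, i.castSucc ≤ j) : push (maxHom i.succ) p (e p τ) =
      if i.castSucc ∈ τ then e p (insert i.succ (τ.erase i.castSucc)) else e p τ := by
  rw [push_e _ h]
  have h1 : ∀ j ∈ τ, j ≠ i.castSucc → i.succ ≤ j := fun j hj hne => by
    have := hi j hj
    rw [Fin.le_def, Fin.val_castSucc] at this
    rw [Fin.le_def, Fin.val_succ]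
    have h2 : (j : ℕ) ≠ i := fun h => hne (Fin.ext h)
    omega
  have h3 : max i.castSucc i.succ = i.succ := max_eq_right (Fin.castSucc_lt_succ).le
  split_ifs with hm
  · congr 1
    ext v
    simp only [Finset.mem_image, maxHom_apply, Finset.mem_insert, Finset.mem_erase]
    constructor
    · rintro ⟨j, hj, rfl⟩
      by_cases hji : j = i.castSucc
      · subst hji; exact Or.inl h3
      · rw [max_eq_left (h1 j hj hji)]; exact Or.inr ⟨hji, hj⟩
    · rintro (rfl | ⟨hv, hvτ⟩)
      · exact ⟨_, hm, h3⟩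
      · exact ⟨v, hvτ, max_eq_left (h1 v hvτ hv)⟩
  · congr 1
    refine (Finset.image_congr fun j hj => ?_).trans Finset.image_id
    exact max_eq_left (h1 j hj fun h' => hm (h' ▸ hj))

/-- The degree `0` form of `bd_addVertex`; it is separate because there is no boundary to compose
with on the other side. -/
theorem bd_addVertex_zero (i : Fin n) {τ : Finset (Fin (n + 1))} (h : τ.card = 1)
    (hi : ∀ j ∈ τ, i.castSucc ≤ j) :
    bd n 0 (addVertex i 0 (e 0 τ)) = e 0 τ - push (maxHom i.succ) 0 (e 0 τ) := by
  rw [push_maxHom_succ i h hi]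
  obtain ⟨v, rfl⟩ := Finset.card_eq_one.1 h
  by_cases hv : v = i.castSucc
  · subst hv
    have hne : i.succ ≠ i.castSucc := Fin.castSucc_lt_succ.ne'
    have hc : ({i.succ, i.castSucc} : Finset (Fin (n + 1))).card = 0 + 2 := Finset.card_pair hne
    rw [addVertex_e i h, if_pos (by simp), bd_e hc, Finset.sum_pair hne,
      if_pos (by simp)]
    have h1 : sgn {i.succ, i.castSucc} i.castSucc = -1 := sgn_eq_neg_one (by
      intro j hj
      simp only [Finset.mem_insert, Finset.mem_singleton] at hj
      rcases hj with rfl | rfl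
      · exact Fin.castSucc_lt_succ.le
      · exact le_rfl)
    have h2 : sgn {i.succ, i.castSucc} i.succ = 1 := by
      rw [Finset.pair_comm, sgn_insert (by simpa using hne.symm) Fin.castSucc_lt_succ,
        sgn_eq_neg_one (by simp)]
      rfl
    rw [h1, h2, Finset.erase_insert (by simpa using hne)]
    have h3 : ({i.succ, i.castSucc} : Finset (Fin (n + 1))).erase i.castSucc = {i.succ} := by
      rw [Finset.pair_comm, Finset.erase_insert (by simpa using hne.symm)]
    rw [h3]
    simp [sub_eq_add_neg]
  · have hv' : i.castSucc ∉ ({v} : Finset (Fin (n + 1))) := by simpa using Ne.symm hv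
    rw [addVertex_e_of_notMem i hv', if_neg hv', map_zero, sub_self]

/-- For a face with first vertex `i`, the new vertex `i + 1` takes the second place. In the boundary
of the enlarged face, removing `i + 1` has sign `+1` and gives `τ` back, while removing `i` has sign
`-1` and gives the image under `max · (i + 1)`. The other terms cancel against `addVertex` of the
boundary. A face without `i` is fixed by the map and killed by the homotopy. -/
theorem bd_addVertex (i : Fin n) {p : ℕ} {τ : Finset (Fin (n + 1))} (h : τ.card = p + 2)
    (hi : ∀ j ∈ τ, i.castSucc ≤ j) :
    bd n (p + 1) (addVertex i (p + 1) (e (p + 1) τ)) + addVertex i p (bd n p (e (p + 1) τ)) =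
      e (p + 1) τ - push (maxHom i.succ) (p + 1) (e (p + 1) τ) := by
  have hlt : i.castSucc < i.succ := Fin.castSucc_lt_succ
  have hce : ∀ v ∈ τ, (τ.erase v).card = p + 1 := fun v hv => by
    rw [Finset.card_erase_of_mem hv, h]; rfl
  rw [push_maxHom_succ i h hi, bd_e h, map_sum, addVertex_e i h]
  simp only [map_smul]
  by_cases hm : i.castSucc ∈ τ
  · rw [if_pos ⟨hm, hi⟩, if_pos hm]
    have h0 : addVertex i p (e p (τ.erase i.castSucc)) = 0 :=
      addVertex_e_of_notMem i (by simp)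
    have h1 : ∀ v ∈ τ, v ≠ i.castSucc →
        addVertex i p (e p (τ.erase v)) = e (p + 1) (insert i.succ (τ.erase v)) := fun v hv hne => by
      rw [addVertex_e i (hce v hv), if_pos]
      exact ⟨Finset.mem_erase.2 ⟨hne.symm, hm⟩, fun j hj => hi j (Finset.mem_of_mem_erase hj)⟩
    by_cases hs : i.succ ∈ τ
    -- When `i + 1` is already in `τ`, nothing can be added and the image of `τ` is degenerate; `τ`
    -- reappears from the boundary by removing `i + 1` and adding it again.
    · rw [e_insert_of_mem h hs, map_zero, zero_add,
        Finset.insert_eq_of_mem (Finset.mem_erase.2 ⟨hlt.ne', hs⟩),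
        e_of_card_ne (τ := τ.erase i.castSucc) (by rw [hce _ hm]; omega), sub_zero,
        Finset.sum_eq_single_of_mem i.succ hs]
      · rw [h1 _ hs hlt.ne', Finset.insert_erase hs]
        have h2 : sgn τ i.succ = 1 := by
          rw [← Finset.insert_erase hm, sgn_insert (by simp) hlt, sgn_eq_neg_one]
          · rfl
          · intro j hj
            have h3 := hi j (Finset.mem_of_mem_erase hj)
            have h4 := (Finset.mem_erase.1 hj).1
            rw [Fin.le_def, Fin.val_castSucc] at h3
            rw [Fin.le_def, Fin.val_succ]
            have h5 : (j : ℕ) ≠ i := fun h => h4 (Fin.ext h)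
            omega
        rw [h2, one_smul]
      · intro v hv hvs
        by_cases hvc : v = i.castSucc
        · rw [hvc, h0, smul_zero]
        · rw [h1 v hv hvc, e_insert_of_mem (hce v hv) (Finset.mem_erase.2 ⟨hvs.symm, hs⟩), smul_zero]
    · have hc : (insert i.succ τ).card = p + 1 + 2 := by rw [Finset.card_insert_of_notMem hs, h]
      have hmin : ∀ j ∈ insert i.succ τ, i.castSucc ≤ j := by
        intro j hj
        rcases Finset.mem_insert.1 hj with rfl | hj
        · exact hlt.le
        · exact hi j hj
      rw [bd_e hc, Finset.sum_insert hs, Finset.erase_insert hs,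
        ← Finset.add_sum_erase τ _ hm, ← Finset.add_sum_erase τ _ hm, h0, smul_zero, zero_add,
        sgn_eq_neg_one hmin, Finset.erase_insert_of_ne hlt.ne']
      have h2 : sgn (insert i.succ τ) i.succ = 1 := by
        have h3 : insert i.succ τ = insert i.castSucc (insert i.succ (τ.erase i.castSucc)) := by
          rw [Finset.insert_comm, Finset.insert_erase hm]
        rw [h3, sgn_insert (by simp [hlt.ne]) hlt, sgn_eq_neg_one]
        · rfl
        · intro j hj
          rcases Finset.mem_insert.1 hj with rfl | hj
          · exact le_rfl
          have h3 := hi j (Finset.mem_of_mem_erase hj)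
          have h4 := (Finset.mem_erase.1 hj).1
          rw [Fin.le_def, Fin.val_castSucc] at h3
          rw [Fin.le_def, Fin.val_succ]
          have h5 : (j : ℕ) ≠ i := fun h => h4 (Fin.ext h)
          omega
      -- Every later vertex has one more predecessor in the enlarged face, so its sign flips and
      -- these terms cancel.
      have h4 : ∑ v ∈ τ.erase i.castSucc, sgn (insert i.succ τ) v •
          (e (p + 1) ((insert i.succ τ).erase v) : Face n (p + 1) →₀ ℤ) =
          - ∑ v ∈ τ.erase i.castSucc, sgn τ v • addVertex i p (e p (τ.erase v)) := by
        rw [← Finset.sum_neg_distrib]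
        refine Finset.sum_congr rfl fun v hv => ?_
        obtain ⟨hne, hv⟩ := Finset.mem_erase.1 hv
        have hvs : i.succ ≠ v := fun h => hs (h ▸ hv)
        have hlv : i.succ < v := by
          have h3 := hi v hv
          rw [Fin.le_def, Fin.val_castSucc] at h3
          rw [Fin.lt_def, Fin.val_succ]
          have h5 : (v : ℕ) ≠ i := fun h => hne (Fin.ext h)
          have h6 : (v : ℕ) ≠ i + 1 := fun h => hvs (Fin.ext h.symm)
          omega
        rw [h1 v hv hne, sgn_insert hs hlv, Finset.erase_insert_of_ne hvs, neg_smul]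
      rw [h4, h2]
      module
  · rw [if_neg fun h' => hm h'.1, if_neg hm, map_zero, zero_add, sub_self]
    refine Finset.sum_eq_zero fun v _ => ?_
    rw [addVertex_e_of_notMem i fun h' => hm (Finset.mem_of_mem_erase h'), smul_zero]

/-- The contraction of the simplex onto its last vertex. -/
noncomputable def contr (n p : ℕ) : (Face n p →₀ ℤ) →ₗ[ℤ] (Face n (p + 1) →₀ ℤ) :=
  ∑ i : Fin n, (addVertex i p).comp (push (maxHom i.castSucc) p)

theorem contr_apply {p : ℕ} (c : Face n p →₀ ℤ) :
    contr n p c = ∑ i : Fin n, addVertex i p (push (maxHom i.castSucc) p c) := by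
  simp [contr]

theorem sum_castSucc_sub_succ {A : Type*} [AddCommGroup A] (f : Fin (n + 1) → A) :
    ∑ i : Fin n, (f i.castSucc - f i.succ) = f 0 - f (Fin.last n) := by
  rw [Finset.sum_sub_distrib]
  have h1 := Fin.sum_univ_castSucc f
  have h2 := Fin.sum_univ_succ f
  rw [sub_eq_sub_iff_add_eq_add, ← h1, h2]

theorem maxHom_comp {i j : Fin (n + 1)} (h : i ≤ j) : (maxHom j).comp (maxHom i) = maxHom j := by
  ext v
  change ((max (max v i) j : Fin (n + 1)) : ℕ) = (max v j : Fin (n + 1))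
  rw [max_assoc, max_eq_right h]

theorem maxHom_zero : (maxHom 0 : Fin (n + 1) →o Fin (n + 1)) = OrderHom.id := by
  ext v
  change ((max v 0 : Fin (n + 1)) : ℕ) = v
  rw [max_eq_left (Fin.zero_le v)]

theorem push_maxHom_last_zero {τ : Finset (Fin (n + 1))} (h : τ.card = 1) :
    push (maxHom (Fin.last n)) 0 (e 0 τ) = e 0 {Fin.last n} := by
  rw [push_e _ h]
  obtain ⟨v, rfl⟩ := Finset.card_eq_one.1 h
  rw [Finset.image_singleton, maxHom_apply, max_eq_right (Fin.le_last v)]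

theorem push_maxHom_last (p : ℕ) (c : Face n (p + 1) →₀ ℤ) :
    push (maxHom (Fin.last n)) (p + 1) c = 0 := by
  suffices h : push (maxHom (Fin.last n)) (p + 1) = 0 from LinearMap.congr_fun h c
  refine linearMap_ext_e fun τ h => ?_
  rw [push_e _ h, e_of_card_ne]
  · rfl
  · have h1 : τ.image (maxHom (Fin.last n)) ⊆ {Fin.last n} := by
      intro v hv
      obtain ⟨j, _, rfl⟩ := Finset.mem_image.1 hv
      rw [Finset.mem_singleton, maxHom_apply, max_eq_right (Fin.le_last j)]
    have := Finset.card_le_card h1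
    rw [Finset.card_singleton] at this
    omega

theorem le_of_mem_image_maxHom {i v : Fin (n + 1)} {τ : Finset (Fin (n + 1))}
    (h : v ∈ τ.image (maxHom i)) : i ≤ v := by
  obtain ⟨j, _, rfl⟩ := Finset.mem_image.1 h
  exact le_max_right _ _

/-- The same telescoping as in `bd_contr`, ending at the constant map to the last vertex, which in
degree `0` is not zero. -/
theorem bd_contr_zero {τ : Finset (Fin (n + 1))} (h : τ.card = 1) :
    bd n 0 (contr n 0 (e 0 τ)) = e 0 τ - e 0 {Fin.last n} := by
  have h1 : ∀ i : Fin n, bd n 0 (addVertex i 0 (push (maxHom i.castSucc) 0 (e 0 τ))) =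
      push (maxHom i.castSucc) 0 (e 0 τ) - push (maxHom i.succ) 0 (e 0 τ) := by
    intro i
    have hc : (τ.image (maxHom i.castSucc)).card = 1 := by
      obtain ⟨v, rfl⟩ := Finset.card_eq_one.1 h
      simp
    conv_lhs => rw [push_e _ h]
    rw [bd_addVertex_zero i hc fun j hj => le_of_mem_image_maxHom hj, ← push_e _ h,
      ← LinearMap.comp_apply, ← push_comp, maxHom_comp (Fin.castSucc_lt_succ).le]
  rw [contr_apply, map_sum, Finset.sum_congr rfl fun i _ => h1 i,
    sum_castSucc_sub_succ (fun i => push (maxHom i) 0 (e 0 τ)), maxHom_zero, push_id,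
    push_maxHom_last_zero h]
  rfl

/-- Since `maxHom (i + 1) ∘ maxHom i = maxHom (i + 1)`, the summand of index `i` is a homotopy from
`push (maxHom i)` to `push (maxHom (i + 1))`. The sum telescopes from the identity to the constant
map at the last vertex, which kills chains of positive degree. -/
theorem bd_contr (p : ℕ) (c : Face n (p + 1) →₀ ℤ) :
    bd n (p + 1) (contr n (p + 1) c) + contr n p (bd n p c) = c := by
  suffices h : (bd n (p + 1)).comp (contr n (p + 1)) + (contr n p).comp (bd n p) = LinearMap.id from
    LinearMap.congr_fun h c
  refine linearMap_ext_e fun τ h => ?_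
  have h1 : ∀ i : Fin n, bd n (p + 1) (addVertex i (p + 1) (push (maxHom i.castSucc) (p + 1)
      (e (p + 1) τ))) + addVertex i p (push (maxHom i.castSucc) p (bd n p (e (p + 1) τ))) =
      push (maxHom i.castSucc) (p + 1) (e (p + 1) τ) -
        push (maxHom i.succ) (p + 1) (e (p + 1) τ) := by
    intro i
    rw [← bd_push]
    have h2 : push (maxHom i.succ) (p + 1) (e (p + 1) τ) = push (maxHom i.succ) (p + 1)
        (push (maxHom i.castSucc) (p + 1) (e (p + 1) τ)) := by
      rw [← LinearMap.comp_apply, ← push_comp, maxHom_comp (Fin.castSucc_lt_succ).le]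
    rw [h2, push_e _ h]
    by_cases hc : (τ.image (maxHom i.castSucc)).card = p + 2
    · exact bd_addVertex i hc fun j hj => le_of_mem_image_maxHom hj
    · rw [e_of_card_ne hc]; simp
  change bd n (p + 1) (contr n (p + 1) _) + contr n p (bd n p _) = _
  rw [contr_apply, contr_apply, map_sum, ← Finset.sum_add_distrib,
    Finset.sum_congr rfl fun i _ => h1 i,
    sum_castSucc_sub_succ (fun i => push (maxHom i) (p + 1) (e (p + 1) τ)), maxHom_zero, push_id,
    push_maxHom_last, sub_zero]

theorem push_nonneg (f : Fin (n + 1) →o Fin (m + 1)) {p : ℕ} {c : Face n p →₀ ℤ}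
    (hc : ∀ σ, 0 ≤ c σ) (σ) : 0 ≤ push f p c σ :=
  linearCombination_nonneg (fun _ _ => e_nonneg _ _ _) hc σ

theorem addVertex_nonneg (i : Fin n) {p : ℕ} {c : Face n p →₀ ℤ}
    (hc : ∀ σ, 0 ≤ c σ) (σ) : 0 ≤ addVertex i p c σ := by
  unfold addVertex
  rw [Finsupp.linearCombination_apply, Finsupp.sum, Finsupp.finsetSum_apply]
  refine Finset.sum_nonneg fun τ _ => mul_nonneg (hc τ) ?_
  split_ifs
  · exact e_nonneg _ _ _
  · exact le_rfl

theorem contr_nonneg {p : ℕ} {c : Face n p →₀ ℤ} (hc : ∀ σ, 0 ≤ c σ) (σ) : 0 ≤ contr n p c σ := by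
  rw [contr_apply, Finsupp.finsetSum_apply]
  exact Finset.sum_nonneg fun i _ => addVertex_nonneg i (push_nonneg _ hc) σ

/-- The contraction vanishes on the last vertex. -/
theorem contr_last : contr n 0 (e 0 {Fin.last n}) = 0 := by
  rw [contr_apply]
  refine Finset.sum_eq_zero fun i _ => ?_
  rw [push_e _ (by simp), Finset.image_singleton, maxHom_apply, max_eq_left (Fin.le_last _),
    addVertex_e_of_notMem]
  simp

/-- The contraction vanishes on the face opposite to the first vertex. -/
theorem contr_erase_zero (n : ℕ) :
    contr (n + 1) n (e n (Finset.univ.erase 0)) = 0 := by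
  have hc : ((Finset.univ : Finset (Fin (n + 2))).erase 0).card = n + 1 := by
    rw [Finset.card_erase_of_mem (Finset.mem_univ _)]; simp
  rw [contr_apply]
  refine Finset.sum_eq_zero fun i _ => ?_
  rw [push_e _ hc]
  -- For `i = 0` the face lacks the vertex `0` at which a vertex would be added. For `i ≥ 1` its
  -- image is degenerate or contains `i + 1` already.
  by_cases hi : (i : ℕ) = 0
  · rw [addVertex_e_of_notMem]
    intro h
    obtain ⟨j, hj, hji⟩ := Finset.mem_image.1 h
    have h0 : i.castSucc = 0 := Fin.ext hi
    rw [maxHom_apply, h0, max_eq_left (Fin.zero_le _)] at hji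
    exact (Finset.mem_erase.1 hj).1 hji
  · by_cases hinj : (Finset.image (maxHom i.castSucc)
        ((Finset.univ : Finset (Fin (n + 2))).erase 0)).card = n + 1
    · rw [addVertex_e i hinj]
      split_ifs with h
      · refine e_insert_of_mem hinj ?_
        refine Finset.mem_image.2 ⟨i.succ, by simp, ?_⟩
        rw [maxHom_apply, max_eq_left (Fin.castSucc_lt_succ).le]
      · rfl
    · rw [e_of_card_ne hinj, map_zero]

end Simplex
end Globular

namespace Globular

open OmegaCategory

/-! ### Morphisms of augmented directed complexes. -/

namespace ADC

theorem Hom.ext' {K L : ADC} {f g : Hom K L} (h : ∀ p, f.app p = g.app p) : f = g := by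
  cases f; cases g
  have : _ = _ := funext h
  subst this
  rfl

/-- Composition of morphisms (first `f`, then `g`). -/
def Hom.trans {K L M : ADC} (f : Hom K L) (g : Hom L M) : Hom K M where
  app p := (g.app p).comp (f.app p)
  bd_app _ _ := (g.bd_app _ _).trans (congrArg _ (f.bd_app _ _))
  aug_app c := (g.aug_app _).trans (f.aug_app c)
  pos_app _ _ hc := g.pos_app _ _ (f.pos_app _ _ hc)

/-- The identity morphism. -/
def Hom.id (K : ADC) : Hom K K where
  app _ := AddMonoidHom.id _
  bd_app _ _ := rfl
  aug_app _ := rfl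
  pos_app _ _ hc := hc

theorem Hom.trans_assoc {K L M N : ADC} (f : Hom K L) (g : Hom L M) (h : Hom M N) :
    (f.trans g).trans h = f.trans (g.trans h) := rfl

end ADC

namespace Simplex
variable {n m k N : ℕ} {K L : ADC}

theorem hom_ext_e {f g : ADC.Hom (adc n) K} (h : ∀ p (τ : Finset (Fin (n + 1))), τ.card = p + 1 →
    f.app p (e p τ : Face n p →₀ ℤ) = g.app p (e p τ : Face n p →₀ ℤ)) : f = g :=
  ADC.Hom.ext' fun p => addHom_ext_e (f := f.app p) (g := g.app p) (h p)

/-- A chain with nonnegative coefficients is a sum of natural multiples of faces, so positivity of a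
map need only be tested on faces. -/
theorem pos_of_e {A : Type*} [AddCommGroup A] {P : AddSubmonoid A} {p : ℕ}
    {f : (Face n p →₀ ℤ) →+ A}
    (h : ∀ τ : Finset (Fin (n + 1)), τ.card = p + 1 → f (e p τ) ∈ P) {c : Face n p →₀ ℤ}
    (hc : ∀ σ, 0 ≤ c σ) : f c ∈ P := by
  rw [← Finsupp.sum_single c, map_finsuppSum]
  refine sum_mem fun σ _ => ?_
  change f (Finsupp.single σ (c σ)) ∈ P
  obtain ⟨y, hy⟩ := Int.eq_ofNat_of_zero_le (hc σ)
  have h1 : (Finsupp.single σ (c σ) : Face n p →₀ ℤ) = y • e p σ.1 := by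
    rw [e_of_card σ.2, hy]; simp
  rw [h1, map_nsmul]
  exact nsmul_mem (h σ.1 σ.2) y

/-! ### Folding at a vertex -/

open Classical in
/-- The projection onto the chains on the vertices that are at least `k`. -/
noncomputable def restrictGE (n k p : ℕ) : (Face n p →₀ ℤ) →ₗ[ℤ] (Face n p →₀ ℤ) :=
  Finsupp.linearCombination ℤ fun σ => if ∀ i ∈ σ.1, k ≤ (i : ℕ) then e p σ.1 else 0

open Classical in
theorem restrictGE_e {p : ℕ} (τ : Finset (Fin (n + 1))) :
    restrictGE n k p (e p τ) = if ∀ i ∈ τ, k ≤ (i : ℕ) then e p τ else 0 := by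
  by_cases h : τ.card = p + 1
  · conv_lhs => rw [e_of_card h, restrictGE, Finsupp.linearCombination_single, one_smul]
  · rw [e_of_card_ne h, map_zero, ite_self]

/-- The homotopy from `push a` to the folding. -/
noncomputable def foldHtpy (a : Fin (N + 1) →o Fin (n + 1)) (k p : ℕ) :
    (Face N p →₀ ℤ) →ₗ[ℤ] (Face n (p + 1) →₀ ℤ) :=
  (contr n p).comp ((push a p).comp (restrictGE N k p))

theorem foldHtpy_e_of_ge (a : Fin (N + 1) →o Fin (n + 1)) {k p : ℕ} {τ : Finset (Fin (N + 1))}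
    (h : ∀ i ∈ τ, k ≤ (i : ℕ)) : foldHtpy a k p (e p τ) = contr n p (push a p (e p τ)) := by
  change contr n p (push a p (restrictGE N k p (e p τ))) = _
  rw [restrictGE_e, if_pos h]

theorem foldHtpy_e_of_not_ge (a : Fin (N + 1) →o Fin (n + 1)) {k p : ℕ} {τ : Finset (Fin (N + 1))}
    (h : ¬ ∀ i ∈ τ, k ≤ (i : ℕ)) : foldHtpy a k p (e p τ) = 0 := by
  change contr n p (push a p (restrictGE N k p (e p τ))) = _
  rw [restrictGE_e, if_neg h, map_zero, map_zero]

/-- The components of the morphism that folds the vertices `≥ k` onto the last vertex. -/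
noncomputable def foldApp (a : Fin (N + 1) →o Fin (n + 1)) (k : ℕ) :
    ∀ p : ℕ, (Face N p →₀ ℤ) →ₗ[ℤ] (Face n p →₀ ℤ)
  | 0 => push a 0 - (bd n 0).comp (foldHtpy a k 0)
  | p + 1 => push a (p + 1) - (bd n (p + 1)).comp (foldHtpy a k (p + 1)) -
      (foldHtpy a k p).comp (bd N p)

/-- On faces whose vertices are all `≥ k` the homotopy is the whole contraction, so subtracting its
boundary leaves only the last vertex. -/
theorem foldApp_zero_of_ge (a : Fin (N + 1) →o Fin (n + 1)) {k : ℕ} {τ : Finset (Fin (N + 1))}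
    (hc : τ.card = 1) (h : ∀ i ∈ τ, k ≤ (i : ℕ)) :
    foldApp a k 0 (e 0 τ) = e 0 {Fin.last n} := by
  change push a 0 (e 0 τ) - bd n 0 (foldHtpy a k 0 (e 0 τ)) = _
  have hc' : (τ.image a).card = 1 := by
    obtain ⟨v, rfl⟩ := Finset.card_eq_one.1 hc
    simp
  rw [foldHtpy_e_of_ge a h, push_e a hc, bd_contr_zero hc', sub_sub_cancel]

theorem foldApp_zero_of_not_ge (a : Fin (N + 1) →o Fin (n + 1)) {k : ℕ} {τ : Finset (Fin (N + 1))}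
    (h : ¬ ∀ i ∈ τ, k ≤ (i : ℕ)) :
    foldApp a k 0 (e 0 τ) = push a 0 (e 0 τ) := by
  change push a 0 (e 0 τ) - bd n 0 (foldHtpy a k 0 (e 0 τ)) = _
  rw [foldHtpy_e_of_not_ge a h, map_zero, sub_zero]

/-- All faces of `τ` have their vertices `≥ k` too, so here the homotopy is the whole contraction
both before and after the boundary, and `bd_contr` cancels `push a`. -/
theorem foldApp_succ_of_ge (a : Fin (N + 1) →o Fin (n + 1)) {k p : ℕ} {τ : Finset (Fin (N + 1))}
    (hc : τ.card = p + 2) (h : ∀ i ∈ τ, k ≤ (i : ℕ)) :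
    foldApp a k (p + 1) (e (p + 1) τ) = 0 := by
  change push a (p + 1) (e (p + 1) τ) - bd n (p + 1) (foldHtpy a k (p + 1) (e (p + 1) τ)) -
    foldHtpy a k p (bd N p (e (p + 1) τ)) = 0
  have h1 : foldHtpy a k p (bd N p (e (p + 1) τ)) =
      contr n p (bd n p (push a (p + 1) (e (p + 1) τ))) := by
    rw [bd_push, bd_e hc, map_sum, map_sum, map_sum]
    refine Finset.sum_congr rfl fun v _ => ?_
    rw [map_smul, map_smul, map_smul, foldHtpy_e_of_ge a fun i hi => h i (Finset.mem_of_mem_erase hi)]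
  rw [h1, foldHtpy_e_of_ge a h, sub_sub, bd_contr, sub_self]

theorem foldApp_succ_of_not_ge (a : Fin (N + 1) →o Fin (n + 1)) {k p : ℕ}
    {τ : Finset (Fin (N + 1))} (hc : τ.card = p + 2) (h : ¬ ∀ i ∈ τ, k ≤ (i : ℕ)) :
    foldApp a k (p + 1) (e (p + 1) τ) = push a (p + 1) (e (p + 1) τ) -
      ∑ v ∈ τ, sgn τ v • foldHtpy a k p (e p (τ.erase v)) := by
  change push a (p + 1) (e (p + 1) τ) - bd n (p + 1) (foldHtpy a k (p + 1) (e (p + 1) τ)) -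
    foldHtpy a k p (bd N p (e (p + 1) τ)) = _
  rw [foldHtpy_e_of_not_ge a h, map_zero, sub_zero, bd_e hc, map_sum]
  simp only [map_smul]

/-- The only sign to control is that of the terms `sgn τ v • foldHtpy`. Such a term is nonzero only
if `τ` without `v` lies above `k` while `τ` does not; then `v` is the first vertex of `τ` and its
sign is `-1`, which cancels the minus sign in front of the sum. The contraction itself is positive.
-/
theorem foldApp_e_nonneg (a : Fin (N + 1) →o Fin (n + 1)) (k p : ℕ) {τ : Finset (Fin (N + 1))}
    (hc : τ.card = p + 1) (σ : Face n p) : 0 ≤ foldApp a k p (e p τ) σ := by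
  by_cases h : ∀ i ∈ τ, k ≤ (i : ℕ)
  · cases p with
    | zero => rw [foldApp_zero_of_ge a hc h]; exact e_nonneg _ _ _
    | succ p => rw [foldApp_succ_of_ge a hc h]; rfl
  · cases p with
    | zero => rw [foldApp_zero_of_not_ge a h]; exact push_nonneg _ (e_nonneg _ _) _
    | succ p =>
      rw [foldApp_succ_of_not_ge a hc h, sub_eq_add_neg, ← Finset.sum_neg_distrib,
        Finsupp.add_apply, Finsupp.finsetSum_apply]
      refine add_nonneg (push_nonneg _ (e_nonneg _ _) _) (Finset.sum_nonneg fun v hv => ?_)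
      by_cases h1 : ∀ i ∈ τ.erase v, k ≤ (i : ℕ)
      · rw [foldHtpy_e_of_ge a h1, sgn_eq_neg_one, neg_smul, one_smul, neg_neg]
        · exact contr_nonneg (push_nonneg _ (e_nonneg _ _)) _
        · intro j hj
          by_contra hjv
          push Not at h
          obtain ⟨i, hi, hik⟩ := h
          have hiv : i = v := by
            by_contra hne
            have := h1 i (Finset.mem_erase.2 ⟨hne, hi⟩)
            omega
          subst hiv
          have := h1 j (Finset.mem_erase.2 ⟨fun h' => hjv h'.ge, hj⟩)
          exact hjv (Fin.le_def.2 (by omega))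
      · rw [foldHtpy_e_of_not_ge a h1, smul_zero, neg_zero]; rfl

/-- The morphism that folds the vertices `≥ k` onto the last vertex. -/
noncomputable def foldHom (a : Fin (N + 1) →o Fin (n + 1)) (k : ℕ) : ADC.Hom (adc N) (adc n) where
  app p := (foldApp a k p).toAddMonoidHom
  bd_app p c := by
    change bd n p (foldApp a k (p + 1) c) = foldApp a k p (bd N p c)
    let c : Face N (p + 1) →₀ ℤ := c
    have h1 : foldApp a k (p + 1) c = push a (p + 1) c - bd n (p + 1) (foldHtpy a k (p + 1) c) -
      foldHtpy a k p (bd N p c) := rfl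
    -- On a boundary the third term of `foldApp` in positive degree contains `bd ∘ bd`, so the
    -- formula agrees with that of degree `0`.
    have h2 : foldApp a k p (bd N p c) = push a p (bd N p c) - bd n p (foldHtpy a k p (bd N p c)) := by
      cases p with
      | zero => rfl
      | succ p =>
        change _ - _ - foldHtpy a k p (bd N p (bd N (p + 1) c)) = _
        rw [bd_bd, map_zero, sub_zero]
        rfl
    refine (congrArg (bd n p) h1).trans ?_
    rw [map_sub, map_sub, bd_bd, sub_zero, bd_push]
    exact h2.symm
  aug_app c := by
    let c : Face N 0 →₀ ℤ := c
    change aug n (push a 0 c - bd n 0 (foldHtpy a k 0 c)) = aug N c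
    rw [map_sub, aug_bd, sub_zero, aug_push]
  pos_app p c hc := pos_of_e (P := (adc n).pos p) (f := (foldApp a k p).toAddMonoidHom)
    (fun _ h => foldApp_e_nonneg a k p h) hc

theorem restrictGE_push (f : Fin (m + 1) →o Fin (N + 1)) {k k' : ℕ}
    (h : ∀ j, k ≤ (f j : ℕ) ↔ k' ≤ (j : ℕ)) (p : ℕ) (c : Face m p →₀ ℤ) :
    restrictGE N k p (push f p c) = push f p (restrictGE m k' p c) := by
  suffices h : (restrictGE N k p).comp (push f p) = (push f p).comp (restrictGE m k' p) from
    LinearMap.congr_fun h c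
  refine linearMap_ext_e fun τ hτ => ?_
  rw [LinearMap.comp_apply, LinearMap.comp_apply, push_e f hτ, restrictGE_e, restrictGE_e]
  have : (∀ i ∈ τ.image f, k ≤ (i : ℕ)) ↔ ∀ i ∈ τ, k' ≤ (i : ℕ) := by
    simp only [Finset.forall_mem_image, h]
  by_cases h1 : ∀ i ∈ τ, k' ≤ (i : ℕ)
  · rw [if_pos h1, if_pos (this.2 h1), push_e f hτ]
  · rw [if_neg h1, if_neg fun h' => h1 (this.1 h'), map_zero]

theorem foldHtpy_push (a : Fin (N + 1) →o Fin (n + 1)) (f : Fin (m + 1) →o Fin (N + 1)) {k k' : ℕ}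
    (h : ∀ j, k ≤ (f j : ℕ) ↔ k' ≤ (j : ℕ)) (p : ℕ) (c : Face m p →₀ ℤ) :
    foldHtpy a k p (push f p c) = foldHtpy (a.comp f) k' p c := by
  change contr n p (push a p (restrictGE N k p (push f p c))) = _
  rw [restrictGE_push f h]
  change _ = contr n p (push (a.comp f) p (restrictGE m k' p c))
  rw [push_comp]
  rfl

/-- Folding depends only on the map of vertices and on which vertices count as `≥ k`. This
identifies the faces of a folding as foldings. -/
theorem pushHom_trans_foldHom (a : Fin (N + 1) →o Fin (n + 1)) (f : Fin (m + 1) →o Fin (N + 1))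
    {k k' : ℕ} (h : ∀ j, k ≤ (f j : ℕ) ↔ k' ≤ (j : ℕ)) :
    (pushHom f).trans (foldHom a k) = foldHom (a.comp f) k' := by
  refine ADC.Hom.ext' fun p => AddMonoidHom.ext fun c => ?_
  let c : Face m p →₀ ℤ := c
  change foldApp a k p (push f p c) = foldApp (a.comp f) k' p c
  clear_value c
  cases p with
  | zero =>
    change push a 0 (push f 0 c) - bd n 0 (foldHtpy a k 0 (push f 0 c)) =
      push (a.comp f) 0 c - bd n 0 (foldHtpy (a.comp f) k' 0 c)
    rw [foldHtpy_push a f h, push_comp]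
    rfl
  | succ p =>
    change push a (p + 1) (push f (p + 1) c) - bd n (p + 1) (foldHtpy a k (p + 1) (push f (p + 1) c))
        - foldHtpy a k p (bd N p (push f (p + 1) c)) =
      push (a.comp f) (p + 1) c - bd n (p + 1) (foldHtpy (a.comp f) k' (p + 1) c)
        - foldHtpy (a.comp f) k' p (bd m p c)
    rw [foldHtpy_push a f h, push_comp, bd_push, foldHtpy_push a f h]
    rfl

/-! ### Linked simplices -/

/-- The face operators on morphisms out of a simplex. -/
noncomputable def homFace (i : Fin (n + 2)) (y : ADC.Hom (adc (n + 1)) K) : ADC.Hom (adc n) K :=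
  (pushHom (Fin.succAboveOrderEmb i).toOrderHom).trans y

/-- A morphism out of a simplex is thin if it vanishes on the top face. -/
def HomThin (f : ADC.Hom (adc n) K) : Prop :=
  f.app n (e n Finset.univ : Face n n →₀ ℤ) = 0

/-- Two simplices are linked if they are consecutive faces of a thin simplex whose other faces are
thin. -/
def Linked (f g : ADC.Hom (adc n) K) : Prop :=
  ∃ (y : ADC.Hom (adc (n + 1)) K) (i : Fin (n + 1)), HomThin y ∧ homFace i.castSucc y = f ∧
    homFace i.succ y = g ∧ ∀ j, j ≠ i.castSucc → j ≠ i.succ → HomThin (homFace j y)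

theorem Linked.trans {f g : ADC.Hom (adc n) K} (h : Linked f g) (x : ADC.Hom K L) :
    Linked (f.trans x) (g.trans x) := by
  obtain ⟨y, i, hy, rfl, rfl, hj⟩ := h
  have key : ∀ {m : ℕ} {z : ADC.Hom (adc m) K}, HomThin z → HomThin (z.trans x) := fun {m z} hz =>
    (congrArg (x.app m) hz).trans (map_zero _)
  exact ⟨y.trans x, i, key hy, rfl, rfl, fun j h1 h2 => key (hj j h1 h2)⟩

theorem eqvGen_linked_trans {f g : ADC.Hom (adc n) K} (h : Relation.EqvGen Linked f g)
    (x : ADC.Hom K L) : Relation.EqvGen Linked (f.trans x) (g.trans x) := by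
  induction h with
  | rel _ _ h => exact .rel _ _ (h.trans x)
  | refl => exact .refl _
  | symm _ _ _ ih => exact .symm _ _ ih
  | trans _ _ _ _ _ ih1 ih2 => exact .trans _ _ _ ih1 ih2

theorem image_succAbove_univ (i : Fin (n + 2)) :
    (Finset.univ : Finset (Fin (n + 1))).image (Fin.succAboveOrderEmb i).toOrderHom =
      Finset.univ.erase i := by
  ext v
  simp only [Finset.mem_image, Finset.mem_univ, true_and, Finset.mem_erase, and_true]
  exact Fin.exists_succAbove_eq_iff

theorem homThin_homFace_iff {i : Fin (n + 2)} {y : ADC.Hom (adc (n + 1)) K} :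
    HomThin (homFace i y) ↔ y.app n (e n (Finset.univ.erase i) : Face (n + 1) n →₀ ℤ) = 0 := by
  have h : push (Fin.succAboveOrderEmb i).toOrderHom n (e n Finset.univ) =
      e n (Finset.univ.erase i) := by
    rw [push_e _ (by simp), image_succAbove_univ]
  rw [← h]
  rfl

theorem push_e_eq_zero (f : Fin (n + 1) →o Fin (m + 1)) {p : ℕ} {τ : Finset (Fin (n + 1))}
    {v w : Fin (n + 1)} (hv : v ∈ τ) (hw : w ∈ τ) (hvw : v ≠ w) (h : f v = f w) :
    push f p (e p τ) = 0 := by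
  by_cases hc : τ.card = p + 1
  · rw [push_e f hc, e_of_card_ne]
    intro h'
    exact hvw (Finset.card_image_iff.1 (h'.trans hc.symm) hv hw h)
  · rw [e_of_card_ne hc, map_zero]

theorem predAbove_comp_castSucc (i : Fin (n + 1)) :
    i.predAboveOrderHom.comp (Fin.succAboveOrderEmb i.castSucc).toOrderHom = OrderHom.id := by
  exact congrArg SimplexCategory.Hom.toOrderHom (SimplexCategory.δ_comp_σ_self (i := i))

theorem predAbove_comp_succ (i : Fin (n + 1)) :
    i.predAboveOrderHom.comp (Fin.succAboveOrderEmb i.succ).toOrderHom = OrderHom.id := by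
  exact congrArg SimplexCategory.Hom.toOrderHom (SimplexCategory.δ_comp_σ_succ (i := i))

theorem predAboveOrderHom_castSucc_eq_succ (i : Fin (n + 1)) :
    i.predAboveOrderHom i.castSucc = i.predAboveOrderHom i.succ := by
  change i.predAbove _ = i.predAbove _
  simp

/-- The link is a folding at `i + 1` of the simplex with the vertices `i` and `i + 1` identified.
Removing `i` lowers the threshold to `i`, removing `i + 1` keeps it at `i + 1`. The hypothesis `1 ≤
i` puts both `0` and `i` below the threshold, which makes the linking simplex thin. -/
theorem linked_foldHom (i : Fin (n + 1)) (hi : 1 ≤ (i : ℕ)) :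
    Linked (foldHom (OrderHom.id : Fin (n + 1) →o Fin (n + 1)) i) (foldHom OrderHom.id (i + 1)) := by
  have hne : i.castSucc ≠ i.succ := (Fin.castSucc_lt_succ).ne
  refine ⟨foldHom i.predAboveOrderHom (i + 1), i, ?_, ?_, ?_, fun j h1 h2 => ?_⟩
  -- The pushed face is degenerate because `i` and `i + 1` have the same image. The homotopy terms
  -- vanish too: after removing one vertex, `0` or `i` remains, and both are below `i + 1`.
  · change foldApp _ _ (n + 1) (e (n + 1) _) = 0
    rw [foldApp_succ_of_not_ge _ (by simp), push_e_eq_zero _ (Finset.mem_univ _)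
      (Finset.mem_univ _) hne (predAboveOrderHom_castSucc_eq_succ i), zero_sub, neg_eq_zero]
    · refine Finset.sum_eq_zero fun v _ => ?_
      rw [foldHtpy_e_of_not_ge, smul_zero]
      intro h
      by_cases hv : v = 0
      · have := h i.castSucc (Finset.mem_erase.2
          ⟨fun h' => by rw [hv] at h'; have : (i : ℕ) = 0 := congrArg Fin.val h'; omega,
            Finset.mem_univ _⟩)
        simp at this
      · have := h 0 (Finset.mem_erase.2 ⟨Ne.symm hv, Finset.mem_univ _⟩)
        simp at this
    · intro h
      have := h 0 (Finset.mem_univ _)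
      simp at this
  · unfold homFace
    rw [pushHom_trans_foldHom _ _ (k' := i), predAbove_comp_castSucc]
    intro j
    change (i : ℕ) + 1 ≤ (i.castSucc.succAbove j : ℕ) ↔ _
    rcases lt_or_ge j.castSucc i.castSucc with h | h
    · rw [Fin.succAbove_of_castSucc_lt _ _ h]
      rw [Fin.lt_def] at h
      simp only [Fin.val_castSucc] at h ⊢
      omega
    · rw [Fin.succAbove_of_le_castSucc _ _ h]
      rw [Fin.le_def] at h
      simp only [Fin.val_castSucc, Fin.val_succ] at h ⊢
      omega
  · unfold homFace
    rw [pushHom_trans_foldHom _ _ (k' := i + 1), predAbove_comp_succ]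
    intro j
    change (i : ℕ) + 1 ≤ (i.succ.succAbove j : ℕ) ↔ _
    rcases lt_or_ge j.castSucc i.succ with h | h
    · rw [Fin.succAbove_of_castSucc_lt _ _ h]
      simp
    · rw [Fin.succAbove_of_le_castSucc _ _ h]
      rw [Fin.le_def] at h
      simp only [Fin.val_castSucc, Fin.val_succ] at h ⊢
      omega
  · rw [homThin_homFace_iff]
    change foldApp _ _ n (e n _) = 0
    -- The dimension is positive since `1 ≤ i ≤ n`; hence the positive degree formula for `foldApp`
    -- applies to the faces.
    obtain ⟨n, rfl⟩ : ∃ n', n = n' + 1 := ⟨n - 1, by have := i.is_lt; omega⟩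
    have hc : ((Finset.univ : Finset (Fin (n + 1 + 2))).erase j).card = n + 2 := by
      rw [Finset.card_erase_of_mem (Finset.mem_univ _)]; simp
    have hm1 : i.castSucc ∈ (Finset.univ : Finset (Fin (n + 1 + 2))).erase j :=
      Finset.mem_erase.2 ⟨h1.symm, Finset.mem_univ _⟩
    have hm2 : i.succ ∈ (Finset.univ : Finset (Fin (n + 1 + 2))).erase j :=
      Finset.mem_erase.2 ⟨h2.symm, Finset.mem_univ _⟩
    rw [foldApp_succ_of_not_ge _ hc, push_e_eq_zero _ hm1 hm2 hne
      (predAboveOrderHom_castSucc_eq_succ i), zero_sub, neg_eq_zero]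
    · refine Finset.sum_eq_zero fun v _ => ?_
      -- A homotopy term can be nonzero only if removing `j` and `v` removes everything below `i +
      -- 1`. This forces `v = i = 1` and `j = 0`, and the term is then the contraction of the face
      -- opposite to the first vertex, which is `0` by `contr_erase_zero`.
      by_cases h : ∀ l ∈ ((Finset.univ : Finset (Fin (n + 1 + 2))).erase j).erase v,
          (i : ℕ) + 1 ≤ (l : ℕ)
      · have hv : v = i.castSucc := by
          by_contra hv
          have := h i.castSucc (Finset.mem_erase.2 ⟨Ne.symm hv, hm1⟩)
          simp at this
        have hj : j = 0 := by
          by_contra hj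
          have := h 0 (Finset.mem_erase.2 ⟨fun h' => by
            rw [hv] at h'; have : 0 = (i : ℕ) := congrArg Fin.val h'; omega,
            Finset.mem_erase.2 ⟨Ne.symm hj, Finset.mem_univ _⟩⟩)
          simp at this
        have hi1 : (i : ℕ) = 1 := by
          by_contra hi1
          have := h 1 (Finset.mem_erase.2 ⟨fun h' => by
            rw [hv] at h'; have : 1 = (i : ℕ) := congrArg Fin.val h'; omega,
            Finset.mem_erase.2 ⟨by rw [hj]; simp, Finset.mem_univ _⟩⟩)
          have : (i : ℕ) + 1 ≤ 1 := this
          omega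
        rw [foldHtpy_e_of_ge _ h, push_e, hv, hj]
        · have : Finset.image i.predAboveOrderHom (((Finset.univ : Finset (Fin (n + 1 + 2))).erase
              0).erase i.castSucc) = Finset.univ.erase 0 := by
            ext w
            simp only [Finset.mem_image, Finset.mem_erase, Finset.mem_univ, and_true]
            constructor
            · rintro ⟨l, ⟨hl1, hl2⟩, rfl⟩ h0
              change i.predAbove l = 0 at h0
              have hl3 : i.castSucc < l := by
                rw [Fin.lt_def, Fin.val_castSucc]
                have h3 : (l : ℕ) ≠ 0 := fun h => hl2 (Fin.ext h)
                have h4 : (l : ℕ) ≠ i := fun h => hl1 (Fin.ext h)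
                omega
              rw [Fin.predAbove_of_castSucc_lt _ _ hl3] at h0
              have := congrArg Fin.val h0
              rw [Fin.lt_def] at hl3
              simp at this hl3
              omega
            · intro hw
              have hw' : (w : ℕ) ≠ 0 := fun h => hw (Fin.ext h)
              refine ⟨w.succ, ⟨fun h => ?_, Fin.succ_ne_zero w⟩, ?_⟩
              · have := congrArg Fin.val h
                simp at this
                omega
              · change i.predAbove w.succ = w
                rw [Fin.predAbove_of_castSucc_lt _ _ (by
                  rw [Fin.lt_def, Fin.val_castSucc, Fin.val_succ]; omega)]
                simp
          rw [this, contr_erase_zero, smul_zero]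
        · rw [hv, hj, Finset.card_erase_of_mem, Finset.card_erase_of_mem (Finset.mem_univ _)]
          · simp
          · rw [hj] at hm1; exact hm1
      · rw [foldHtpy_e_of_not_ge _ h, smul_zero]
    · intro h
      have := h i.castSucc hm1
      simp at this

/-- The only face above the threshold `n` is the last vertex, where the contraction vanishes; so no
face is changed. -/
theorem foldHom_last (n : ℕ) :
    foldHom (OrderHom.id : Fin (n + 1) →o Fin (n + 1)) n = ADC.Hom.id (adc n) := by
  refine hom_ext_e fun p τ hτ => ?_
  change foldApp _ _ p (e p τ) = e p τ
  have hid : push (OrderHom.id : Fin (n + 1) →o Fin (n + 1)) p (e p τ) = e p τ :=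
    LinearMap.congr_fun (push_id p) _
  have hlast : ∀ {τ : Finset (Fin (n + 1))}, (∀ i ∈ τ, n ≤ (i : ℕ)) → τ ⊆ {Fin.last n} := by
    intro τ h i hi
    rw [Finset.mem_singleton]
    exact Fin.ext (le_antisymm (Fin.le_last i) (h i hi))
  by_cases h : ∀ i ∈ τ, n ≤ (i : ℕ)
  · have h1 := Finset.card_le_card (hlast h)
    rw [Finset.card_singleton] at h1
    obtain rfl : p = 0 := by omega
    rw [foldApp_zero_of_ge _ hτ h, Finset.eq_of_subset_of_card_le (hlast h) (by simp [hτ])]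
  · cases p with
    | zero => rw [foldApp_zero_of_not_ge _ h, hid]
    | succ p =>
      rw [foldApp_succ_of_not_ge _ hτ h, hid, Finset.sum_eq_zero, sub_zero]
      intro v hv
      by_cases h1 : ∀ i ∈ τ.erase v, n ≤ (i : ℕ)
      · have h2 : (τ.erase v).card = p + 1 := by rw [Finset.card_erase_of_mem hv, hτ]; rfl
        have h3 := Finset.card_le_card (hlast h1)
        rw [Finset.card_singleton] at h3
        obtain rfl : p = 0 := by omega
        rw [foldHtpy_e_of_ge _ h1, Finset.eq_of_subset_of_card_le (hlast h1) (by simp [h2]),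
          push_id, LinearMap.id_apply, contr_last, smul_zero]
      · rw [foldHtpy_e_of_not_ge _ h1, smul_zero]

/-- The threshold is lowered one step at a time from the last vertex. The bound `k ≤ n` keeps it at
least `1`, as `linked_foldHom` requires. -/
theorem eqvGen_linked_foldHom (n k : ℕ) (hk : k ≤ n) :
    Relation.EqvGen Linked (ADC.Hom.id (adc (n + 1)))
      (foldHom (OrderHom.id : Fin (n + 2) →o Fin (n + 2)) (n + 1 - k)) := by
  induction k with
  | zero => rw [Nat.sub_zero, foldHom_last]; exact .refl _
  | succ k ih =>
    refine .trans _ _ _ (ih (by omega)) (.symm _ _ (.rel _ _ ?_))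
    have := linked_foldHom (n := n + 1) ⟨n + 1 - (k + 1), by omega⟩ (by change 1 ≤ n + 1 - (k + 1); omega)
    have h2 : n + 1 - (k + 1) + 1 = n + 1 - k := by omega
    simp only [h2] at this
    exact this

end Simplex
end Globular

namespace Globular

open OmegaCategory

/-! ### The suspension of an augmented directed complex. -/

namespace ADC

/-- The chain groups of the suspension. -/
def SuspK (K : ADC) : ℕ → Type
  | 0 => ℤ × ℤ
  | p + 1 => K.K p

instance SuspK.group (K : ADC) : ∀ p, AddCommGroup (SuspK K p)
  | 0 => inferInstanceAs (AddCommGroup (ℤ × ℤ))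
  | p + 1 => K.group p

/-- The positive chains of the suspension. -/
noncomputable def suspPos (K : ADC) : ∀ p, AddSubmonoid (SuspK K p)
  | 0 => (AddSubmonoid.nonneg (ℤ × ℤ) : AddSubmonoid (ℤ × ℤ))
  | p + 1 => K.pos p

/-- The boundary of the suspension. -/
def suspBd (K : ADC) : ∀ p, SuspK K (p + 1) →+ SuspK K p
  | 0 => (AddMonoidHom.prod (-K.aug) K.aug : K.K 0 →+ ℤ × ℤ)
  | p + 1 => -K.bd p

/-- The (orientation-reversing) suspension: two new basis elements in degree `0`, the source and the
target, and the chains of degree `p` in degree `p + 1`. -/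
noncomputable def susp (K : ADC) : ADC where
  K := SuspK K
  pos := suspPos K
  bd := suspBd K
  aug := (AddMonoidHom.fst ℤ ℤ + AddMonoidHom.snd ℤ ℤ : ℤ × ℤ →+ ℤ)
  bd_bd p c := by
    match p with
    | 0 =>
      let c : K.K 1 := c
      change ((-(K.aug (-(K.bd 0 c))), K.aug (-(K.bd 0 c))) : ℤ × ℤ) = 0
      rw [map_neg, K.aug_bd]
      rfl
    | p + 1 =>
      let c : K.K (p + 2) := c
      change -(K.bd p (-(K.bd (p + 1) c))) = 0
      rw [map_neg, K.bd_bd, neg_zero, neg_zero]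
  aug_bd c := neg_add_cancel (K.aug c)

/-- The suspension of a morphism, in each degree. -/
def suspApp {K L : ADC} (f : Hom K L) : ∀ p, SuspK K p →+ SuspK L p
  | 0 => AddMonoidHom.id (ℤ × ℤ)
  | p + 1 => f.app p

/-- The suspension of a morphism. -/
noncomputable def suspMap {K L : ADC} (f : Hom K L) : Hom (susp K) (susp L) where
  app := suspApp f
  bd_app p c := by
    match p with
    | 0 =>
      let c : K.K 0 := c
      change ((-(L.aug (f.app 0 c)), L.aug (f.app 0 c)) : ℤ × ℤ) = (-(K.aug c), K.aug c)
      rw [f.aug_app]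
    | p + 1 =>
      let c : K.K (p + 1) := c
      change -(L.bd p (f.app (p + 1) c)) = f.app p (-(K.bd p c))
      rw [f.bd_app, map_neg]
  aug_app _ := rfl
  pos_app p c hc := by
    match p with
    | 0 => exact hc
    | p + 1 => exact f.pos_app p c hc

theorem suspMap_trans {K L M : ADC} (f : Hom K L) (g : Hom L M) :
    suspMap (f.trans g) = (suspMap f).trans (suspMap g) := by
  refine Hom.ext' fun p => ?_
  match p with
  | 0 => rfl
  | p + 1 => rfl

theorem suspMap_id (K : ADC) : suspMap (Hom.id K) = Hom.id (susp K) := by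
  refine Hom.ext' fun p => ?_
  match p with
  | 0 => rfl
  | p + 1 => rfl

end ADC

namespace Simplex
variable {n m : ℕ} {K L : ADC}

/-! ### Cones -/

/-- The face of the `(n + 1)`-simplex spanned by `0` and the shift of `τ`. -/
def coneFace (τ : Finset (Fin (n + 1))) : Finset (Fin (n + 2)) := insert 0 (τ.image Fin.succ)

/-- The face of the `n`-simplex whose shift consists of the vertices of `σ` that are not `0`. -/
def unshift (σ : Finset (Fin (n + 2))) : Finset (Fin (n + 1)) :=
  Finset.univ.filter fun i => i.succ ∈ σ

theorem zero_notMem_image_succ (τ : Finset (Fin (n + 1))) : (0 : Fin (n + 2)) ∉ τ.image Fin.succ := by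
  intro h
  obtain ⟨j, _, hj⟩ := Finset.mem_image.1 h
  exact Fin.succ_ne_zero j hj

theorem succ_mem_image_succ {τ : Finset (Fin (n + 1))} {i : Fin (n + 1)} :
    i.succ ∈ τ.image Fin.succ ↔ i ∈ τ := by
  rw [Finset.mem_image]
  exact ⟨fun ⟨j, hj, hji⟩ => Fin.succ_injective _ hji ▸ hj, fun h => ⟨i, h, rfl⟩⟩

theorem succ_mem_coneFace {τ : Finset (Fin (n + 1))} {i : Fin (n + 1)} :
    i.succ ∈ coneFace τ ↔ i ∈ τ := by
  unfold coneFace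
  rw [Finset.mem_insert, succ_mem_image_succ]
  exact ⟨fun h => h.resolve_left (Fin.succ_ne_zero i), Or.inr⟩

theorem zero_mem_coneFace (τ : Finset (Fin (n + 1))) : 0 ∈ coneFace τ := Finset.mem_insert_self _ _

theorem card_image_succ (τ : Finset (Fin (n + 1))) : (τ.image Fin.succ).card = τ.card :=
  Finset.card_image_of_injective _ (Fin.succ_injective _)

theorem card_coneFace (τ : Finset (Fin (n + 1))) : (coneFace τ).card = τ.card + 1 := by
  unfold coneFace
  rw [Finset.card_insert_of_notMem (zero_notMem_image_succ τ), card_image_succ]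

theorem unshift_coneFace (τ : Finset (Fin (n + 1))) : unshift (coneFace τ) = τ := by
  ext i
  simp [unshift, succ_mem_coneFace]

theorem coneFace_unshift {σ : Finset (Fin (n + 2))} (h : 0 ∈ σ) : coneFace (unshift σ) = σ := by
  ext i
  induction i using Fin.cases with
  | zero => simp [zero_mem_coneFace, h]
  | succ i => simp [unshift, succ_mem_coneFace]

theorem coneFace_erase_succ (τ : Finset (Fin (n + 1))) (v : Fin (n + 1)) :
    (coneFace τ).erase v.succ = coneFace (τ.erase v) := by
  ext i
  induction i using Fin.cases with
  | zero => simp [zero_mem_coneFace, (Fin.succ_ne_zero v).symm]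
  | succ i => simp [succ_mem_coneFace]

theorem coneFace_erase_zero (τ : Finset (Fin (n + 1))) :
    (coneFace τ).erase 0 = τ.image Fin.succ := Finset.erase_insert (zero_notMem_image_succ τ)

theorem sgn_coneFace_succ (τ : Finset (Fin (n + 1))) (v : Fin (n + 1)) :
    sgn (coneFace τ) v.succ = - sgn τ v := by
  unfold coneFace
  rw [sgn_insert (zero_notMem_image_succ τ) (Fin.succ_pos v)]
  congr 1
  unfold sgn
  rw [Finset.filter_image, card_image_succ]
  simp

theorem sgn_coneFace_zero (τ : Finset (Fin (n + 1))) : sgn (coneFace τ) 0 = -1 :=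
  sgn_eq_neg_one fun j _ => Fin.zero_le j

/-- The vertex `0` comes first, hence the sign `-1`; it also precedes each shifted vertex, hence the
reversal of the other signs. The function `f` is arbitrary because the formula is used for
boundaries, for maps applied to boundaries and for the folding homotopy. -/
theorem sum_coneFace {A : Type*} [AddCommGroup A] (τ : Finset (Fin (n + 1)))
    (f : Finset (Fin (n + 2)) → A) :
    ∑ v ∈ coneFace τ, sgn (coneFace τ) v • f ((coneFace τ).erase v) =
      - f (τ.image Fin.succ) - ∑ v ∈ τ, sgn τ v • f (coneFace (τ.erase v)) := by
  rw [show coneFace τ = insert 0 (τ.image Fin.succ) from rfl,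
    Finset.sum_insert (zero_notMem_image_succ τ), Finset.sum_image fun _ _ _ _ h => Fin.succ_injective _ h]
  change sgn (coneFace τ) 0 • f ((coneFace τ).erase 0) + ∑ v ∈ τ, sgn (coneFace τ) v.succ •
    f ((coneFace τ).erase v.succ) = _
  simp only [sgn_coneFace_zero, sgn_coneFace_succ, coneFace_erase_succ, coneFace_erase_zero,
    neg_smul, one_smul, Finset.sum_neg_distrib]
  abel

/-- The chain of cones over a chain. -/
noncomputable def cone (n p : ℕ) : (Face n p →₀ ℤ) →ₗ[ℤ] (Face (n + 1) (p + 1) →₀ ℤ) :=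
  Finsupp.linearCombination ℤ fun σ => e (p + 1) (coneFace σ.1)

theorem cone_e {p : ℕ} (τ : Finset (Fin (n + 1))) :
    cone n p (e p τ) = e (p + 1) (coneFace τ) := by
  by_cases h : τ.card = p + 1
  · rw [e_of_card h, cone, Finsupp.linearCombination_single, one_smul]
  · rw [e_of_card_ne h, map_zero, e_of_card_ne]
    rw [card_coneFace]
    omega

/-- The shift of the vertices. -/
def succHom (n : ℕ) : Fin (n + 1) →o Fin (n + 2) := (Fin.succOrderEmb (n + 1)).toOrderHom

theorem push_succHom_e {p : ℕ} {τ : Finset (Fin (n + 1))} (h : τ.card = p + 1) :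
    push (succHom n) p (e p τ) = e p (τ.image Fin.succ) := push_e _ h

theorem bd_cone_zero {τ : Finset (Fin (n + 1))} (h : τ.card = 1) :
    bd (n + 1) 0 (cone n 0 (e 0 τ)) = e 0 {0} - push (succHom n) 0 (e 0 τ) := by
  rw [cone_e, bd_e (by rw [card_coneFace, h]), sum_coneFace, push_succHom_e h]
  obtain ⟨v, rfl⟩ := Finset.card_eq_one.1 h
  have h1 : coneFace (({v} : Finset (Fin (n + 1))).erase v) = {0} := by
    ext i
    simp [coneFace]
  rw [Finset.sum_singleton, h1, sgn_eq_neg_one (by simp)]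
  simp
  abel

theorem bd_cone (p : ℕ) (c : Face n (p + 1) →₀ ℤ) :
    bd (n + 1) (p + 1) (cone n (p + 1) c) = - push (succHom n) (p + 1) c - cone n p (bd n p c) := by
  suffices h : (bd (n + 1) (p + 1)).comp (cone n (p + 1)) =
      - push (succHom n) (p + 1) - (cone n p).comp (bd n p) from LinearMap.congr_fun h c
  refine linearMap_ext_e fun τ h => ?_
  change bd (n + 1) (p + 1) (cone n (p + 1) _) = - push (succHom n) (p + 1) _ - cone n p (bd n p _)
  rw [cone_e, bd_e (by rw [card_coneFace, h]), sum_coneFace, push_succHom_e h, bd_e h, map_sum]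
  simp only [map_smul, cone_e]

open Classical in
/-- The part of a chain that consists of cones. -/
noncomputable def uncone (n p : ℕ) : (Face (n + 1) (p + 1) →₀ ℤ) →ₗ[ℤ] (Face n p →₀ ℤ) :=
  Finsupp.linearCombination ℤ fun σ => if 0 ∈ σ.1 then e p (unshift σ.1) else 0

theorem uncone_e_of_notMem {p : ℕ} {σ : Finset (Fin (n + 2))} (h : 0 ∉ σ) :
    uncone n p (e (p + 1) σ) = 0 := by
  by_cases hc : σ.card = p + 2
  · rw [e_of_card hc, uncone, Finsupp.linearCombination_single, one_smul, if_neg h]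
  · rw [e_of_card_ne hc, map_zero]

theorem uncone_e_coneFace {p : ℕ} (τ : Finset (Fin (n + 1))) :
    uncone n p (e (p + 1) (coneFace τ)) = e p τ := by
  by_cases hc : (coneFace τ).card = p + 2
  · rw [e_of_card hc, uncone, Finsupp.linearCombination_single, one_smul,
      if_pos (zero_mem_coneFace τ), unshift_coneFace]
  · rw [e_of_card_ne hc, map_zero, e_of_card_ne]
    rw [card_coneFace] at hc
    omega

/-- The face of a cone opposite to `0` is not a cone, and the remaining signs are reversed by
`sum_coneFace`. This reversal is the reason for the minus sign in the boundary of the suspension. -/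
theorem bd_uncone (p : ℕ) (c : Face (n + 1) (p + 2) →₀ ℤ) :
    -(bd n p (uncone n (p + 1) c)) = uncone n p (bd (n + 1) (p + 1) c) := by
  suffices h : -((bd n p).comp (uncone n (p + 1))) = (uncone n p).comp (bd (n + 1) (p + 1)) from
    LinearMap.congr_fun h c
  refine linearMap_ext_e fun σ h => ?_
  change -(bd n p (uncone n (p + 1) _)) = uncone n p (bd (n + 1) (p + 1) _)
  rw [bd_e h, map_sum]
  simp only [map_smul]
  by_cases h0 : 0 ∈ σ
  · obtain ⟨τ, rfl⟩ : ∃ τ, σ = coneFace τ := ⟨_, (coneFace_unshift h0).symm⟩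
    rw [card_coneFace] at h
    rw [uncone_e_coneFace, bd_e (by omega), sum_coneFace τ fun σ => uncone n p (e (p + 1) σ),
      uncone_e_of_notMem (zero_notMem_image_succ τ)]
    simp only [uncone_e_coneFace]
    simp
  · rw [uncone_e_of_notMem h0, map_zero, neg_zero]
    refine (Finset.sum_eq_zero fun v _ => ?_).symm
    rw [uncone_e_of_notMem fun h' => h0 (Finset.mem_of_mem_erase h'), smul_zero]

open Classical in
/-- The map on vertices from a simplex to a suspension. -/
noncomputable def coneZero (n : ℕ) : (Face (n + 1) 0 →₀ ℤ) →ₗ[ℤ] ℤ × ℤ :=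
  Finsupp.linearCombination ℤ fun σ => if 0 ∈ σ.1 then (0, 1) else (1, 0)

open Classical in
theorem coneZero_e {σ : Finset (Fin (n + 2))} (h : σ.card = 1) :
    coneZero n (e 0 σ) = if 0 ∈ σ then (0, 1) else (1, 0) := by
  rw [e_of_card h, coneZero, Finsupp.linearCombination_single, one_smul]

/-- The components of the morphism from a simplex to the suspension of its last face. -/
noncomputable def toSuspApp (n : ℕ) : ∀ p, (Face (n + 1) p →₀ ℤ) →+ ADC.SuspK (adc n) p
  | 0 => (coneZero n).toAddMonoidHom
  | p + 1 => (uncone n p).toAddMonoidHom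

/-- An edge from `0` runs between the two poles of the suspension. An edge without `0` has both ends
at the same pole, so its boundary vanishes there. -/
theorem coneZero_bd (c : Face (n + 1) 1 →₀ ℤ) :
    ((-(aug n (uncone n 0 c)), aug n (uncone n 0 c)) : ℤ × ℤ) = coneZero n (bd (n + 1) 0 c) := by
  suffices h : LinearMap.prod (-(aug n).comp (uncone n 0)) ((aug n).comp (uncone n 0)) =
    (coneZero n).comp (bd (n + 1) 0) from LinearMap.congr_fun h c
  refine linearMap_ext_e fun σ h => ?_
  change ((-(aug n (uncone n 0 _)), aug n (uncone n 0 _)) : ℤ × ℤ) = coneZero n (bd (n + 1) 0 _)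
  rw [bd_e h, map_sum]
  simp only [map_smul]
  by_cases h0 : 0 ∈ σ
  · obtain ⟨τ, rfl⟩ : ∃ τ, σ = coneFace τ := ⟨_, (coneFace_unshift h0).symm⟩
    rw [card_coneFace] at h
    have h : τ.card = 1 := by omega
    rw [uncone_e_coneFace, aug_e h, sum_coneFace τ fun σ => coneZero n (e 0 σ),
      coneZero_e (by rw [card_image_succ, h]), if_neg (zero_notMem_image_succ τ)]
    obtain ⟨v, rfl⟩ := Finset.card_eq_one.1 h
    rw [Finset.sum_singleton, coneZero_e (by rw [card_coneFace]; simp), if_pos (zero_mem_coneFace _),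
      sgn_eq_neg_one (by simp)]
    simp
  · rw [uncone_e_of_notMem h0, map_zero]
    have h1 : ∀ v ∈ σ, sgn σ v • coneZero n (e 0 (σ.erase v)) = sgn σ v • ((1, 0) : ℤ × ℤ) := by
      intro v hv
      rw [coneZero_e (by rw [Finset.card_erase_of_mem hv, h]),
        if_neg fun h' => h0 (Finset.mem_of_mem_erase h')]
    -- The sum of the signs is the augmentation of the boundary of the edge.
    have h2 : ∑ v ∈ σ, sgn σ v = 0 := by
      have h3 := aug_bd (n := n + 1) (e 1 σ)
      rw [bd_e h, map_sum] at h3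
      rw [← h3]
      refine Finset.sum_congr rfl fun v hv => ?_
      rw [map_smul, aug_e (by rw [Finset.card_erase_of_mem hv, h]), smul_eq_mul, mul_one]
    rw [Finset.sum_congr rfl h1, ← Finset.sum_smul, h2, zero_smul]
    rfl

/-- The morphism from a simplex to the suspension of the face opposite to its first vertex. -/
noncomputable def toSusp (n : ℕ) : ADC.Hom (adc (n + 1)) (ADC.susp (adc n)) where
  app := toSuspApp n
  bd_app p c := by
    match p with
    | 0 => exact coneZero_bd c
    | p + 1 => exact bd_uncone p c
  aug_app c := by
    let s : ℤ × ℤ →ₗ[ℤ] ℤ := LinearMap.fst ℤ ℤ ℤ + LinearMap.snd ℤ ℤ ℤ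
    suffices h : s.comp (coneZero n) = aug (n + 1) from LinearMap.congr_fun h c
    refine linearMap_ext_e fun σ h => ?_
    rw [LinearMap.comp_apply, coneZero_e h, aug_e h]
    split_ifs <;> rfl
  pos_app p c hc := by
    refine pos_of_e (P := ADC.suspPos (adc n) p) (f := toSuspApp n p) (fun τ h => ?_) hc
    match p with
    | 0 =>
      change 0 ≤ coneZero n (e 0 τ)
      rw [coneZero_e h]
      split_ifs
      · exact ⟨le_rfl, zero_le_one⟩
      · exact ⟨zero_le_one, le_rfl⟩
    | p + 1 =>
      intro σ
      change 0 ≤ uncone n p (e (p + 1) τ) σ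
      by_cases h0 : 0 ∈ τ
      · rw [← coneFace_unshift h0, uncone_e_coneFace]; exact e_nonneg _ _ _
      · rw [uncone_e_of_notMem h0]; rfl

/-- The components of the morphism from the suspension. -/
noncomputable def ofSuspApp (n : ℕ) : ∀ p, ADC.SuspK (adc n) p →+ (Face (n + 1) p →₀ ℤ)
  | 0 => ((LinearMap.toSpanSingleton ℤ _ (e 0 {Fin.last (n + 1)})).comp (LinearMap.fst ℤ ℤ ℤ) +
      (LinearMap.toSpanSingleton ℤ _ (e 0 {0})).comp (LinearMap.snd ℤ ℤ ℤ) :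
        ℤ × ℤ →ₗ[ℤ] (Face (n + 1) 0 →₀ ℤ)).toAddMonoidHom
  | p + 1 => (cone n p + (contr (n + 1) p).comp (push (succHom n) p) :
      (Face n p →₀ ℤ) →ₗ[ℤ] (Face (n + 1) (p + 1) →₀ ℤ)).toAddMonoidHom

theorem ofSuspApp_zero (a b : ℤ) : ofSuspApp n 0 (a, b) =
    a • e 0 {Fin.last (n + 1)} + b • e 0 {0} := rfl

theorem ofSuspApp_succ {p : ℕ} (c : Face n p →₀ ℤ) : ofSuspApp n (p + 1) c =
    cone n p c + contr (n + 1) p (push (succHom n) p c) := rfl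

/-- The morphism from the suspension of the face opposite to the first vertex to the simplex. -/
noncomputable def ofSusp (n : ℕ) : ADC.Hom (ADC.susp (adc n)) (adc (n + 1)) where
  app := ofSuspApp n
  bd_app p c := by
    match p with
    | 0 =>
      let c : Face n 0 →₀ ℤ := c
      change bd (n + 1) 0 (cone n 0 c + contr (n + 1) 0 (push (succHom n) 0 c)) =
        (-(aug n c)) • e 0 {Fin.last (n + 1)} + aug n c • e 0 {0}
      suffices h : (bd (n + 1) 0).comp (cone n 0 + (contr (n + 1) 0).comp (push (succHom n) 0)) =
          (LinearMap.toSpanSingleton ℤ _ (e 0 {Fin.last (n + 1)})).comp (-(aug n)) +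
          (LinearMap.toSpanSingleton ℤ _ (e 0 {0})).comp (aug n) from LinearMap.congr_fun h c
      refine linearMap_ext_e fun τ h => ?_
      change bd (n + 1) 0 (cone n 0 (e 0 τ) + contr (n + 1) 0 (push (succHom n) 0 (e 0 τ))) =
        (-(aug n (e 0 τ))) • e 0 {Fin.last (n + 1)} + aug n (e 0 τ) • e 0 {0}
      rw [map_add, bd_cone_zero h, push_succHom_e h, bd_contr_zero (by rw [card_image_succ, h]),
        aug_e h]
      module
    | p + 1 =>
      let c : Face n (p + 1) →₀ ℤ := c
      change bd (n + 1) (p + 1) (cone n (p + 1) c + contr (n + 1) (p + 1) (push (succHom n) (p + 1) c)) =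
        cone n p (-(bd n p c)) + contr (n + 1) p (push (succHom n) p (-(bd n p c)))
      -- The boundary of the cone leaves `-push (succHom n)`, which is not in the image of the
      -- suspension; the boundary of the contraction of the shifted chain cancels it.
      have h := bd_contr p (push (succHom n) (p + 1) c)
      rw [map_add, bd_cone, eq_sub_of_add_eq h, bd_push]
      simp only [map_neg]
      abel
  aug_app c := by
    obtain ⟨a, b⟩ : ℤ × ℤ := c
    change aug (n + 1) (a • e 0 {Fin.last (n + 1)} + b • e 0 {0}) = a + b
    rw [map_add, map_smul, map_smul, aug_e (by simp), aug_e (by simp)]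
    simp
  pos_app p c hc := by
    match p with
    | 0 =>
      obtain ⟨a, b⟩ : ℤ × ℤ := c
      have hc : (0 : ℤ × ℤ) ≤ (a, b) := hc
      intro σ
      exact add_nonneg (mul_nonneg hc.1 (e_nonneg _ _ _)) (mul_nonneg hc.2 (e_nonneg _ _ _))
    | p + 1 =>
      refine pos_of_e (P := (adc (n + 1)).pos (p + 1)) (f := ofSuspApp n (p + 1))
        (fun τ _ σ => ?_) hc
      change 0 ≤ cone n p (e p τ) σ + contr (n + 1) p (push (succHom n) p (e p τ)) σ
      rw [cone_e]
      exact add_nonneg (e_nonneg _ _ _) (contr_nonneg (push_nonneg _ (e_nonneg _ _)) _)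

/-- Folding at `1` sends the faces without `0` to the last vertex in degree `0` and to zero above.
To a face containing `0` and at least one more vertex it adds the contraction of the opposite face,
the only one of its faces with all vertices `≥ 1`. These are exactly the values of `ofSusp` on the
two poles and on cones. -/
theorem toSusp_trans_ofSusp (n : ℕ) :
    (toSusp n).trans (ofSusp n) = foldHom (OrderHom.id : Fin (n + 2) →o Fin (n + 2)) 1 := by
  refine hom_ext_e fun p σ h => ?_
  have hge : (∀ i ∈ σ, 1 ≤ (i : ℕ)) ↔ 0 ∉ σ := by
    constructor
    · intro h1 h0
      have := h1 0 h0
      simp at this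
    · intro h0 i hi
      rw [Nat.one_le_iff_ne_zero]
      exact fun h' => h0 (by rwa [← Fin.ext (a := i) (b := 0) h'])
  match p with
  | 0 =>
    change ofSuspApp n 0 (coneZero n (e 0 σ)) = foldApp _ _ 0 (e 0 σ)
    rw [coneZero_e h]
    by_cases h0 : 0 ∈ σ
    · rw [if_pos h0, ofSuspApp_zero, foldApp_zero_of_not_ge _ (by rw [hge]; simpa using h0), push_id]
      obtain ⟨v, rfl⟩ := Finset.card_eq_one.1 h
      rw [Finset.mem_singleton] at h0
      subst h0
      simp
    · rw [if_neg h0, ofSuspApp_zero, foldApp_zero_of_ge _ h (hge.2 h0)]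
      simp
  | p + 1 =>
    change ofSuspApp n (p + 1) (uncone n p (e (p + 1) σ)) = foldApp _ _ (p + 1) (e (p + 1) σ)
    by_cases h0 : 0 ∈ σ
    · rw [foldApp_succ_of_not_ge _ h (by rw [hge]; simpa using h0), push_id]
      obtain ⟨τ, rfl⟩ : ∃ τ, σ = coneFace τ := ⟨_, (coneFace_unshift h0).symm⟩
      rw [card_coneFace] at h
      rw [uncone_e_coneFace, ofSuspApp_succ, cone_e, push_succHom_e (by omega),
        sum_coneFace τ fun σ => foldHtpy OrderHom.id 1 p (e p σ), foldHtpy_e_of_ge, push_id,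
        Finset.sum_eq_zero]
      · simp
      · intro v _
        rw [foldHtpy_e_of_not_ge, smul_zero]
        intro h'
        have := h' 0 (zero_mem_coneFace _)
        simp at this
      · intro i hi
        obtain ⟨j, _, rfl⟩ := Finset.mem_image.1 hi
        simp
    · rw [uncone_e_of_notMem h0, foldApp_succ_of_ge _ h (hge.2 h0)]
      exact map_zero (ofSuspApp n (p + 1))

/-- The cone construction on morphisms out of simplices. -/
noncomputable def coneHom (f : ADC.Hom (adc n) K) : ADC.Hom (adc (n + 1)) (ADC.susp K) :=
  (toSusp n).trans (ADC.suspMap f)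

theorem image_succAbove_succ_coneFace (j : Fin (n + 2)) (τ : Finset (Fin (n + 1))) :
    (coneFace τ).image (Fin.succAboveOrderEmb j.succ).toOrderHom =
      coneFace (τ.image (Fin.succAboveOrderEmb j).toOrderHom) := by
  unfold coneFace
  rw [Finset.image_insert, Finset.image_image, Finset.image_image]
  congr 1
  refine Finset.image_congr fun i _ => ?_
  exact Fin.succ_succAbove_succ j i

theorem zero_mem_image_succAbove_succ (j : Fin (n + 2)) (σ : Finset (Fin (n + 2))) :
    0 ∈ σ.image (Fin.succAboveOrderEmb j.succ).toOrderHom ↔ 0 ∈ σ := by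
  constructor
  · intro h
    obtain ⟨i, hi, h0⟩ := Finset.mem_image.1 h
    have h1 : (Fin.succAboveOrderEmb j.succ).toOrderHom (0 : Fin (n + 2)) = 0 :=
      Fin.succ_succAbove_zero j
    have : i = 0 := (Fin.succAboveOrderEmb j.succ).injective (h0.trans h1.symm)
    exact this ▸ hi
  · exact fun h => Finset.mem_image.2 ⟨0, h, Fin.succ_succAbove_zero j⟩

/-- Removing the vertex `j + 1` from a cone removes `j` from its base and keeps the apex. -/
theorem homFace_succ_coneHom (j : Fin (n + 2)) (y : ADC.Hom (adc (n + 1)) K) :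
    homFace j.succ (coneHom y) = coneHom (homFace j y) := by
  suffices h : (pushHom (Fin.succAboveOrderEmb j.succ).toOrderHom).trans (toSusp (n + 1)) =
      (toSusp n).trans (ADC.suspMap (pushHom (Fin.succAboveOrderEmb j).toOrderHom)) by
    unfold homFace coneHom
    rw [← ADC.Hom.trans_assoc, h, ADC.suspMap_trans, ADC.Hom.trans_assoc]
  refine hom_ext_e fun p σ h => ?_
  have hc : (σ.image (Fin.succAboveOrderEmb j.succ).toOrderHom).card = p + 1 := by
    exact (Finset.card_image_of_injective _ (Fin.succAboveOrderEmb j.succ).injective).trans h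
  match p with
  | 0 =>
    change coneZero (n + 1) (push _ 0 (e 0 σ)) = coneZero n (e 0 σ)
    rw [push_e _ h, coneZero_e hc, coneZero_e h]
    simp only [zero_mem_image_succAbove_succ]
  | p + 1 =>
    change uncone (n + 1) p (push _ (p + 1) (e (p + 1) σ)) =
      push (Fin.succAboveOrderEmb j).toOrderHom p (uncone n p (e (p + 1) σ))
    rw [push_e _ h]
    by_cases h0 : 0 ∈ σ
    · obtain ⟨τ, rfl⟩ : ∃ τ, σ = coneFace τ := ⟨_, (coneFace_unshift h0).symm⟩
      rw [card_coneFace] at h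
      rw [image_succAbove_succ_coneFace, uncone_e_coneFace, uncone_e_coneFace, push_e _ (by omega)]
    · rw [uncone_e_of_notMem h0, map_zero,
        uncone_e_of_notMem fun h' => h0 ((zero_mem_image_succAbove_succ j σ).1 h')]

theorem HomThin.coneHom {f : ADC.Hom (adc n) K} (h : HomThin f) : HomThin (coneHom f) := by
  have h1 : (Finset.univ : Finset (Fin (n + 2))) = coneFace Finset.univ := by
    ext i
    induction i using Fin.cases with
    | zero => simp [zero_mem_coneFace]
    | succ i => simp [succ_mem_coneFace]
  change f.app n (uncone n n (e (n + 1) Finset.univ)) = 0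
  rw [h1, uncone_e_coneFace]
  exact h

/-- The cone over a link is a link with all indices shifted by one. The only new face is the one
opposite to the apex; it contains no cone, so it goes to zero and is thin. -/
theorem Linked.coneHom {f g : ADC.Hom (adc n) K} (h : Linked f g) :
    Linked (coneHom f) (coneHom g) := by
  obtain ⟨y, i, hy, rfl, rfl, hj⟩ := h
  refine ⟨Simplex.coneHom y, i.succ, hy.coneHom, ?_, homFace_succ_coneHom _ _, fun j h1 h2 => ?_⟩
  · exact homFace_succ_coneHom i.castSucc y
  · induction j using Fin.cases with
    | zero =>
      rw [homThin_homFace_iff]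
      change y.app n (uncone (n + 1) n (e (n + 1) _)) = 0
      rw [uncone_e_of_notMem (by simp)]
      exact map_zero (y.app n)
    | succ j =>
      rw [homFace_succ_coneHom]
      exact (hj j (fun h => h1 (by rw [h]; rfl)) (fun h => h2 (by rw [h]))).coneHom

theorem eqvGen_linked_coneHom {f g : ADC.Hom (adc n) K} (h : Relation.EqvGen Linked f g) :
    Relation.EqvGen Linked (coneHom f) (coneHom g) := by
  induction h with
  | rel _ _ h => exact .rel _ _ h.coneHom
  | refl => exact .refl _
  | symm _ _ _ ih => exact .symm _ _ ih
  | trans _ _ _ _ _ ih1 ih2 => exact .trans _ _ _ ih1 ih2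

end Simplex

/-! ### The globe and its suspension. -/

namespace Globe

/-- The components of the morphism from the globe to its suspension. -/
def toSuspApp : ∀ p, adc.K p →+ ADC.SuspK adc p
  | 0 => ({ toFun := fun c => (c false, c true)
            map_zero' := rfl
            map_add' := fun _ _ => rfl } : (Bool → ℤ) →+ ℤ × ℤ)
  | _ + 1 => ({ toFun := fun c α => c (!α)
                map_zero' := rfl
                map_add' := fun _ _ => rfl } : (Bool → ℤ) →+ (Bool → ℤ))

/-- The morphism from the globe to its suspension. -/
noncomputable def toSusp : ADC.Hom adc (ADC.susp adc) where
  app := toSuspApp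
  bd_app p c := by
    match p with
    | 0 =>
      let c : Bool → ℤ := c
      change ((-(c true + c false), c true + c false) : ℤ × ℤ) =
        (-(c false + c true), c false + c true)
      rw [add_comm]
    | p + 1 =>
      let c : Bool → ℤ := c
      funext α
      change -(if α then c true + c false else -(c true + c false)) =
        if (!α) then c false + c true else -(c false + c true)
      cases α <;> simp <;> ring
  aug_app _ := rfl
  pos_app p c hc := by
    match p with
    | 0 => exact ⟨hc false, hc true⟩
    | p + 1 => exact fun α => hc (!α)

end Globe

namespace Simplex
variable {n : ℕ}

/-- The cone over `τ` contains `0, …, p` exactly when `τ` contains `0, …, p - 1`, and likewise for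
the next vertex, so the label of the cone is that of `τ` in the next degree. The parity of the
degree changes, so the sign is reversed, which `Globe.toSusp` compensates. -/
theorem toSusp_trans_suspMap_collapse (n : ℕ) :
    (toSusp n).trans (ADC.suspMap (collapse n)) = (collapse (n + 1)).trans Globe.toSusp := by
  refine hom_ext_e fun p σ h => ?_
  match p with
  | 0 =>
    change coneZero n (e 0 σ) = Globe.toSuspApp 0 (collapseApp (n + 1) 0 (e 0 σ))
    rw [coneZero_e h, collapseApp_e h]
    have h1 : label 0 σ = Pi.single (if 0 ∈ σ then true else false) 1 := by
      unfold label
      rw [if_pos (fun i hi => absurd hi (Nat.not_lt_zero _))]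
      congr 1
      by_cases h0 : 0 ∈ σ
      · rw [if_pos h0, if_pos ⟨0, h0, rfl⟩]; rfl
      · rw [if_neg h0, if_neg]
        · rfl
        · rintro ⟨i, hi, hi0⟩
          exact h0 (by rwa [← Fin.ext (a := i) (b := 0) hi0])
    rw [h1]
    split_ifs <;> rfl
  | p + 1 =>
    change collapseApp n p (uncone n p (e (p + 1) σ)) =
      fun α => collapseApp (n + 1) (p + 1) (e (p + 1) σ) (!α)
    rw [collapseApp_e h]
    by_cases h0 : 0 ∈ σ
    · obtain ⟨τ, rfl⟩ : ∃ τ, σ = coneFace τ := ⟨_, (coneFace_unshift h0).symm⟩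
      rw [card_coneFace] at h
      rw [uncone_e_coneFace, collapseApp_e (by omega)]
      have h1 : (∀ i : Fin (n + 2), (i : ℕ) < p + 1 → i ∈ coneFace τ) ↔
          ∀ i : Fin (n + 1), (i : ℕ) < p → i ∈ τ := by
        constructor
        · exact fun h i hi => succ_mem_coneFace.1 (h i.succ (by simpa using hi))
        · intro h i hi
          induction i using Fin.cases with
          | zero => exact zero_mem_coneFace τ
          | succ i => exact succ_mem_coneFace.2 (h i (by simpa using hi))
      have h2 : (∃ i ∈ coneFace τ, (i : ℕ) = p + 1) ↔ ∃ i ∈ τ, (i : ℕ) = p := by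
        constructor
        · rintro ⟨i, hi, hip⟩
          induction i using Fin.cases with
          | zero => simp at hip
          | succ i => exact ⟨i, succ_mem_coneFace.1 hi, by simpa using hip⟩
        · rintro ⟨i, hi, hip⟩
          exact ⟨i.succ, succ_mem_coneFace.2 hi, by simp [hip]⟩
      have h3 : ∀ q : ℕ, decide (Odd (q + 1)) = !decide (Odd q) := fun q => by
        rw [Bool.eq_iff_iff]; simp [Nat.odd_add_one]
      unfold label
      simp only [h1, h2]
      by_cases h4 : ∀ i : Fin (n + 1), (i : ℕ) < p → i ∈ τ
      · rw [if_pos h4, if_pos h4]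
        funext α
        by_cases h5 : ∃ i ∈ τ, (i : ℕ) = p
        · rw [if_pos h5, if_pos h5, h3 (p + 1)]
          generalize decide (Odd (p + 1)) = b
          cases b <;> cases α <;> rfl
        · rw [if_neg h5, if_neg h5, h3 p]
          generalize decide (Odd p) = b
          cases b <;> cases α <;> rfl
      · rw [if_neg h4, if_neg h4]
        rfl
    · rw [uncone_e_of_notMem h0, map_zero]
      have : label (p + 1) σ = 0 := if_neg fun h' => h0 (h' 0 (Nat.succ_pos p))
      rw [this]
      rfl

/-- The components of the morphism from the globe to the point. -/
noncomputable def ofGlobeZeroApp : ∀ p, Globe.adc.K p →+ (Face 0 p →₀ ℤ)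
  | 0 => ((LinearMap.toSpanSingleton ℤ _ (e 0 Finset.univ)).comp
      (LinearMap.proj (R := ℤ) (φ := fun _ : Bool => ℤ) false +
      LinearMap.proj (R := ℤ) (φ := fun _ : Bool => ℤ) true) :
        (Bool → ℤ) →ₗ[ℤ] (Face 0 0 →₀ ℤ)).toAddMonoidHom
  | _ + 1 => 0

theorem ofGlobeZeroApp_zero (c : Bool → ℤ) :
    ofGlobeZeroApp 0 c = (c false + c true) • e 0 Finset.univ := rfl

/-- The morphism from the globe to the point. -/
noncomputable def ofGlobeZero : ADC.Hom Globe.adc (adc 0) where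
  app := ofGlobeZeroApp
  bd_app p c := by
    match p with
    | 0 =>
      let c : Bool → ℤ := c
      refine (map_zero (bd 0 0)).trans ?_
      change 0 = (-(c false + c true) + (c false + c true)) • (e 0 Finset.univ : Face 0 0 →₀ ℤ)
      rw [neg_add_cancel, zero_smul]
    | p + 1 => exact map_zero (bd 0 (p + 1))
  aug_app c := by
    let c : Bool → ℤ := c
    change aug 0 ((c false + c true) • e 0 Finset.univ) = c false + c true
    rw [map_smul, aug_e (by simp), smul_eq_mul, mul_one]
  pos_app p c hc := by
    match p with
    | 0 => exact fun σ => mul_nonneg (add_nonneg (hc false) (hc true)) (e_nonneg _ _ _)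
    | p + 1 => exact zero_mem ((adc 0).pos (p + 1))

theorem collapse_trans_ofGlobeZero : (collapse 0).trans ofGlobeZero = ADC.Hom.id (adc 0) := by
  refine hom_ext_e fun p σ h => ?_
  have h1 : σ.card ≤ 1 := by simpa using Finset.card_le_univ σ
  obtain rfl : p = 0 := by omega
  have h2 : σ = Finset.univ := (Finset.card_eq_iff_eq_univ σ).1 (by simpa using h)
  change ofGlobeZeroApp 0 (collapseApp 0 0 (e 0 σ)) = e 0 σ
  have h3 : ∃ β, label 0 σ = Pi.single β 1 := ⟨_, if_pos fun i hi => absurd hi (Nat.not_lt_zero _)⟩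
  obtain ⟨β, hβ⟩ := h3
  rw [collapseApp_e h, hβ, ofGlobeZeroApp_zero, h2]
  cases β <;> simp

/-- The identity of a simplex is connected by links to a morphism that factors through the
collapse. -/
theorem exists_eqvGen_linked_collapse (n : ℕ) : ∃ g : ADC.Hom Globe.adc (adc n),
    Relation.EqvGen Linked (ADC.Hom.id (adc n)) ((collapse n).trans g) := by
  induction n with
  | zero => exact ⟨ofGlobeZero, by rw [collapse_trans_ofGlobeZero]; exact .refl _⟩
  | succ n ih =>
    obtain ⟨g, hg⟩ := ih
    -- The factorisation runs through the suspensions of the smaller globe and of the smaller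
    -- simplex, and returns by `ofSusp`.
    refine ⟨Globe.toSusp.trans ((ADC.suspMap g).trans (ofSusp n)), ?_⟩
    have h1 := eqvGen_linked_foldHom n n le_rfl
    rw [Nat.add_sub_cancel_left, ← toSusp_trans_ofSusp] at h1
    -- The cone over the identity is `toSusp n`, so this chain of links starts at the folding at
    -- `1`, where `h1` ends.
    have h2 := eqvGen_linked_trans (eqvGen_linked_coneHom hg) (ofSusp n)
    unfold coneHom at h2
    rw [ADC.suspMap_id, ADC.suspMap_trans, ← ADC.Hom.trans_assoc, toSusp_trans_suspMap_collapse] at h2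
    exact h1.trans _ _ _ h2

end Simplex
end Globular

/-! ### Thin simplices and simplices that factor through the collapse. -/

namespace Globular

open OmegaCategory

/-- Since the component in degree `m + 1` vanishes, the boundary formula forces the two components
in degree `m` to coincide; so `d_m` changes nothing. -/
theorem ADC.Cell.dimLE {K : ADC} {z : K.Cell} {m : ℕ} (h : ∀ p, m < p → ∀ α, z.x p α = 0) :
    DimLE m z := by
  intro γ
  refine ADC.Cell.ext' fun p α => ?_
  change (ADC.Cell.dOp m γ z).x p α = _
  rw [ADC.Cell.dOp_x]
  split_ifs with h1 h2
  · rfl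
  · subst h2
    have h3 : z.x p true = z.x p false := by
      have := z.bd p true
      rw [h _ (Nat.lt_succ_self p), map_zero] at this
      exact (sub_eq_zero.1 this.symm)
    cases γ <;> cases α <;> first | rfl | exact h3 | exact h3.symm
  · exact (h p (by omega) α).symm

namespace Simplex
variable {n m : ℕ}

theorem chain_eq_zero {p : ℕ} (h : n < p) (c : Face n p →₀ ℤ) : c = 0 := by
  ext σ
  have h1 := Finset.card_le_univ σ.1
  have h2 := σ.2
  rw [Fintype.card_fin] at h1
  omega

/-- In degree `n + 1` the top element is the top face alone, and there are no chains above. -/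
theorem dimLE_of_homThin {K : ADC} {f : ADC.Hom (adc (n + 1)) K} (h : HomThin f) :
    DimLE n ((ADC.Cell.map f).toFun (top (n + 1))) := by
  refine ADC.Cell.dimLE fun p hp α => ?_
  change f.app p (topChain (n + 1) p α) = 0
  rcases Nat.lt_or_ge (n + 1) p with h1 | h1
  · rw [topChain_eq_zero h1]; exact map_zero (f.app p)
  · obtain rfl : p = n + 1 := by omega
    rw [topChain_self]
    exact h

end Simplex

section
variable {D : Type u} [OmegaCategory D] {n : ℕ}

theorem Simplex.exists_atom_collapse (c : Oriental n) : ∃ p ≤ n, ∃ α,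
    (ADC.Cell.map (collapse n)).toFun c = Globe.atom p α := by
  obtain ⟨p, α, h⟩ := Globe.exists_atom ((ADC.Cell.map (collapse n)).toFun c)
  refine ⟨p, ?_, α, h⟩
  by_contra hp
  have h1 : ((ADC.Cell.map (collapse n)).toFun c).x p α = 0 := by
    change collapseApp n p (c.x p α) = 0
    rw [chain_eq_zero (not_le.1 hp) (c.x p α), map_zero]
  rw [h, Globe.atom_x] at h1
  simp only [Globe.atomX, lt_irrefl, if_false, if_true] at h1
  exact Globe.single_ne α h1

/-- A simplex that factors through the collapse is of the form `□(u)`. -/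
theorem exists_box_of_collapse (h : OmegaFunctor Globe.adc.Cell D) :
    ∃ u : D, DimLE n u ∧ (ADC.Cell.map (Simplex.collapse n)).trans h = box n u := by
  obtain ⟨β, hβ⟩ := Simplex.collapse_top n
  have hdim : DimLE n (Globe.atom n β) := fun γ => by rw [Globe.d_atom, if_pos le_rfl]
  refine ⟨h.toFun (Globe.atom n β), h.dimLE hdim, ?_⟩
  apply OmegaFunctor.ext
  funext c
  change h.toFun ((ADC.Cell.map (Simplex.collapse n)).toFun c) =
    (Globe.eval _).toFun ((ADC.Cell.map (Simplex.collapse n)).toFun c)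
  obtain ⟨p, hp, α, hc⟩ := Simplex.exists_atom_collapse c
  rw [hc, Globe.eval_atom, ← h.map_d, Globe.d_atom]
  split_ifs with hnp
  -- In the top dimension the sign of the atom must be that of the image of the top element: the
  -- chains of degree `n` of `Δ^n` are the multiples of the top face, so the two components are
  -- proportional.
  · obtain rfl : p = n := le_antisymm hp hnp
    have h1 : ((ADC.Cell.map (Simplex.collapse p)).toFun c).x p true = Pi.single α (1 : ℤ) := by
      rw [hc, Globe.atom_x]
      simp [Globe.atomX]
      rfl
    have h2 : ((ADC.Cell.map (Simplex.collapse p)).toFun (Simplex.top p)).x p true =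
        Pi.single β (1 : ℤ) := by
      rw [hβ, Globe.atom_x]
      simp [Globe.atomX]
      rfl
    have h3 : ∃ z : ℤ, c.x p true = z • Simplex.topChain p p true := by
      let b : Face p p →₀ ℤ := c.x p true
      refine ⟨b ⟨Finset.univ, by simp⟩, ?_⟩
      change b = _
      rw [Simplex.topChain_self, Simplex.e_of_card (by simp)]
      ext σ
      obtain ⟨σ, hσ⟩ := σ
      obtain rfl := (Finset.card_eq_iff_eq_univ σ).1 (by simpa using hσ)
      simp
    obtain ⟨z, hz⟩ := h3
    have h4 : (Pi.single α 1 : Bool → ℤ) = z • Pi.single β 1 := by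
      rw [← h1, ← h2]
      change Simplex.collapseApp p p (c.x p true) = z • Simplex.collapseApp p p _
      rw [hz, map_smul]
      rfl
    have h5 : α = β := by
      by_contra hne
      have := congrFun h4 α
      rw [Pi.single_eq_same, Pi.smul_apply, Pi.single_eq_of_ne hne, smul_zero] at this
      exact one_ne_zero this
    rw [h5]
  · rfl

end

/-! ### Links give equal classes in the reduced complex. -/

namespace CR
variable {C : Type u} [OmegaCategory C] [NonContracting C] {n : ℕ}

theorem ofSimplex_eq_zero {x : Nerve (SemiPath C) (n + 1)} (h : DimLE n (Nerve.ev x)) :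
    CR.ofSimplex x = 0 :=
  (QuotientAddGroup.eq_zero_iff _).2
    (AddSubgroup.mem_sup_left (AddSubgroup.subset_closure ⟨x, h, rfl⟩))

theorem mk_bdSimplex {x : Nerve (SemiPath C) (n + 1)} :
    (QuotientAddGroup.mk (bdSimplex C (n + 1) x) : CRGroup C (n + 1)) =
      ∑ i : Fin (n + 2), (-1 : ℤ) ^ (i : ℕ) • CR.ofSimplex (Nerve.face i x) := by
  change QuotientAddGroup.mk' (reducedRel C (n + 1)) (bdSimplex C (n + 1) x) = _
  rw [bdSimplex, map_sum]
  simp only [map_zsmul]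
  rfl

/-- The boundary of a thin simplex vanishes in the reduced complex. -/
theorem sum_face_eq_zero {y : Nerve (SemiPath C) (n + 1)} (h : DimLE n (Nerve.ev y)) :
    ∑ i : Fin (n + 2), (-1 : ℤ) ^ (i : ℕ) • CR.ofSimplex (Nerve.face i y) = 0 := by
  rw [← mk_bdSimplex, ← bd_ofSimplex]
  exact (QuotientAddGroup.eq_zero_iff _).2 (AddSubgroup.mem_sup_right
    (AddSubgroup.mem_map_of_mem _ (AddSubgroup.subset_closure ⟨y, h, rfl⟩)))

/-- Consecutive faces occur with opposite signs, so the surviving part of an alternating sum is a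
difference. -/
theorem sum_consecutive {A : Type*} [AddCommGroup A] (f : Fin (n + 2) → A) (i : Fin (n + 1))
    (h : ∀ j, j ≠ i.castSucc → j ≠ i.succ → f j = 0) :
    ∑ j : Fin (n + 2), (-1 : ℤ) ^ (j : ℕ) • f j =
      (-1 : ℤ) ^ (i : ℕ) • (f i.castSucc - f i.succ) := by
  rw [Fintype.sum_eq_add i.castSucc i.succ (Fin.castSucc_lt_succ).ne
    fun j hj => by rw [h j hj.1 hj.2, smul_zero]]
  rw [Fin.val_castSucc, Fin.val_succ, pow_succ, smul_sub, mul_neg_one, neg_smul, sub_eq_add_neg]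

theorem neg_one_pow_smul_eq_zero {A : Type*} [AddCommGroup A] {k : ℕ} {a : A}
    (h : (-1 : ℤ) ^ k • a = 0) : a = 0 := by
  rcases neg_one_pow_eq_or ℤ k with h1 | h1
  · rwa [h1, one_smul] at h
  · rwa [h1, neg_smul, one_smul, neg_eq_zero] at h

/-- Two simplices that are consecutive faces of a thin simplex whose other faces are zero have the
same class. -/
theorem ofSimplex_face_eq {y : Nerve (SemiPath C) (n + 1)} (h : DimLE n (Nerve.ev y))
    (i : Fin (n + 1))
    (h0 : ∀ j, j ≠ i.castSucc → j ≠ i.succ → CR.ofSimplex (Nerve.face j y) = 0) :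
    CR.ofSimplex (Nerve.face i.castSucc y) = CR.ofSimplex (Nerve.face i.succ y) := by
  have h1 := sum_face_eq_zero h
  rw [sum_consecutive (fun j => CR.ofSimplex (Nerve.face j y)) i h0] at h1
  exact sub_eq_zero.1 (neg_one_pow_smul_eq_zero h1)

theorem ofSimplex_eq_of_linked {K : ADC} {f g : ADC.Hom (Simplex.adc n) K}
    (h : Simplex.Linked f g) (x : OmegaFunctor K.Cell (SemiPath C)) :
    CR.ofSimplex ((ADC.Cell.map f).trans x) = CR.ofSimplex ((ADC.Cell.map g).trans x) := by
  obtain ⟨y, i, hy, rfl, rfl, hj⟩ := h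
  refine ofSimplex_face_eq (y := (ADC.Cell.map y).trans x) (x.dimLE (Simplex.dimLE_of_homThin hy)) i
    fun j h1 h2 => ?_
  -- There are no thin generators among the `0`-simplices, but a `1`-simplex has no faces besides
  -- the two linked ones.
  cases n with
  | zero =>
    have hi := i.isLt
    have hj := j.isLt
    have h1' : (j : ℕ) ≠ i := fun h => h1 (Fin.ext h)
    have h2' : (j : ℕ) ≠ i + 1 := fun h => h2 (Fin.ext h)
    omega
  | succ n =>
    exact ofSimplex_eq_zero (x := (ADC.Cell.map (Simplex.homFace j y)).trans x)
      (x.dimLE (Simplex.dimLE_of_homThin (hj j h1 h2)))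

/-- Every simplex has the class of some `□(u)`. -/
theorem exists_ofSimplex_eq_box (x : Nerve (SemiPath C) n) :
    ∃ u : SemiPath C, DimLE n u ∧ CR.ofSimplex x = CR.ofSimplex (box n u) := by
  obtain ⟨g, hg⟩ := Simplex.exists_eqvGen_linked_collapse n
  obtain ⟨u, hu, hxu⟩ := exists_box_of_collapse (n := n) ((ADC.Cell.map g).trans x)
  refine ⟨u, hu, ?_⟩
  rw [← hxu]
  -- The class is regarded as a function of the endomorphism of `Δ^n`, so that it can be carried
  -- along the chain of links.
  change (fun f => CR.ofSimplex ((ADC.Cell.map f).trans x)) (ADC.Hom.id _) =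
    (fun f => CR.ofSimplex ((ADC.Cell.map f).trans x)) ((Simplex.collapse n).trans g)
  generalize ADC.Hom.id _ = a, (Simplex.collapse n).trans g = b at hg ⊢
  induction hg with
  | rel _ _ h => exact ofSimplex_eq_of_linked h x
  | refl => rfl
  | symm _ _ _ ih => exact ih.symm
  | trans _ _ _ _ _ ih1 ih2 => exact ih1.trans ih2

end CR
end Globular

/-! ### Gluing two globes along an `r`-dimensional cell. -/

namespace Globular

open OmegaCategory

section
variable {A : Type u} [OmegaCategory A] {n : ℕ} {x y : A}

theorem comp_eq_right (h : Composable n x y) (hx : DimLE n x) : comp n x y = y := by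
  conv_lhs => rw [← hx true, show d n true x = d n false y from h]
  exact src_comp n y

theorem comp_eq_left (h : Composable n x y) (hy : DimLE n y) : comp n x y = x := by
  conv_lhs => rw [← hy false, ← show d n true x = d n false y from h]
  exact comp_tgt n x

theorem d_comp_of_lt {m : ℕ} (hm : m < n) (α : Bool) (h : Composable n x y) :
    d m α (comp n x y) = d m α x := by
  rw [← d_d_of_lt α false _ hm, d_src _ _ _ h, d_d_of_lt _ _ _ hm]

end

namespace Globe

theorem dimLE_atom {p q : ℕ} {α : Bool} : DimLE q (atom p α) ↔ p ≤ q := by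
  refine ⟨fun h => ?_, fun h γ => by rw [d_atom, if_pos h]⟩
  by_contra hp
  have h1 := h true
  have h2 := h false
  rw [d_atom, if_neg hp] at h1 h2
  exact absurd (atom_inj (h1.trans h2.symm)).2 (by simp)

/-- Of two composable elements of the globe, one is an identity. -/
theorem dimLE_or_dimLE {n : ℕ} {X Y : adc.Cell} (h : Composable n X Y) :
    DimLE n X ∨ DimLE n Y := by
  obtain ⟨p, α, rfl⟩ := exists_atom X
  obtain ⟨q, β, rfl⟩ := exists_atom Y
  rw [dimLE_atom, dimLE_atom]
  by_contra! hc
  have h : d n true (atom p α) = d n false (atom q β) := h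
  rw [d_atom, d_atom, if_neg hc.1.not_ge, if_neg hc.2.not_ge] at h
  exact absurd (atom_inj h).2 (by simp)

theorem d_eq_atom {n : ℕ} {X : adc.Cell} (h : ¬ DimLE n X) (γ : Bool) : d n γ X = atom n γ := by
  obtain ⟨p, α, rfl⟩ := exists_atom X
  rw [dimLE_atom] at h
  rw [d_atom, if_neg h]

/-- `X` and `Y` are composed of one element of dimension at least `r` in each of two consecutive
globes. -/
def SeqRel (r : ℕ) (X Y : adc.Cell) : Prop :=
  d r true X = atom r true ∧ d r false Y = atom r false

/-- `X` and `Y` are the images under the two collapses of an element of the pushout of two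
globes along the `r`-target of the first one and the `r`-source of the second one. -/
def PairRel (r : ℕ) (X Y : adc.Cell) : Prop :=
  (X = Y ∧ DimLE r X) ∨ SeqRel r X Y

variable {r : ℕ} {X Y X' Y' : adc.Cell}

theorem not_seqRel_self (h : DimLE r X) : ¬ SeqRel r X X := fun h' => by
  have h1 := h'.1
  have h2 := h'.2
  rw [h] at h1 h2
  exact absurd (atom_inj (h1.symm.trans h2)).2 (by simp)

theorem d_of_lt_of_seqRel (h : SeqRel r X Y) {n : ℕ} (hn : n < r) (γ : Bool) :
    d n γ X = atom n γ ∧ d n γ Y = atom n γ := by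
  constructor
  · rw [← d_d_of_lt γ true X hn, h.1, d_atom, if_neg hn.not_ge]
  · rw [← d_d_of_lt γ false Y hn, h.2, d_atom, if_neg hn.not_ge]

theorem not_dimLE_of_seqRel (h : SeqRel r X Y) {n : ℕ} (hn : n < r) :
    ¬ DimLE n X ∧ ¬ DimLE n Y := by
  have key : ∀ {Z : adc.Cell}, (∀ γ, d n γ Z = atom n γ) → ¬ DimLE n Z := fun h1 h2 =>
    absurd (atom_inj ((h1 true).symm.trans ((h2 true).trans ((h2 false).symm.trans (h1 false))))).2
      (by simp)
  exact ⟨key fun γ => (d_of_lt_of_seqRel h hn γ).1, key fun γ => (d_of_lt_of_seqRel h hn γ).2⟩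

theorem seqRel_d_of_gt (h : SeqRel r X Y) {n : ℕ} (hn : r < n) (γ : Bool) :
    SeqRel r (d n γ X) (d n γ Y) :=
  ⟨(d_d_of_lt _ _ _ hn).trans h.1, (d_d_of_lt _ _ _ hn).trans h.2⟩

variable {D : Type u} [OmegaCategory D] {u v : D}

open Classical in
/-- The value on the pair `(X, Y)` of the ω-functor that sends the two globes to `u` and `v`. -/
noncomputable def glue (r : ℕ) (u v : D) (X Y : adc.Cell) : D :=
  if SeqRel r X Y then comp r ((eval u).toFun X) ((eval v).toFun Y)
  else (eval (comp r u v)).toFun X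

theorem glue_of_seqRel (h : SeqRel r X Y) :
    glue r u v X Y = comp r ((eval u).toFun X) ((eval v).toFun Y) := if_pos h

theorem glue_self (h : DimLE r X) : glue r u v X X = (eval (comp r u v)).toFun X :=
  if_neg (not_seqRel_self h)

theorem d_eval (n : ℕ) (γ : Bool) (X : adc.Cell) :
    d n γ ((eval u).toFun X) = (eval u).toFun (d n γ X) := ((eval u).map_d n γ X).symm

theorem composable_eval (huv : Composable r u v) (h : SeqRel r X Y) :
    Composable r ((eval u).toFun X) ((eval v).toFun Y) := by
  change d r true _ = d r false _
  rw [d_eval, d_eval, h.1, h.2, eval_atom, eval_atom]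
  exact huv

/-- Above degree `r` the pair stays in the two globes, and below it drops to the common boundary.
Degree `r` is the delicate one, where the source or target of a sequential pair can be of either
type. -/
theorem glue_d (huv : Composable r u v) (h : PairRel r X Y) (n : ℕ) (γ : Bool) :
    glue r u v (d n γ X) (d n γ Y) = d n γ (glue r u v X Y) := by
  rcases h with ⟨rfl, h⟩ | h
  · rw [glue_self (h.d n γ), glue_self h, d_eval]
  · have hc := composable_eval huv h
    rw [glue_of_seqRel h]
    rcases lt_trichotomy r n with hn | rfl | hn
    · rw [glue_of_seqRel (seqRel_d_of_gt h hn γ), d_comp _ _ _ hn.ne' hc, d_eval, d_eval]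
    -- The `r`-source of the composite is that of its first factor. If `X` has dimension at most
    -- `r`, the pair of `r`-sources is still sequential, with an identity as second factor.
    -- Otherwise both members become `e_r^-`, a diagonal pair whose value is `s_r(u *_r v) = s_r u`.
    -- The target is symmetric.
    · cases γ
      · rw [d_src _ _ _ hc]
        by_cases hX : DimLE r X
        · have hs : SeqRel r (d r false X) (d r false Y) :=
            ⟨by rw [hX, ← h.1], (d_d_of_le _ _ _ le_rfl).trans h.2⟩
          rw [glue_of_seqRel hs, comp_eq_left (composable_eval huv hs)
            ((eval v).dimLE (dimLE_d _ _ _)), d_eval]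
        · rw [h.2, d_eq_atom hX, glue_self (dimLE_atom.2 le_rfl), eval_atom, d_src _ _ _ huv,
            d_eval, d_eq_atom hX, eval_atom]
      · rw [d_tgt _ _ _ hc]
        by_cases hY : DimLE r Y
        · have hs : SeqRel r (d r true X) (d r true Y) :=
            ⟨(d_d_of_le _ _ _ le_rfl).trans h.1, by rw [hY, ← h.2]⟩
          rw [glue_of_seqRel hs, comp_eq_right (composable_eval huv hs)
            ((eval u).dimLE (dimLE_d _ _ _)), d_eval]
        · rw [h.1, d_eq_atom hY, glue_self (dimLE_atom.2 le_rfl), eval_atom, d_tgt _ _ _ huv,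
            d_eval, d_eq_atom hY, eval_atom]
    · obtain ⟨h1, h2⟩ := d_of_lt_of_seqRel h hn γ
      rw [h1, h2, glue_self (dimLE_atom.2 hn.le), eval_atom, d_comp_of_lt hn _ huv,
        d_comp_of_lt hn _ hc, d_eval, h1, eval_atom]

theorem glue_dimLE (huv : Composable r u v) (h : PairRel r X Y) {n : ℕ} (hX : DimLE n X)
    (hY : DimLE n Y) : DimLE n (glue r u v X Y) := fun γ => by
  rw [← glue_d huv h, hX, hY]

theorem composable_glue (huv : Composable r u v) (h : PairRel r X Y) (h' : PairRel r X' Y') {n : ℕ}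
    (hX : Composable n X X') (hY : Composable n Y Y') :
    Composable n (glue r u v X Y) (glue r u v X' Y') := by
  change d n true _ = d n false _
  rw [← glue_d huv h, ← glue_d huv h', show d n true X = _ from hX, show d n true Y = _ from hY]

/-- Gluing is compatible with composition. -/
theorem glue_comp (huv : Composable r u v) (h : PairRel r X Y) (h' : PairRel r X' Y') {n : ℕ}
    (hX : Composable n X X') (hY : Composable n Y Y') :
    glue r u v (comp n X X') (comp n Y Y') = comp n (glue r u v X Y) (glue r u v X' Y') := by
  have hg := composable_glue huv h h' hX hY
  have key : DimLE n X → DimLE n Y →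
      glue r u v (comp n X X') (comp n Y Y') = comp n (glue r u v X Y) (glue r u v X' Y') :=
    fun h1 h2 => by
      rw [comp_eq_right hX h1, comp_eq_right hY h2, comp_eq_right hg (glue_dimLE huv h h1 h2)]
  have key' : DimLE n X' → DimLE n Y' →
      glue r u v (comp n X X') (comp n Y Y') = comp n (glue r u v X Y) (glue r u v X' Y') :=
    fun h1 h2 => by
      rw [comp_eq_left hX h1, comp_eq_left hY h2, comp_eq_left hg (glue_dimLE huv h' h1 h2)]
  by_cases hXY : DimLE n X ∧ DimLE n Y
  · exact key hXY.1 hXY.2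
  by_cases hXY' : DimLE n X' ∧ DimLE n Y'
  · exact key' hXY'.1 hXY'.2
  -- A diagonal pair is excluded here: if `X = Y` is not an identity for `*_n`, then `X'` and `Y'`
  -- both are, because two non-identities of the globe do not compose.
  have hs : SeqRel r X Y := by
    rcases h with ⟨rfl, h1⟩ | h
    · exfalso
      have h2 : ¬ DimLE n X := fun h => hXY ⟨h, h⟩
      have h3 := (dimLE_or_dimLE hX).resolve_left h2
      have h4 := (dimLE_or_dimLE hY).resolve_left h2
      exact hXY' ⟨h3, h4⟩
    · exact h
  have hs' : SeqRel r X' Y' := by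
    rcases h' with ⟨rfl, h1⟩ | h
    · exfalso
      have h2 : ¬ DimLE n X' := fun h => hXY' ⟨h, h⟩
      have h3 := (dimLE_or_dimLE hX).resolve_right h2
      have h4 := (dimLE_or_dimLE hY).resolve_right h2
      exact hXY ⟨h3, h4⟩
    · exact h
  have hc := composable_eval huv hs
  have hc' := composable_eval huv hs'
  rcases lt_trichotomy r n with hn | rfl | hn
  · have hs2 : SeqRel r (comp n X X') (comp n Y Y') :=
      ⟨(d_comp_of_lt hn _ hX).trans hs.1, (d_comp_of_lt hn _ hY).trans hs.2⟩
    rw [glue_of_seqRel hs, glue_of_seqRel hs', glue_of_seqRel hs2, (eval u).map_comp _ _ _ hX,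
      (eval v).map_comp _ _ _ hY]
    exact interchange _ _ _ _ hn.ne ((eval u).composable hX) ((eval v).composable hY) hc hc'
  -- For `n = r`, the element `X` cannot be an identity: then `X'` would not be one, and the
  -- `r`-target `e_r^+` of `X` would be the `r`-source `e_r^-` of `X'`. So `X'` and `Y` are
  -- identities and both sides are the composite of the values of `X` and `Y'`.
  · rcases dimLE_or_dimLE hX with h1 | h1
    · exfalso
      have h2 : ¬ DimLE r Y := fun h2 => hXY ⟨h1, h2⟩
      have h3 := (dimLE_or_dimLE hY).resolve_left h2
      have h4 : ¬ DimLE r X' := fun h4 => hXY' ⟨h4, h3⟩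
      have h5 : d r true X = d r false X' := hX
      rw [hs.1, d_eq_atom h4] at h5
      exact absurd (atom_inj h5).2 (by simp)
    · have h2 : ¬ DimLE r Y' := fun h2 => hXY' ⟨h1, h2⟩
      have h3 := (dimLE_or_dimLE hY).resolve_right h2
      have hs2 : SeqRel r X Y' := ⟨hs.1, hs'.2⟩
      rw [glue_of_seqRel hs, glue_of_seqRel hs', comp_eq_left hX h1, comp_eq_right hY h3,
        glue_of_seqRel hs2, comp_eq_left hc ((eval v).dimLE h3),
        comp_eq_right hc' ((eval u).dimLE h1)]
  -- For `n < r` the first components are both of dimension at least `r`, so they are not identities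
  -- for `*_n` and cannot be composed.
  · exfalso
    obtain ⟨h1, h2⟩ := not_dimLE_of_seqRel hs hn
    obtain ⟨h3, h4⟩ := not_dimLE_of_seqRel hs' hn
    exact (dimLE_or_dimLE hX).elim h1 h3

/-- Two ω-functors to the globe with related values give an ω-functor to `D`. -/
noncomputable def glueFunctor {A : Type v} [OmegaCategory A] (huv : Composable r u v)
    (F G : OmegaFunctor A adc.Cell) (h : ∀ c, PairRel r (F.toFun c) (G.toFun c)) :
    OmegaFunctor A D where
  toFun c := glue r u v (F.toFun c) (G.toFun c)
  map_d n γ c := by rw [F.map_d, G.map_d, glue_d huv (h c)]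
  map_comp n c c' hc := by
    rw [F.map_comp _ _ _ hc, G.map_comp _ _ _ hc,
      glue_comp huv (h c) (h c') (F.composable hc) (G.composable hc)]

/-- If the second element has dimension at most `r` and is not the `r`-target, it does not
contribute. -/
theorem glue_eq_left (huv : Composable r u v) (h : PairRel r X Y) (hY : DimLE r Y)
    (hne : Y ≠ atom r true) : glue r u v X Y = (eval u).toFun X := by
  rcases h with ⟨rfl, -⟩ | h
  · rw [glue_self hY]
    obtain ⟨p, α, rfl⟩ := exists_atom X
    rw [eval_atom, eval_atom]
    rcases (dimLE_atom.1 hY).lt_or_eq with hp | rfl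
    · exact d_comp_of_lt hp α huv
    · cases α
      · exact d_src _ _ _ huv
      · exact absurd rfl hne
  · rw [glue_of_seqRel h, comp_eq_left (composable_eval huv h) ((eval v).dimLE hY)]

/-- If the first element has dimension at most `r` and is not the `r`-source, it does not
contribute. -/
theorem glue_eq_right (huv : Composable r u v) (h : PairRel r X Y) (hX : DimLE r X)
    (hne : X ≠ atom r false) : glue r u v X Y = (eval v).toFun Y := by
  rcases h with ⟨rfl, -⟩ | h
  · rw [glue_self hX]
    obtain ⟨p, α, rfl⟩ := exists_atom X
    rw [eval_atom, eval_atom]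
    rcases (dimLE_atom.1 hX).lt_or_eq with hp | rfl
    · rw [← d_d_of_lt α true (comp r u v) hp, d_tgt _ _ _ huv, d_d_of_lt _ _ _ hp]
    · cases α
      · exact absurd rfl hne
      · exact d_tgt _ _ _ huv
  · rw [glue_of_seqRel h, comp_eq_right (composable_eval huv h) ((eval u).dimLE hX)]

/-- The coefficients of an element of the globe. -/
def coef (X : adc.Cell) (p : ℕ) (α γ : Bool) : ℤ := (show Bool → ℤ from X.x p α) γ

theorem coef_atom (p : ℕ) (α : Bool) (q : ℕ) (β γ : Bool) : coef (atom p α) q β γ =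
    if q < p then (if γ = β then 1 else 0) else if q = p then (if γ = α then 1 else 0) else 0 := by
  change atomX p α q β γ = _
  unfold atomX
  split_ifs with h1 h2 h3 h4
  all_goals first | subst h2; simp | subst h4; simp | simp [*]

end Globe
end Globular

/-! ### Recognising related pairs by their coefficients. -/

namespace Globular

open OmegaCategory

namespace Globe
variable {r : ℕ} {X Y : adc.Cell}

theorem seqRel_atom {p q : ℕ} {α β : Bool} : SeqRel r (atom p α) (atom q β) ↔
    (r < p ∨ p = r ∧ α = true) ∧ (r < q ∨ q = r ∧ β = false) := by
  have key : ∀ (p : ℕ) (α γ : Bool), d r γ (atom p α) = atom r γ ↔ r < p ∨ p = r ∧ α = γ := by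
    intro p α γ
    rw [d_atom]
    split_ifs with h
    · exact ⟨fun h' => Or.inr (atom_inj h'), fun h' => by
        obtain ⟨rfl, rfl⟩ := h'.resolve_left h.not_gt
        rfl⟩
    · exact ⟨fun _ => Or.inl (not_le.1 h), fun _ => rfl⟩
  exact and_congr (key p α true) (key q β false)

theorem coef_atom_of_le {p : ℕ} (hp : r ≤ p) (α β γ : Bool) :
    coef (atom p α) r β γ = if γ = (if r < p then β else α) then 1 else 0 := by
  rw [coef_atom]
  rcases hp.lt_or_eq with h | rfl
  · rw [if_pos h, if_pos h]
  · rw [if_neg (lt_irrefl _), if_neg (lt_irrefl _), if_pos rfl]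

/-- In degree `p` the two components of `e_p^α` are equal, whereas those of an atom of larger
dimension differ. Equal coefficients therefore force equal dimensions, and then equal signs. -/
theorem eq_of_coef {p q : ℕ} {α β : Bool} (hpq : p ≤ q)
    (h : ∀ γ δ, coef (atom p α) p γ δ = coef (atom q β) p γ δ) : atom p α = atom q β := by
  simp only [coef_atom_of_le le_rfl, coef_atom_of_le hpq, lt_irrefl, if_false] at h
  rcases hpq.lt_or_eq with h1 | rfl
  · have := h (!α) α
    simp [h1] at this
  · have := h α α
    simp only [lt_irrefl, if_false, if_true] at this
    split_ifs at this with h4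
    · rw [h4]
    · simp at this

/-- If one of the two has dimension below `r`, the degree of the smaller dimension already separates
distinct atoms. -/
theorem eq_or_le_of_coef (h1 : ∀ p < r, ∀ α γ, coef X p α γ = coef Y p α γ) :
    (X = Y ∧ DimLE r X) ∨ ∃ p q α β, r ≤ p ∧ r ≤ q ∧ X = atom p α ∧ Y = atom q β := by
  obtain ⟨p, α, rfl⟩ := exists_atom X
  obtain ⟨q, β, rfl⟩ := exists_atom Y
  by_cases hp : r ≤ p ∧ r ≤ q
  · exact Or.inr ⟨p, q, α, β, hp.1, hp.2, rfl, rfl⟩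
  refine Or.inl ?_
  rcases le_total p q with h | h
  · exact ⟨eq_of_coef h (h1 p (by omega)), dimLE_atom.2 (by omega)⟩
  · have := eq_of_coef h fun γ δ => (h1 q (by omega) γ δ).symm
    exact ⟨this.symm, this ▸ dimLE_atom.2 (by omega)⟩

/-- Only atoms of dimension at least `r` remain to be compared. In degree `r` the component of a
larger atom follows the side `α`, while that of `e_r^±` is constant. For `b` equal to `true`, the
inequality on the coefficients of `e_r^+` says that distinct atoms are arranged with `e_r^+` on the
left or `e_r^-` on the right, the condition `SeqRel`; for `false` the order is reversed. -/
theorem pairRel_of_coef (h1 : ∀ p < r, ∀ α γ, coef X p α γ = coef Y p α γ) (b : Bool)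
    (h2 : ∀ α, coef Y r α b ≤ coef X r α b) : if b then PairRel r X Y else PairRel r Y X := by
  rcases eq_or_le_of_coef h1 with ⟨rfl, hX⟩ | ⟨p, q, α, β, hp, hq, rfl, rfl⟩
  · rw [ite_self]
    exact Or.inl ⟨rfl, hX⟩
  simp only [coef_atom_of_le hp, coef_atom_of_le hq] at h2
  have h3 := h2 true
  have h4 := h2 false
  simp only [PairRel, seqRel_atom]
  by_cases hpq : p = r ∧ q = r ∧ α = β
  · obtain ⟨rfl, rfl, rfl⟩ := hpq
    rw [ite_self]
    exact Or.inl ⟨rfl, dimLE_atom.2 le_rfl⟩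
  rcases hp.eq_or_lt with h5 | h5 <;> rcases hq.eq_or_lt with h6 | h6 <;>
    cases b <;> cases α <;> cases β <;> simp_all

variable {D : Type u} [OmegaCategory D] {u v : D}

/-- The glued element agrees with the composite if the components of the pair agree in degrees at
most `r`. -/
theorem glue_eq_eval (h : PairRel r X Y)
    (hXY : ∀ p ≤ r, ∀ α γ, coef X p α γ = coef Y p α γ) (huv : Composable r u v) :
    (DimLE (r + 1) v → glue r u v X Y = (eval (comp r u v)).toFun X) ∧
    (DimLE (r + 1) u → glue r u v X Y = (eval (comp r u v)).toFun Y) := by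
  rcases h with ⟨rfl, hX⟩ | h
  · exact ⟨fun _ => glue_self hX, fun _ => glue_self hX⟩
  obtain ⟨p, α, rfl⟩ := exists_atom X
  obtain ⟨q, β, rfl⟩ := exists_atom Y
  rw [glue_of_seqRel h]
  simp only [eval_atom]
  rw [seqRel_atom] at h
  have h1 := hXY r le_rfl true true
  have h2 := hXY r le_rfl false false
  rw [coef_atom_of_le (by omega), coef_atom_of_le (by omega)] at h1 h2
  -- The alternatives `X = e_r^+` and `Y = e_r^-` are excluded because the components in degree `r`
  -- agree on both sides: a constant component is neither that of a larger atom nor that of the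
  -- opposite sign.
  have hpq : r < p ∧ r < q := by
    rcases h with ⟨h3 | ⟨rfl, rfl⟩, h4 | ⟨rfl, rfl⟩⟩ <;> simp_all
  -- Both dimensions exceed `r`, so a factor of dimension at most `r + 1` is fixed by both
  -- operators, and the index used on it may be changed.
  exact ⟨fun hv => by rw [d_comp _ _ _ hpq.1.ne' huv, hv.mono hpq.2, hv.mono hpq.1],
    fun hu => by rw [d_comp _ _ _ hpq.2.ne' huv, hu.mono hpq.1, hu.mono hpq.2]⟩

/-- `X` and `Y` are related, in the order prescribed by `b`. -/
def PairRelOf (b : Bool) (r : ℕ) (X Y : adc.Cell) : Prop :=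
  if b then PairRel r X Y else PairRel r Y X

end Globe

open Globe

/-! ### Gluing in an order prescribed by a Boolean, to treat both parities at once. -/

section
variable {D : Type u} [OmegaCategory D] {n r : ℕ}

/-- `u` and `w` are `r`-composable, in the order prescribed by `b`. -/
def ComposableOf (b : Bool) (r : ℕ) (u w : D) : Prop :=
  if b then Composable r u w else Composable r w u

/-- The composite of `u` and `w` in the order prescribed by `b`. -/
def compOf (b : Bool) (r : ℕ) (u w : D) : D := if b then comp r u w else comp r w u

/-- The glued element for the order prescribed by `b`. -/
noncomputable def glueOf (b : Bool) (r : ℕ) (u w : D) (X Y : adc.Cell) : D :=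
  if b then glue r u w X Y else glue r w u Y X

variable {b : Bool} {u w : D} {X Y : adc.Cell}

theorem glueOf_dimLE (huw : ComposableOf b r u w) (h : PairRelOf b r X Y) (hX : DimLE n X)
    (hY : DimLE n Y) : DimLE n (glueOf b r u w X Y) := by
  cases b with
  | true => exact glue_dimLE huw h hX hY
  | false => exact glue_dimLE huw h hY hX

theorem glueOf_eq_left (huw : ComposableOf b r u w) (h : PairRelOf b r X Y) (hY : DimLE r Y)
    (hne : Y ≠ atom r b) : glueOf b r u w X Y = (eval u).toFun X := by
  cases b with
  | true => exact glue_eq_left huw h hY hne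
  | false => exact glue_eq_right huw h hY hne

theorem glueOf_eq_right (huw : ComposableOf b r u w) (h : PairRelOf b r X Y) (hX : DimLE r X)
    (hne : X ≠ atom r (!b)) : glueOf b r u w X Y = (eval w).toFun Y := by
  cases b with
  | true => exact glue_eq_right huw h hX hne
  | false => exact glue_eq_left huw h hX hne

theorem glueOf_eq_eval (huw : ComposableOf b r u w) (h : PairRelOf b r X Y)
    (hXY : ∀ p ≤ r, ∀ α γ, coef X p α γ = coef Y p α γ) (hw : DimLE (r + 1) w) :
    glueOf b r u w X Y = (eval (compOf b r u w)).toFun X := by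
  cases b with
  | true => exact (glue_eq_eval h hXY huw).1 hw
  | false => exact (glue_eq_eval h (fun p hp α γ => (hXY p hp α γ).symm) huw).2 hw

theorem exists_glueOf {A : Type v} [OmegaCategory A] {F G : OmegaFunctor A adc.Cell}
    (huw : ComposableOf b r u w) (h : ∀ c, PairRelOf b r (F.toFun c) (G.toFun c)) :
    ∃ H : OmegaFunctor A D, ∀ c, H.toFun c = glueOf b r u w (F.toFun c) (G.toFun c) := by
  cases b with
  | true => exact ⟨glueFunctor huw F G h, fun _ => rfl⟩
  | false => exact ⟨glueFunctor huw G F h, fun _ => rfl⟩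

end
end Globular

/-! ### Collapses along maps of vertices. -/

namespace Globular

open OmegaCategory

namespace Simplex
variable {N n m r p : ℕ}

/-- A map of vertices that fixes the vertices below `r` and no others below `r`. -/
def FixesBelow (r : ℕ) (a : Fin (N + 1) →o Fin (n + 1)) : Prop :=
  (∀ v : Fin (N + 1), (v : ℕ) < r → (a v : ℕ) = v) ∧ ∀ v : Fin (N + 1), r ≤ (v : ℕ) → r ≤ (a v : ℕ)

theorem FixesBelow.eq_iff {a : Fin (N + 1) →o Fin (n + 1)} (ha : FixesBelow r a)
    (hp : p < r) (v : Fin (N + 1)) : (a v : ℕ) = p ↔ (v : ℕ) = p := by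
  rcases Nat.lt_or_ge v r with h | h
  · rw [ha.1 v h]
  · have := ha.2 v h
    omega

/-- The collapse to the globe along a map of vertices. -/
noncomputable def collapseAlong (a : Fin (N + 1) →o Fin (n + 1)) : ADC.Hom (adc N) Globe.adc :=
  (pushHom a).trans (collapse n)

theorem coef_collapseAlong (a : Fin (N + 1) →o Fin (n + 1)) (c : Oriental N) (p : ℕ)
    (α γ : Bool) : Globe.coef ((ADC.Cell.map (collapseAlong a)).toFun c) p α γ =
      collapseApp n p (push a p (c.x p α)) γ := rfl

-- Two vertices with the same image must both be `≥ r`. A face with `p + 1` vertices containing two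
-- of these cannot also contain all `p` vertices below `p`, so in the degenerate case the condition
-- on the right fails, as required. Otherwise the label can be read before applying `a`.
open Classical in
theorem collapseApp_push_e {a : Fin (N + 1) →o Fin (n + 1)} (ha : FixesBelow r a) (hr : r ≤ N)
    (hp : p ≤ r) {τ : Finset (Fin (N + 1))} (hτ : τ.card = p + 1) :
    collapseApp n p (push a p (e p τ)) = if ∀ i : Fin (N + 1), (i : ℕ) < p → i ∈ τ then
      Pi.single (if ∃ i ∈ τ, (a i : ℕ) = p then decide (Odd (p + 1)) else decide (Odd p)) 1
    else 0 := by
  have hfix : ∀ {x y : Fin (N + 1)}, a x = a y → x ≠ y → r ≤ (x : ℕ) := by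
    intro x y hxy hne
    by_contra hx
    have h1 := ha.1 x (not_le.1 hx)
    exact hne (Fin.ext (((ha.eq_iff (not_le.1 hx) y).1 (by rw [← hxy, h1])).symm))
  by_cases hinj : Set.InjOn a τ
  · have hcard : (τ.image a).card = p + 1 := (Finset.card_image_of_injOn hinj).trans hτ
    rw [push_e a hτ, collapseApp_e hcard, label]
    refine if_congr ?_ ?_ rfl
    · constructor
      · intro h i hi
        have h1 := ha.1 i (hi.trans_le hp)
        obtain ⟨j, hj, hji⟩ := Finset.mem_image.1 (h (a i) (by omega))
        by_contra hne
        have := hfix hji.symm (fun h => hne (h ▸ hj))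
        omega
      · intro h i hi
        refine Finset.mem_image.2 ⟨⟨i, by omega⟩, h _ hi, Fin.ext ?_⟩
        exact ha.1 _ (hi.trans_le hp)
    · simp only [Finset.mem_image, exists_exists_and_eq_and]
  · have h1 : ∃ x ∈ τ, ∃ y ∈ τ, a x = a y ∧ x ≠ y := by
      unfold Set.InjOn at hinj
      push Not at hinj
      obtain ⟨x, hx, y, hy, h⟩ := hinj
      exact ⟨x, hx, y, hy, h⟩
    obtain ⟨x, hx, y, hy, hxy, hne⟩ := h1
    rw [push_e_eq_zero a hx hy hne hxy, map_zero, if_neg]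
    intro h
    have hx' := hfix hxy hne
    have hy' := hfix hxy.symm hne.symm
    have h2 : insert x (insert y (Finset.univ.filter fun i : Fin (N + 1) => (i : ℕ) < p)) ⊆ τ := by
      intro i hi
      simp only [Finset.mem_insert, Finset.mem_filter, Finset.mem_univ, true_and] at hi
      rcases hi with rfl | rfl | hi
      · exact hx
      · exact hy
      · exact h i hi
    have h3 := Finset.card_le_card h2
    rw [Finset.card_insert_of_notMem, Finset.card_insert_of_notMem, card_below (by omega)] at h3
    · omega
    · simp only [Finset.mem_filter, Finset.mem_univ, true_and]; omega
    · simp only [Finset.mem_insert, Finset.mem_filter, Finset.mem_univ, true_and, not_or]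
      exact ⟨hne, by omega⟩

/-- By `collapseApp_push_e`, in degree `p ≤ r` a map enters only through the set of vertices sent to
`p`. -/
theorem coef_collapseAlong_eq {a : Fin (N + 1) →o Fin (n + 1)} {a' : Fin (N + 1) →o Fin (m + 1)}
    (ha : FixesBelow r a) (ha' : FixesBelow r a') (hr : r ≤ N) (hp : p ≤ r)
    (h : ∀ v, (a v : ℕ) = p ↔ (a' v : ℕ) = p) (c : Oriental N) (α γ : Bool) :
    Globe.coef ((ADC.Cell.map (collapseAlong a)).toFun c) p α γ =
      Globe.coef ((ADC.Cell.map (collapseAlong a')).toFun c) p α γ := by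
  rw [coef_collapseAlong, coef_collapseAlong]
  refine congrFun (LinearMap.congr_fun (f := (collapseApp n p).comp (push a p))
    (g := (collapseApp m p).comp (push a' p)) (linearMap_ext_e fun τ hτ => ?_) _) γ
  rw [LinearMap.comp_apply, LinearMap.comp_apply, collapseApp_push_e ha hr hp hτ,
    collapseApp_push_e ha' hr hp hτ]
  simp only [h]

theorem decide_odd_ne (r : ℕ) : decide (Odd (r + 1)) = !decide (Odd r) := by
  rw [← decide_not]
  exact decide_eq_decide.2 Nat.odd_add_one

/-- In degree `r` a face has the sign of the parity of `r + 1` if some vertex is sent to `r`, and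
that of `r` otherwise. So if every vertex sent to `r` by one map is sent to `r` by the other, their
coefficients for a fixed sign are comparable, and `b` is chosen to make the inequality of
`pairRel_of_coef` point the right way. -/
theorem pairRelOf_collapseAlong {a : Fin (N + 1) →o Fin (n + 1)}
    {a' : Fin (N + 1) →o Fin (m + 1)} {b : Bool}
    (ha : FixesBelow r a) (ha' : FixesBelow r a') (hr : r ≤ N)
    (hb : (b = decide (Odd (r + 1)) ∧ ∀ v, (a' v : ℕ) = r → (a v : ℕ) = r) ∨
      (b = decide (Odd r) ∧ ∀ v, (a v : ℕ) = r → (a' v : ℕ) = r)) (c : Oriental N) :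
    Globe.PairRelOf b r ((ADC.Cell.map (collapseAlong a)).toFun c)
      ((ADC.Cell.map (collapseAlong a')).toFun c) := by
  refine Globe.pairRel_of_coef (fun p hp α γ => coef_collapseAlong_eq ha ha' hr hp.le
    (fun v => (ha.eq_iff hp v).trans (ha'.eq_iff hp v).symm) c α γ) b fun α => ?_
  rw [coef_collapseAlong, coef_collapseAlong, ← sub_nonneg]
  let f : (Face N r →₀ ℤ) →ₗ[ℤ] (Bool → ℤ) :=
    (collapseApp n r).comp (push a r) - (collapseApp m r).comp (push a' r)
  let g : (Face N r →₀ ℤ) →+ ℤ := (Pi.evalAddMonoidHom (fun _ : Bool => ℤ) b).comp f.toAddMonoidHom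
  change g (c.x r α) ∈ AddSubmonoid.nonneg ℤ
  refine pos_of_e (fun τ hτ => ?_) (c.pos r α)
  change 0 ≤ collapseApp n r (push a r (e r τ)) b - collapseApp m r (push a' r (e r τ)) b
  rw [collapseApp_push_e ha hr le_rfl hτ, collapseApp_push_e ha' hr le_rfl hτ]
  by_cases h1 : ∀ i : Fin (N + 1), (i : ℕ) < r → i ∈ τ
  · rw [if_pos h1, if_pos h1, sub_nonneg, Pi.single_apply, Pi.single_apply]
    rcases hb with ⟨rfl, hb⟩ | ⟨rfl, hb⟩
    · by_cases h2 : ∃ i ∈ τ, (a' i : ℕ) = r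
      · obtain ⟨i, hi, h3⟩ := h2
        rw [if_pos (⟨i, hi, hb i h3⟩ : ∃ i ∈ τ, (a i : ℕ) = r), decide_odd_ne, if_pos rfl]
        split_ifs <;> simp
      · rw [if_neg h2, decide_odd_ne, if_neg (by simp : ¬ (!decide (Odd r)) = decide (Odd r))]
        split_ifs <;> simp
    · by_cases h2 : ∃ i ∈ τ, (a i : ℕ) = r
      · obtain ⟨i, hi, h3⟩ := h2
        rw [if_pos (⟨i, hi, hb i h3⟩ : ∃ i ∈ τ, (a' i : ℕ) = r), decide_odd_ne,
          if_neg (by simp : ¬ decide (Odd r) = !decide (Odd r))]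
        split_ifs <;> simp
      · rw [if_neg h2, if_pos rfl]
        split_ifs <;> simp
  · rw [if_neg h1, if_neg h1]
    exact (sub_self _).ge

theorem dimLE_collapseAlong_target (a : Fin (N + 1) →o Fin (n + 1)) (c : Oriental N) :
    DimLE n ((ADC.Cell.map (collapseAlong a)).toFun c) := by
  refine ADC.Cell.dimLE fun p hp α => ?_
  change collapseApp n p (push a p (c.x p α)) = 0
  rw [chain_eq_zero hp (push a p (c.x p α)), map_zero]

theorem dimLE_collapseAlong_top {a : Fin (N + 2) →o Fin (n + 1)} {v w : Fin (N + 2)}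
    (hvw : v ≠ w) (h : a v = a w) :
    DimLE N ((ADC.Cell.map (collapseAlong a)).toFun (top (N + 1))) := by
  refine dimLE_of_homThin ?_
  change collapseApp n (N + 1) (push a (N + 1) (e (N + 1) Finset.univ)) = 0
  rw [push_e_eq_zero a (Finset.mem_univ v) (Finset.mem_univ w) hvw h, map_zero]

theorem exists_mem_of_card_lt {τ : Finset (Fin (N + 1))} (h : r ≤ N) (hτ : r < τ.card) :
    ∃ i ∈ τ, r ≤ (i : ℕ) := by
  by_contra! h1
  have h2 : τ ⊆ Finset.univ.filter fun i : Fin (N + 1) => (i : ℕ) < r := fun i hi => by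
    simpa using h1 i hi
  have := Finset.card_le_card h2
  rw [card_below (by omega)] at this
  omega

/-- A face of dimension larger than `r` has two vertices `≥ r`, and these are identified. -/
theorem dimLE_collapseAlong {a : Fin (N + 1) →o Fin (n + 1)} (hr : r ≤ N)
    (h : ∀ v w : Fin (N + 1), r ≤ (v : ℕ) → r ≤ (w : ℕ) → a v = a w) (c : Oriental N) :
    DimLE r ((ADC.Cell.map (collapseAlong a)).toFun c) := by
  refine ADC.Cell.dimLE fun p hp α => ?_
  change collapseApp n p (push a p (c.x p α)) = 0
  rw [show push a p (c.x p α) = 0 from LinearMap.congr_fun (f := push a p) (g := 0)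
    (linearMap_ext_e fun τ hτ => ?_) _, map_zero]
  obtain ⟨i, hi, hri⟩ := exists_mem_of_card_lt hr (show r < τ.card by omega)
  obtain ⟨j, hj, hrj⟩ := exists_mem_of_card_lt hr (show r < (τ.erase i).card by
    rw [Finset.card_erase_of_mem hi]; omega)
  rw [Finset.mem_erase] at hj
  rw [push_e_eq_zero a hi hj.2 hj.1.symm (h i j hri hrj), LinearMap.zero_apply]

/-- Under either hypothesis no face gets the label of sign `b` in degree `r`, so the corresponding
coefficient is `0`, whereas for `e_r^b` it is `1`. -/
theorem collapseAlong_ne_atom {a : Fin (N + 1) →o Fin (n + 1)} {b : Bool} (ha : FixesBelow r a)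
    (hr : r ≤ N) (hb : (b = decide (Odd r) ∧ ∀ v : Fin (N + 1), r ≤ (v : ℕ) → (a v : ℕ) = r) ∨
      (b = decide (Odd (r + 1)) ∧ ∀ v, (a v : ℕ) ≠ r)) (c : Oriental N) :
    (ADC.Cell.map (collapseAlong a)).toFun c ≠ Globe.atom r b := by
  intro hc
  have h1 : Globe.coef ((ADC.Cell.map (collapseAlong a)).toFun c) r true b = 1 := by
    rw [hc, Globe.coef_atom, if_neg (lt_irrefl r), if_pos rfl, if_pos rfl]
  rw [coef_collapseAlong] at h1
  let f : (Face N r →₀ ℤ) →ₗ[ℤ] (Bool → ℤ) := (collapseApp n r).comp (push a r)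
  let g : (Face N r →₀ ℤ) →ₗ[ℤ] ℤ := (LinearMap.proj (R := ℤ) (φ := fun _ : Bool => ℤ) b).comp f
  have hg : g = 0 := by
    refine linearMap_ext_e fun τ hτ => ?_
    change collapseApp n r (push a r (e r τ)) b = 0
    rw [collapseApp_push_e ha hr le_rfl hτ]
    split_ifs with h2 h3
    · rcases hb with ⟨rfl, -⟩ | ⟨-, hb⟩
      · rw [Pi.single_apply, if_neg]
        rw [decide_odd_ne]
        simp
      · obtain ⟨i, -, h4⟩ := h3
        exact absurd h4 (hb i)
    · rcases hb with ⟨-, hb⟩ | ⟨rfl, -⟩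
      · obtain ⟨i, hi, hri⟩ := exists_mem_of_card_lt hr (show r < τ.card by omega)
        exact absurd ⟨i, hi, hb i hri⟩ h3
      · rw [Pi.single_apply, if_neg]
        rw [decide_odd_ne]
        simp
    · rfl
  have h2 : g (c.x r true) = 1 := h1
  rw [hg] at h2
  exact zero_ne_one h2

end Simplex
end Globular

/-! ### The simplices between `□(u)` and `□` of a composite. -/

namespace Globular

open OmegaCategory

namespace Simplex
variable {N n m r : ℕ}

theorem predAbove_val (i : Fin (n + 1)) (v : Fin (n + 2)) :
    (i.predAboveOrderHom v : ℕ) = if (i : ℕ) < v then (v : ℕ) - 1 else v := by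
  change (i.predAbove v : ℕ) = _
  unfold Fin.predAbove
  simp only [Fin.lt_def, Fin.val_castSucc]
  split_ifs <;> rfl

theorem succAbove_val (i : Fin (n + 2)) (v : Fin (n + 1)) :
    ((Fin.succAboveOrderEmb i).toOrderHom v : ℕ) = if (v : ℕ) < i then (v : ℕ) else v + 1 := by
  change (i.succAbove v : ℕ) = _
  unfold Fin.succAbove
  simp only [Fin.lt_def, Fin.val_castSucc]
  split_ifs <;> rfl

/-- The map of vertices that is the identity below `r`, takes the value `r` on `[r, j)`, and takes
the value `r + 1` from `j` on. -/
def stepHom (r j N : ℕ) : Fin (N + 1) →o Fin (r + 2) where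
  toFun v := ⟨if (v : ℕ) < r then v else if (v : ℕ) < j then r else r + 1, by split_ifs <;> omega⟩
  monotone' v w h := by
    have h : (v : ℕ) ≤ w := h
    change (if (v : ℕ) < r then (v : ℕ) else if (v : ℕ) < j then r else r + 1) ≤
      if (w : ℕ) < r then (w : ℕ) else if (w : ℕ) < j then r else r + 1
    split_ifs <;> omega

theorem stepHom_val (r j N : ℕ) (v : Fin (N + 1)) : (stepHom r j N v : ℕ) =
    if (v : ℕ) < r then (v : ℕ) else if (v : ℕ) < j then r else r + 1 := rfl

theorem fixesBelow_id : FixesBelow r (OrderHom.id : Fin (n + 1) →o Fin (n + 1)) :=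
  ⟨fun _ _ => rfl, fun _ h => h⟩

theorem fixesBelow_stepHom (r j N : ℕ) : FixesBelow r (stepHom r j N) := by
  refine ⟨fun v h => ?_, fun v h => ?_⟩ <;> rw [stepHom_val] <;> split_ifs <;> omega

theorem fixesBelow_predAbove {i : Fin (n + 1)} (h : r ≤ i) :
    FixesBelow r i.predAboveOrderHom := by
  refine ⟨fun v h => ?_, fun v h => ?_⟩ <;> rw [predAbove_val] <;> split_ifs <;> omega

theorem stepHom_comp_castSucc {i : Fin (n + 1)} (h : r ≤ i) :
    (stepHom r (i + 1) (n + 1)).comp (Fin.succAboveOrderEmb i.castSucc).toOrderHom =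
      stepHom r i n := by
  refine OrderHom.ext _ _ (funext fun v => Fin.ext ?_)
  change (stepHom r (i + 1) (n + 1) ((Fin.succAboveOrderEmb i.castSucc).toOrderHom v) : ℕ) = _
  rw [stepHom_val, stepHom_val, succAbove_val, Fin.val_castSucc]
  split_ifs <;> omega

theorem stepHom_comp_succ {i : Fin (n + 1)} (h : r ≤ i) :
    (stepHom r (i + 1) (n + 1)).comp (Fin.succAboveOrderEmb i.succ).toOrderHom =
      stepHom r (i + 1) n := by
  refine OrderHom.ext _ _ (funext fun v => Fin.ext ?_)
  change (stepHom r (i + 1) (n + 1) ((Fin.succAboveOrderEmb i.succ).toOrderHom v) : ℕ) = _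
  rw [stepHom_val, stepHom_val, succAbove_val, Fin.val_succ]
  split_ifs <;> omega

theorem stepHom_comp_last (r : ℕ) :
    (stepHom r (r + 1) (r + 2)).comp (Fin.succAboveOrderEmb (Fin.last (r + 2))).toOrderHom =
      OrderHom.id := by
  refine OrderHom.ext _ _ (funext fun v => Fin.ext ?_)
  change (stepHom r (r + 1) (r + 2) ((Fin.succAboveOrderEmb (Fin.last (r + 2))).toOrderHom v) : ℕ) =
    v
  rw [stepHom_val, succAbove_val, Fin.val_last]
  split_ifs <;> omega

theorem collapseAlong_id (c : Oriental n) :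
    (ADC.Cell.map (collapseAlong OrderHom.id)).toFun c = (ADC.Cell.map (collapse n)).toFun c := by
  refine ADC.Cell.ext' fun p α => ?_
  change collapseApp n p (push OrderHom.id p (c.x p α)) = collapseApp n p (c.x p α)
  rw [show push OrderHom.id p (c.x p α) = c.x p α from LinearMap.congr_fun (push_id p) _]

theorem collapseAlong_comp (a : Fin (m + 1) →o Fin (n + 1)) (f : Fin (N + 1) →o Fin (m + 1))
    (c : Oriental N) : (ADC.Cell.map (collapseAlong a)).toFun ((Simplex.map f).toFun c) =
      (ADC.Cell.map (collapseAlong (a.comp f))).toFun c := by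
  refine ADC.Cell.ext' fun p α => ?_
  change collapseApp n p (push a p (push f p (c.x p α))) =
    collapseApp n p (push (a.comp f) p (c.x p α))
  rw [push_comp]
  rfl

end Simplex

open Simplex

section
variable {D : Type u} [OmegaCategory D] {n r : ℕ} {b : Bool} {u w : D}

/-- The values of the simplex obtained from `□(u)` and the `(r + 1)`-simplex `□(w)` pulled back
along a map of vertices. -/
noncomputable def pairValue (b : Bool) (r : ℕ) (u w : D) {N : ℕ} (a : Fin (N + 1) →o Fin (n + 1))
    (a' : Fin (N + 1) →o Fin (r + 2)) (c : Oriental N) : D :=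
  glueOf b r u w ((ADC.Cell.map (collapseAlong a)).toFun c)
    ((ADC.Cell.map (collapseAlong a')).toFun c)

theorem pairValue_map {m N : ℕ} (a : Fin (m + 1) →o Fin (n + 1)) (a' : Fin (m + 1) →o Fin (r + 2))
    (f : Fin (N + 1) →o Fin (m + 1)) (c : Oriental N) :
    pairValue b r u w a a' ((Simplex.map f).toFun c) =
      pairValue b r u w (a.comp f) (a'.comp f) c := by
  unfold pairValue
  rw [collapseAlong_comp, collapseAlong_comp]

theorem box_toFun (c : Oriental n) : (box n u).toFun c =
    (Globe.eval u).toFun ((ADC.Cell.map (collapseAlong OrderHom.id)).toFun c) := by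
  rw [collapseAlong_id]
  rfl

theorem pairRelOf_id_stepHom {j : ℕ} (hr : r ≤ n)
    (hb : b = decide (Odd (r + 1)) ∧ j ≤ r + 1 ∨ b = decide (Odd r) ∧ r < j) (c : Oriental n) :
    Globe.PairRelOf b r ((ADC.Cell.map (collapseAlong OrderHom.id)).toFun c)
      ((ADC.Cell.map (collapseAlong (stepHom r j n))).toFun c) := by
  refine pairRelOf_collapseAlong fixesBelow_id (fixesBelow_stepHom _ _ _) hr ?_ c
  refine hb.imp (fun h => ⟨h.1, fun v => ?_⟩) fun h => ⟨h.1, fun v => ?_⟩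
  · rw [stepHom_val]
    change _ → (v : ℕ) = r
    split_ifs <;> omega
  · rw [stepHom_val]
    change (v : ℕ) = r → _
    split_ifs <;> omega

/-- For `j = r` no vertex is sent to `r`. The second member of the pair has dimension at most `r`
and is never `e_r^b`, so `w` does not contribute. -/
theorem pairValue_stepHom_self (huw : ComposableOf b r u w) (hr : r ≤ n)
    (hb : b = decide (Odd (r + 1))) (c : Oriental n) :
    pairValue b r u w OrderHom.id (stepHom r r n) c = (box n u).toFun c := by
  rw [box_toFun]
  refine glueOf_eq_left huw (pairRelOf_id_stepHom hr (Or.inl ⟨hb, by omega⟩) c)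
    (dimLE_collapseAlong hr (fun v v' h h' => Fin.ext ?_) c)
    (collapseAlong_ne_atom (fixesBelow_stepHom _ _ _) hr (Or.inr ⟨hb, fun v => ?_⟩) c)
  · rw [stepHom_val, stepHom_val]; split_ifs <;> omega
  · rw [stepHom_val]; split_ifs <;> omega

/-- For `j = n + 1` all vertices `≥ r` are sent to `r`. Again the second member is at most
`r`-dimensional and is never `e_r^b`, this time for the other parity. -/
theorem pairValue_stepHom_last (huw : ComposableOf b r u w) (hr : r ≤ n)
    (hb : b = decide (Odd r)) (c : Oriental n) :
    pairValue b r u w OrderHom.id (stepHom r (n + 1) n) c = (box n u).toFun c := by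
  rw [box_toFun]
  refine glueOf_eq_left huw (pairRelOf_id_stepHom hr (Or.inr ⟨hb, by omega⟩) c)
    (dimLE_collapseAlong hr (fun v v' h h' => Fin.ext ?_) c)
    (collapseAlong_ne_atom (fixesBelow_stepHom _ _ _) hr (Or.inl ⟨hb, fun v hv => ?_⟩) c)
  · rw [stepHom_val, stepHom_val]; split_ifs <;> omega
  · rw [stepHom_val]; split_ifs <;> omega

/-- For `j = r + 1` both maps send exactly the vertex `p` to `p`, for every `p ≤ r`. The two members
then agree up to degree `r`, and the glued simplex is the one of the composite. -/
theorem pairValue_stepHom_succ (huw : ComposableOf b r u w) (hr : r ≤ n) (hw : DimLE (r + 1) w)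
    (c : Oriental n) :
    pairValue b r u w OrderHom.id (stepHom r (r + 1) n) c = (box n (compOf b r u w)).toFun c := by
  rw [box_toFun]
  refine glueOf_eq_eval huw (pairRelOf_id_stepHom hr ?_ c) (fun p hp α γ => ?_) hw
  · rw [decide_odd_ne]
    cases b <;> cases decide (Odd r) <;> simp
  · refine coef_collapseAlong_eq fixesBelow_id (fixesBelow_stepHom _ _ _) hr hp (fun v => ?_) c α γ
    rw [stepHom_val]
    change (v : ℕ) = p ↔ _
    split_ifs <;> omega

/-- With `i = r` the degeneracy sends `r` and `r + 1` to `r` but the step map only `r`; with `i > r`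
the degeneracy sends only `r` there and the step map all of `[r, i]`. The parity of `b` follows this
inclusion. -/
theorem pairRelOf_predAbove_stepHom {i : Fin (n + 1)} (hi : r ≤ i)
    (hb : b = decide (Odd (r + 1)) ∧ (i : ℕ) = r ∨ b = decide (Odd r) ∧ r < i)
    (c : Oriental (n + 1)) : Globe.PairRelOf b r
      ((ADC.Cell.map (collapseAlong i.predAboveOrderHom)).toFun c)
      ((ADC.Cell.map (collapseAlong (stepHom r (i + 1) (n + 1)))).toFun c) := by
  refine pairRelOf_collapseAlong (fixesBelow_predAbove hi) (fixesBelow_stepHom _ _ _)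
    (by omega) ?_ c
  refine hb.imp (fun h => ⟨h.1, fun v => ?_⟩) fun h => ⟨h.1, fun v => ?_⟩
  · rw [stepHom_val, predAbove_val]
    split_ifs <;> omega
  · rw [stepHom_val, predAbove_val]
    split_ifs <;> omega

/-- The simplices that relate the simplices of a whiskered element. -/
theorem exists_pairSimplex (huw : ComposableOf b r u w) (i : Fin (n + 1)) (hi : r ≤ i)
    (hb : b = decide (Odd (r + 1)) ∧ (i : ℕ) = r ∨ b = decide (Odd r) ∧ r < i) :
    ∃ y : Nerve D (n + 1),
      (∀ c, y.toFun c = pairValue b r u w i.predAboveOrderHom (stepHom r (i + 1) (n + 1)) c) ∧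
      (∀ {N : ℕ} (f : Fin (N + 1) →o Fin (n + 2)) (m : ℕ) (c : Oriental N),
        DimLE m ((ADC.Cell.map (collapseAlong (i.predAboveOrderHom.comp f))).toFun c) →
        DimLE m ((ADC.Cell.map (collapseAlong ((stepHom r (i + 1) (n + 1)).comp f))).toFun c) →
        DimLE m ((Nerve.pull f y).toFun c)) := by
  have h := pairRelOf_predAbove_stepHom hi hb
  obtain ⟨y, hy⟩ := exists_glueOf huw h
  refine ⟨y, hy, fun f m c h1 h2 => ?_⟩
  change DimLE m (y.toFun ((Simplex.map f).toFun c))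
  rw [hy]
  rw [← collapseAlong_comp] at h1 h2
  exact glueOf_dimLE huw (h _) h1 h2

end
end Globular

/-! ### Whiskering and additivity in the reduced complex. -/

namespace Globular

open OmegaCategory Simplex

/-- Any face other than the two in question still contains both `i` and `i + 1`, which the
degeneracy identifies. -/
theorem Simplex.predAbove_comp_apply_eq {n : ℕ} {i : Fin (n + 1)} {j : Fin (n + 2)}
    (h1 : j ≠ i.castSucc) (h2 : j ≠ i.succ) : ∃ v w : Fin (n + 1), v ≠ w ∧
      (i.predAboveOrderHom.comp (Fin.succAboveOrderEmb j).toOrderHom) v =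
        (i.predAboveOrderHom.comp (Fin.succAboveOrderEmb j).toOrderHom) w := by
  obtain ⟨v, hv⟩ := Fin.exists_succAbove_eq h1.symm
  obtain ⟨w, hw⟩ := Fin.exists_succAbove_eq h2.symm
  refine ⟨v, w, fun h => ?_, ?_⟩
  · rw [h, hw] at hv
    exact (Fin.castSucc_lt_succ (i := i)).ne' hv
  · change i.predAboveOrderHom (j.succAbove v) = i.predAboveOrderHom (j.succAbove w)
    rw [hv, hw, predAboveOrderHom_castSucc_eq_succ]

section
variable {D : Type u} [OmegaCategory D] {n r : ℕ} {b : Bool} {u w : D}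

theorem pairSimplex_face_castSucc {i : Fin (n + 1)} (hi : r ≤ i) {y : Nerve D (n + 1)}
    (hy : ∀ c, y.toFun c = pairValue b r u w i.predAboveOrderHom (stepHom r (i + 1) (n + 1)) c)
    (c : Oriental n) : (Nerve.face i.castSucc y).toFun c =
      pairValue b r u w OrderHom.id (stepHom r i n) c := by
  change y.toFun ((Simplex.map _).toFun c) = _
  rw [hy, pairValue_map, predAbove_comp_castSucc, stepHom_comp_castSucc hi]

theorem pairSimplex_face_succ {i : Fin (n + 1)} (hi : r ≤ i) {y : Nerve D (n + 1)}
    (hy : ∀ c, y.toFun c = pairValue b r u w i.predAboveOrderHom (stepHom r (i + 1) (n + 1)) c)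
    (c : Oriental n) : (Nerve.face i.succ y).toFun c =
      pairValue b r u w OrderHom.id (stepHom r (i + 1) n) c := by
  change y.toFun ((Simplex.map _).toFun c) = _
  rw [hy, pairValue_map, predAbove_comp_succ, stepHom_comp_succ hi]

/-- The simplices in question are thin. -/
theorem dimLE_ev_pairSimplex (hrn : r < n) {i : Fin (n + 1)} {y : Nerve D (n + 1)}
    (hd : ∀ {N : ℕ} (f : Fin (N + 1) →o Fin (n + 2)) (m : ℕ) (c : Oriental N),
        DimLE m ((ADC.Cell.map (collapseAlong (i.predAboveOrderHom.comp f))).toFun c) →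
        DimLE m ((ADC.Cell.map (collapseAlong ((stepHom r (i + 1) (n + 1)).comp f))).toFun c) →
        DimLE m ((Nerve.pull f y).toFun c)) : DimLE n (Nerve.ev y) := by
  -- The first member is degenerate, and the second lives on `Δ^{r+1}`, so its dimension is at most
  -- `r + 1 ≤ n`.
  have h := hd OrderHom.id n (Simplex.top (n + 1))
    (dimLE_collapseAlong_top (Fin.castSucc_lt_succ (i := i)).ne
      (predAboveOrderHom_castSucc_eq_succ i))
    ((dimLE_collapseAlong_target _ _).mono hrn)
  rwa [Nerve.pull_id] at h

end

namespace CR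
variable {C : Type u} [OmegaCategory C] [NonContracting C] {n r : ℕ} {b : Bool} {u w : SemiPath C}

/-- The two simplices are the consecutive faces `i` and `i + 1` of one thin simplex. The hypothesis
`r + 2 ≤ n` makes the other faces thin: on them the first member is degenerate, and the second has
dimension at most `r + 1 ≤ n - 1`. -/
theorem ofSimplex_pair_eq (huw : ComposableOf b r u w) (hrn : r + 2 ≤ n) (i : Fin (n + 1))
    (hi : r ≤ i) (hb : b = decide (Odd (r + 1)) ∧ (i : ℕ) = r ∨ b = decide (Odd r) ∧ r < i)
    {x x' : Nerve (SemiPath C) n}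
    (hx : ∀ c, x.toFun c = pairValue b r u w OrderHom.id (stepHom r i n) c)
    (hx' : ∀ c, x'.toFun c = pairValue b r u w OrderHom.id (stepHom r (i + 1) n) c) :
    CR.ofSimplex x = CR.ofSimplex x' := by
  obtain ⟨y, hy, hd⟩ := exists_pairSimplex huw i hi hb
  have h1 : x = Nerve.face i.castSucc y := OmegaFunctor.ext (funext fun c =>
    (hx c).trans (pairSimplex_face_castSucc hi hy c).symm)
  have h2 : x' = Nerve.face i.succ y := OmegaFunctor.ext (funext fun c =>
    (hx' c).trans (pairSimplex_face_succ hi hy c).symm)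
  rw [h1, h2]
  refine ofSimplex_face_eq (dimLE_ev_pairSimplex (by omega) hd) i fun j hj1 hj2 => ?_
  obtain ⟨n, rfl⟩ := Nat.exists_eq_add_of_le' (show 1 ≤ n by omega)
  obtain ⟨v, v', hvv', hv⟩ := predAbove_comp_apply_eq hj1 hj2
  exact ofSimplex_eq_zero (hd _ _ _ (dimLE_collapseAlong_top hvv' hv)
    ((dimLE_collapseAlong_target _ _).mono (by omega)))

/-- For this parity a single move, from `j = r` to `j = r + 1`, leads from `□(u)` to the composite.
-/
theorem ofSimplex_box_compOf_of_odd_succ (huw : ComposableOf b r u w) (hrn : r + 2 ≤ n)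
    (hw : DimLE (r + 1) w) (hb : b = decide (Odd (r + 1))) :
    CR.ofSimplex (box n (compOf b r u w)) = CR.ofSimplex (box n u) :=
  (ofSimplex_pair_eq huw hrn ⟨r, by omega⟩ le_rfl (Or.inl ⟨hb, rfl⟩)
    (fun c => (pairValue_stepHom_self huw (by omega) hb c).symm)
    (fun c => (pairValue_stepHom_succ huw (by omega) hw c).symm)).symm

/-- For this parity the interpolation starts at the composite, `j = r + 1`, and reaches `□(u)` only
at `j = n + 1`; each unit step is a link. -/
theorem ofSimplex_box_compOf_of_odd (huw : ComposableOf b r u w) (hrn : r + 2 ≤ n)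
    (hw : DimLE (r + 1) w) (hb : b = decide (Odd r)) :
    CR.ofSimplex (box n (compOf b r u w)) = CR.ofSimplex (box n u) := by
  have hX : ∀ j, r < j → ∃ x : Nerve (SemiPath C) n, ∀ c, x.toFun c =
      pairValue b r u w OrderHom.id (stepHom r j n) c := fun j hj =>
    exists_glueOf huw (pairRelOf_id_stepHom (by omega) (Or.inr ⟨hb, hj⟩))
  have key : ∀ k, r + 1 + k ≤ n + 1 → ∀ x : Nerve (SemiPath C) n,
      (∀ c, x.toFun c = pairValue b r u w OrderHom.id (stepHom r (r + 1 + k) n) c) →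
      CR.ofSimplex (box n (compOf b r u w)) = CR.ofSimplex x := by
    intro k
    induction k with
    | zero =>
      intro _ x hx
      congr 1
      exact OmegaFunctor.ext (funext fun c =>
        (pairValue_stepHom_succ huw (by omega) hw c).symm.trans (hx c).symm)
    | succ k ih =>
      intro hk x hx
      obtain ⟨x', hx'⟩ := hX (r + 1 + k) (by omega)
      rw [ih (by omega) x' hx']
      exact ofSimplex_pair_eq huw hrn ⟨r + 1 + k, by omega⟩ (by change r ≤ r + 1 + k; omega)
        (Or.inr ⟨hb, by change r < r + 1 + k; omega⟩) hx' hx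
  refine key (n - r) (by omega) _ fun c => ?_
  rw [show r + 1 + (n - r) = n + 1 by omega]
  exact (pairValue_stepHom_last huw (by omega) hb c).symm

/-- Whiskering by an element of dimension at most `r + 1` does not change the class. -/
theorem ofSimplex_box_compOf (huw : ComposableOf b r u w) (hrn : r + 2 ≤ n)
    (hw : DimLE (r + 1) w) :
    CR.ofSimplex (box n (compOf b r u w)) = CR.ofSimplex (box n u) := by
  by_cases h : b = decide (Odd r)
  · exact ofSimplex_box_compOf_of_odd huw hrn hw h
  · refine ofSimplex_box_compOf_of_odd_succ huw hrn hw ?_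
    rw [decide_odd_ne]
    cases b <;> simp_all

/-- For `n = r + 1` the simplex with `i = r` has one relevant face beyond `r` and `r + 1`. On the
last face, numbered `r + 2`, the degeneracy sends all vertices `≥ r` to `r`, so `u` does not
contribute and the face is `□(w)`. The vanishing boundary gives the sum. -/
theorem ofSimplex_box_compOf_add (huw : ComposableOf b r u w) (hw : DimLE (r + 1) w)
    (hb : b = decide (Odd (r + 1))) :
    CR.ofSimplex (box (r + 1) (compOf b r u w)) =
      CR.ofSimplex (box (r + 1) u) + CR.ofSimplex (box (r + 1) w) := by
  let i : Fin (r + 2) := ⟨r, by omega⟩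
  obtain ⟨y, hy, hd⟩ := exists_pairSimplex huw i le_rfl (Or.inl ⟨hb, rfl⟩)
  have h1 : Nerve.face i.castSucc y = box (r + 1) u := OmegaFunctor.ext (funext fun c =>
    (pairSimplex_face_castSucc le_rfl hy c).trans (pairValue_stepHom_self huw (by omega) hb c))
  have h2 : Nerve.face i.succ y = box (r + 1) (compOf b r u w) :=
    OmegaFunctor.ext (funext fun c =>
      (pairSimplex_face_succ le_rfl hy c).trans (pairValue_stepHom_succ huw (by omega) hw c))
  have h3 : Nerve.face (Fin.last (r + 2)) y = box (r + 1) w := by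
    refine OmegaFunctor.ext (funext fun c => ?_)
    have hval : ∀ v : Fin (r + 2), r ≤ (v : ℕ) → ((i.predAboveOrderHom.comp
        (Fin.succAboveOrderEmb (Fin.last (r + 2))).toOrderHom) v : ℕ) = r := fun v hv => by
      change (i.predAboveOrderHom ((Fin.succAboveOrderEmb (Fin.last (r + 2))).toOrderHom v) : ℕ) = r
      rw [predAbove_val, succAbove_val, Fin.val_last]
      change (if r < _ then _ else _) = r
      split_ifs <;> omega
    have hfix : FixesBelow r (i.predAboveOrderHom.comp
        (Fin.succAboveOrderEmb (Fin.last (r + 2))).toOrderHom) := by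
      refine ⟨fun v hv => ?_, fun v hv => (hval v hv).ge⟩
      change (i.predAboveOrderHom ((Fin.succAboveOrderEmb (Fin.last (r + 2))).toOrderHom v) : ℕ) = v
      rw [predAbove_val, succAbove_val, Fin.val_last]
      change (if r < _ then _ else _) = (v : ℕ)
      split_ifs <;> omega
    rw [box_toFun, ← stepHom_comp_last, ← collapseAlong_comp]
    change y.toFun ((Simplex.map _).toFun c) = _
    rw [hy]
    refine glueOf_eq_right huw (pairRelOf_predAbove_stepHom le_rfl (Or.inl ⟨hb, rfl⟩) _) ?_ ?_ <;>
      rw [collapseAlong_comp]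
    · exact dimLE_collapseAlong (by omega)
        (fun v v' h h' => Fin.ext ((hval v h).trans (hval v' h').symm)) c
    · refine collapseAlong_ne_atom hfix (by omega) (Or.inl ⟨?_, hval⟩) c
      rw [hb, decide_odd_ne, Bool.not_not]
  -- On a face below `r` both members are degenerate: the degeneracy identifies `r` and `r + 1`, and
  -- the step map identifies the last two vertices of the face.
  have h4 : ∀ j : Fin (r + 2), j ≠ (Fin.last r).castSucc → j ≠ (Fin.last r).succ →
      CR.ofSimplex (Nerve.face j.castSucc y) = 0 := by
    intro j hj1 hj2
    have hj : (j : ℕ) < r := by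
      have h5 : (j : ℕ) ≠ r := fun h => hj1 (Fin.ext h)
      have h6 : (j : ℕ) ≠ r + 1 := fun h => hj2 (Fin.ext h)
      omega
    obtain ⟨v, v', hvv', hv⟩ := predAbove_comp_apply_eq (i := i) (j := j.castSucc)
      (fun h => hj.ne (congrArg Fin.val h))
      (fun h => by have : (j : ℕ) = r + 1 := congrArg Fin.val h; omega)
    refine ofSimplex_eq_zero (hd _ _ _ (dimLE_collapseAlong_top hvv' hv) ?_)
    refine dimLE_collapseAlong_top (v := Fin.last (r + 1)) (w := (Fin.last r).castSucc)
      (Fin.castSucc_lt_last _).ne' (Fin.ext ?_)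
    change (stepHom r (r + 1) (r + 2) ((Fin.succAboveOrderEmb j.castSucc).toOrderHom _) : ℕ) =
      stepHom r (r + 1) (r + 2) ((Fin.succAboveOrderEmb j.castSucc).toOrderHom _)
    rw [stepHom_val, stepHom_val, succAbove_val, succAbove_val]
    simp only [Fin.val_castSucc, Fin.val_last]
    split_ifs <;> omega
  -- The faces `r`, `r + 1`, `r + 2` have signs `(-1)^r`, `-(-1)^r`, `(-1)^r`, so up to sign the
  -- relation reads `□(u) - □(composite) + □(w) = 0`.
  have h5 := sum_face_eq_zero (dimLE_ev_pairSimplex (Nat.lt_succ_self r) hd)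
  rw [Fin.sum_univ_castSucc] at h5
  simp only [Fin.val_castSucc] at h5
  rw [sum_consecutive (fun j : Fin (r + 2) => CR.ofSimplex (Nerve.face j.castSucc y)) (Fin.last r)
    h4, h3] at h5
  rw [show (Fin.last r).castSucc.castSucc = i.castSucc from rfl,
    show (Fin.last r).succ.castSucc = i.succ from rfl, h1, h2, Fin.val_last, Fin.val_last,
    pow_add, neg_one_sq, mul_one, ← smul_add] at h5
  have h6 := neg_one_pow_smul_eq_zero h5
  rw [sub_add_eq_add_sub, sub_eq_zero] at h6
  exact h6.symm

/-- The operators `□` are additive on composites modulo the relations of the reduced complex. -/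
theorem ofSimplex_box_comp {u v : SemiPath C} (hr : r < n) (hu : DimLE n u) (hv : DimLE n v)
    (h : Composable r u v) :
    CR.ofSimplex (box n (comp r u v)) = CR.ofSimplex (box n u) + CR.ofSimplex (box n v) := by
  obtain ⟨k, rfl⟩ := Nat.exists_eq_add_of_le (show r + 1 ≤ n from hr)
  induction k generalizing r u v with
  | zero =>
    -- In the base case both elements have dimension at most `r + 1`. For the wrong parity they
    -- exchange roles, which is harmless because addition is commutative.
    by_cases hb : true = decide (Odd (r + 1))
    · exact ofSimplex_box_compOf_add (b := true) h hv hb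
    · rw [add_comm (CR.ofSimplex _)]
      exact ofSimplex_box_compOf_add (b := false) h hu (by simpa using hb)
  | succ k ih =>
    have e : r + 1 + (k + 1) = r + 1 + 1 + k := by omega
    rw [e] at hu hv ⊢
    have h1 : Composable r u (d (r + 1) false v) := by
      change d r true u = d r false (d (r + 1) false v)
      rw [d_d_of_lt _ _ _ (Nat.lt_succ_self r)]
      exact h
    have h2 : Composable r (d (r + 1) true u) v := by
      change d r true (d (r + 1) true u) = d r false v
      rw [d_d_of_lt _ _ _ (Nat.lt_succ_self r)]
      exact h
    have h3 : Composable (r + 1) u (d (r + 1) true u) := (d_d_of_le _ _ _ le_rfl).symm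
    have h4 : Composable (r + 1) (d (r + 1) false v) v := d_d_of_le _ _ _ le_rfl
    have h5 : Composable (r + 1) (comp r u (d (r + 1) false v)) (comp r (d (r + 1) true u) v) := by
      change d (r + 1) true _ = d (r + 1) false _
      rw [d_comp _ _ _ (Nat.succ_ne_self r) h1, d_comp _ _ _ (Nat.succ_ne_self r) h2,
        d_d_of_le _ _ _ le_rfl, d_d_of_le _ _ _ le_rfl]
    -- By interchange an `r`-composite is an `(r + 1)`-composite of two whiskerings by elements of
    -- dimension at most `r + 1`.
    have h6 : comp r u v =
        comp (r + 1) (comp r u (d (r + 1) false v)) (comp r (d (r + 1) true u) v) := by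
      rw [interchange _ _ _ _ (Nat.succ_ne_self r) h1 h2 h3 h4, comp_tgt, src_comp]
    have h7 : DimLE (r + 1 + 1 + k) (comp r u (d (r + 1) false v)) :=
      hu.comp ((dimLE_d _ _ _).mono (by omega)) h1
    have h8 : DimLE (r + 1 + 1 + k) (comp r (d (r + 1) true u) v) :=
      DimLE.comp ((dimLE_d _ _ _).mono (by omega)) hv h2
    rw [h6, ih h5 (by omega) h7 h8]
    -- Each whiskering has the class of its main factor; `n ≥ r + 2` holds because this is the
    -- inductive step.
    congr 1
    · exact ofSimplex_box_compOf (b := true) h1 (by omega) (dimLE_d _ _ _)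
    · exact ofSimplex_box_compOf (b := false) (u := v) h2 (by omega) (dimLE_d _ _ _)

end CR
end Globular

/-! ### The boundary of `□(u)`. -/

namespace Globular

open OmegaCategory Simplex

section
variable {D : Type u} [OmegaCategory D] {n : ℕ} {u : D}

/-- A face of `□(u)` that omits a vertex from `n` on. -/
theorem face_box {j : Fin (n + 2)} {α : Bool} (hj : n ≤ j)
    (hα : (!α) = decide (Odd n) ∧ (j : ℕ) = n + 1 ∨ (!α) = decide (Odd (n + 1)) ∧ (j : ℕ) = n) :
    Nerve.face j (box (n + 1) u) = box n (d n α u) := by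
  let a := (Fin.succAboveOrderEmb j).toOrderHom
  have ha : FixesBelow n a := by
    refine ⟨fun v hv => ?_, fun v hv => ?_⟩ <;> rw [succAbove_val] <;> split_ifs <;> omega
  refine OmegaFunctor.ext (funext fun c => ?_)
  change (box (n + 1) u).toFun ((Simplex.map a).toFun c) = _
  rw [box_toFun, box_toFun, collapseAlong_comp]
  change (Globe.eval u).toFun ((ADC.Cell.map (collapseAlong a)).toFun c) = _
  have hX : DimLE n ((ADC.Cell.map (collapseAlong a)).toFun c) := by
    refine ADC.Cell.dimLE fun p hp α => ?_
    change collapseApp (n + 1) p (push a p (c.x p α)) = 0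
    rw [show push a p (c.x p α) = push a p 0 from congrArg _ (chain_eq_zero hp (c.x p α)),
      map_zero, map_zero]
  have hY := dimLE_collapseAlong_target OrderHom.id c
  -- Removing the last vertex sends all vertices `≥ n` to `n`; removing `n` leaves none there.
  -- Either way only one sign is possible in degree `n`.
  have hne : (ADC.Cell.map (collapseAlong a)).toFun c ≠ Globe.atom n (!α) := by
    refine collapseAlong_ne_atom ha le_rfl (hα.imp (fun h => ⟨h.1, fun v hv => ?_⟩)
      fun h => ⟨h.1, fun v => ?_⟩) c <;> rw [succAbove_val] <;> split_ifs <;> omega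
  have hcoef : ∀ p < n, ∀ β γ, Globe.coef ((ADC.Cell.map (collapseAlong a)).toFun c) p β γ =
      Globe.coef ((ADC.Cell.map (collapseAlong OrderHom.id)).toFun c) p β γ := fun p hp =>
    coef_collapseAlong_eq ha fixesBelow_id le_rfl hp.le
      (fun v => (ha.eq_iff hp v).trans (fixesBelow_id.eq_iff hp v).symm) c
  generalize (ADC.Cell.map (collapseAlong a)).toFun c = X,
    (ADC.Cell.map (collapseAlong OrderHom.id)).toFun c = Y at hX hY hne hcoef ⊢
  have hsign : ∀ {β}, X = Globe.atom n β → X = Globe.atom n α := by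
    rintro β rfl
    cases α <;> cases β <;> first | rfl | exact absurd rfl hne
  -- Below degree `n` the face and the smaller simplex have the same components. In degree `n` the
  -- sign on the face is `α`, and `d_n` of `d_n^α u` is `d_n^α u` for either sign.
  rcases Globe.eq_or_le_of_coef hcoef with ⟨rfl, -⟩ | ⟨p, q, β, γ, hp, hq, hXp, rfl⟩
  · obtain ⟨p, β, hXp⟩ := Globe.exists_atom X
    rw [hXp, Globe.dimLE_atom] at hX
    rcases hX.lt_or_eq with hp | rfl
    · rw [hXp, Globe.eval_atom, Globe.eval_atom, d_d_of_lt _ _ _ hp]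
    · rw [hsign hXp, Globe.eval_atom, Globe.eval_atom, d_d_of_le _ _ _ le_rfl]
  · rw [hXp, Globe.dimLE_atom] at hX
    rw [Globe.dimLE_atom] at hY
    obtain rfl := le_antisymm hX hp
    obtain rfl := le_antisymm hY hq
    rw [hsign hXp, Globe.eval_atom, Globe.eval_atom, d_d_of_le _ _ _ le_rfl]

/-- The other faces of `□(u)` are thin. -/
theorem dimLE_ev_face_box {j : Fin (n + 3)} (hj : (j : ℕ) < n + 1) :
    DimLE n (Nerve.ev (Nerve.face j (box (n + 2) u))) := by
  refine (Globe.eval u).dimLE (dimLE_of_homThin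
    (f := homFace j (collapse (n + 2))) (homThin_homFace_iff.2 ?_))
  change collapseApp (n + 2) (n + 1) (e (n + 1) (Finset.univ.erase j)) = 0
  rw [collapseApp_e (by rw [Finset.card_erase_of_mem (Finset.mem_univ j)]; simp), label, if_neg]
  intro h
  exact Finset.notMem_erase j _ (h j hj)

end

namespace CR
variable {C : Type u} [OmegaCategory C] [NonContracting C] {n : ℕ}

/-- Only the faces `n` and `n + 1` matter. For even `n` they are the source and the target in this
order, for odd `n` the reverse, and the sign `(-1)^n` turns both cases into source minus target. -/
theorem CRd_ofSimplex_box (u : SemiPath C) :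
    CRd C (n + 1) (CR.ofSimplex (box (n + 1) u)) =
      CR.ofSimplex (box n (d n false u)) - CR.ofSimplex (box n (d n true u)) := by
  have h : CRd C (n + 1) (CR.ofSimplex (box (n + 1) u)) =
      ∑ i : Fin (n + 2), (-1 : ℤ) ^ (i : ℕ) • CR.ofSimplex (Nerve.face i (box (n + 1) u)) := by
    rw [← mk_bdSimplex, ← bd_ofSimplex]
    rfl
  rw [h, sum_consecutive (fun i => CR.ofSimplex (Nerve.face i (box (n + 1) u))) (Fin.last n)
    fun j h1 h2 => ?_]
  · have e1 : Nerve.face (Fin.last n).castSucc (box (n + 1) u) = box n (d n (decide (Odd n)) u) :=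
      face_box le_rfl (Or.inr ⟨(decide_odd_ne n).symm, rfl⟩)
    have e2 : Nerve.face (Fin.last n).succ (box (n + 1) u) =
        box n (d n (decide (Odd (n + 1))) u) :=
      face_box (by simp) (Or.inl ⟨by rw [decide_odd_ne, Bool.not_not], by simp⟩)
    rw [e1, e2, decide_odd_ne, Fin.val_last]
    by_cases hn : Odd n
    · rw [decide_eq_true hn, hn.neg_one_pow, neg_smul, one_smul, neg_sub]
      rfl
    · rw [decide_eq_false hn, (Nat.not_odd_iff_even.1 hn).neg_one_pow, one_smul]
      rfl
  · have h3 : (j : ℕ) ≠ n := fun h => h1 (Fin.ext h)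
    have h4 : (j : ℕ) ≠ n + 1 := fun h => h2 (Fin.ext h)
    -- A `1`-simplex has no other faces; in higher dimension the other faces are thin.
    cases n with
    | zero => omega
    | succ n => exact ofSimplex_eq_zero (dimLE_ev_face_box (by omega))

theorem CRd_ofSimplex_boxMinus_zero {x : Path C} (hx : DimLE 1 x.val) :
    CRd C 0 (CR.ofSimplex (boxMinus 0 x)) = CR.ofObj (srcObj x.val) := by
  change QuotientAddGroup.mk (bd C 0 (Chains.ofSimplex (boxMinus 0 x))) = _
  rw [bd_ofSimplex, bdSimplex, ev_boxMinus hx]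
  rfl

theorem ofSimplex_boxMinus_eq_zero {x : Path C} (h : DimLE n x.val) :
    CR.ofSimplex (boxMinus n x) = 0 := by
  -- No morphism in `ℙC` has dimension `0`, so the case of degree `1`, which has no thin elements,
  -- is empty.
  cases n with
  | zero => exact absurd h x.dim
  | succ n =>
    refine ofSimplex_eq_zero ?_
    rw [ev_boxMinus (h.mono (Nat.le_succ _))]
    exact (hMinus C).dimLE fun α => Path.ext (h α)

theorem hMinus_comp_zero {x y z : Path C} (h : Composable 0 x.val y.val)
    (hz : z.val = comp 0 x.val y.val) : (hMinus C).toFun z = (hMinus C).toFun x :=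
  (hMinus_eq (.rel _ _ ⟨y, h, hz⟩)).symm

theorem ofSimplex_boxMinus_comp {r : ℕ} (h1 : 1 ≤ r) (hr : r ≤ n) {x y z : Path C}
    (hx : DimLE (n + 1) x.val) (hy : DimLE (n + 1) y.val) (h : Composable r x.val y.val)
    (hz : z.val = comp r x.val y.val) :
    CR.ofSimplex (boxMinus n z) = CR.ofSimplex (boxMinus n x) + CR.ofSimplex (boxMinus n y) := by
  -- Degrees in `ℙC` are one less than in `C`: the composition `*_{r+1}` of `C` is `*_r` there.
  obtain ⟨r, rfl⟩ := Nat.exists_eq_add_of_le' h1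
  have hxy : Composable r x y := Path.ext h
  have hz' : z = comp r x y := Path.ext (hz.trans (Path.compOp_val h).symm)
  unfold boxMinus
  rw [hz', (hMinus C).map_comp _ _ _ hxy]
  exact ofSimplex_box_comp hr ((hMinus C).dimLE fun α => Path.ext (hx α))
    ((hMinus C).dimLE fun α => Path.ext (hy α)) ((hMinus C).composable hxy)

/-! ### Generation by the elements `Φ^{gl-}(h^-(x))`. -/

variable (C n) in
/-- The subgroup generated by the classes of the `Φ^{gl-}(h^-(x))` for `x` of dimension `n + 1`. -/
noncomputable def foldedSubgroup : AddSubgroup (CRGroup C (n + 1)) :=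
  AddSubgroup.closure {c | ∃ x : Path C, HasDim (n + 1) x.val ∧ c = CR.ofSimplex (boxMinus n x)}

theorem ofSimplex_box_eq_zero {m : ℕ} {u : SemiPath C} (hm : m < n) (h : DimLE m u) :
    CR.ofSimplex (box n u) = 0 := by
  obtain ⟨n, rfl⟩ := Nat.exists_eq_add_of_le' (show 1 ≤ n by omega)
  refine ofSimplex_eq_zero ?_
  rw [ev_box (h.mono hm.le)]
  exact h.mono (by omega)

/-- Induction on the expression of `q` in terms of elements of `ℙC`. The statement concerns all
`d_n^α q` at once because `q` itself may have too large a dimension for a given `n`, and because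
sources and targets of a composite may involve only one of the factors. -/
theorem ofSimplex_box_mem (q : SemiPath C) : ∀ (n : ℕ) (α : Bool),
    CR.ofSimplex (box n (d n α q)) ∈ foldedSubgroup C n := by
  induction q using UnivQuot.induct with
  | gen x =>
    intro n α
    change CR.ofSimplex (box n (d n α ((hMinus C).toFun x))) ∈ _
    rw [← (hMinus C).map_d]
    change CR.ofSimplex (boxMinus n (d n α x)) ∈ _
    -- The generators are required to have dimension exactly `n + 1` in `C`; those of smaller
    -- dimension have class zero.
    by_cases h : DimLE n (d n α x).val
    · rw [ofSimplex_boxMinus_eq_zero h]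
      exact zero_mem _
    · exact AddSubgroup.subset_closure ⟨d n α x, ⟨dimLE_d (n + 1) α x.val, fun m hm hm' =>
        h (hm'.mono (by omega))⟩, rfl⟩
  | dstep m β q ih =>
    intro n α
    rcases lt_trichotomy n m with h | rfl | h
    · rw [d_d_of_lt _ _ _ h]
      exact ih n α
    · rw [d_d_of_le _ _ _ le_rfl]
      exact ih n β
    · rw [ofSimplex_box_eq_zero h ((dimLE_d m β q).d n α)]
      exact zero_mem _
  | cstep m p q h ihp ihq =>
    intro n α
    rcases lt_trichotomy n m with hn | rfl | hn
    · rw [d_comp_of_lt hn _ h]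
      exact ihp n α
    · cases α
      · rw [d_src _ _ _ h]
        exact ihp n false
      · rw [d_tgt _ _ _ h]
        exact ihq n true
    -- For `m < n` the operator `d_n` commutes with `*_m`, and additivity applies.
    · rw [d_comp _ _ _ hn.ne' h, ofSimplex_box_comp hn (dimLE_d _ _ _) (dimLE_d _ _ _)
        (composable_d α hn.ne' h)]
      exact add_mem (ihp n α) (ihq n α)

/-- A simplex has the class of some `□(u)` with `u` of dimension at most `n`, hence `u = d_n^+ u`,
and `ofSimplex_box_mem` applies. -/
theorem foldedSubgroup_eq_top : foldedSubgroup C n = ⊤ := by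
  refine (AddSubgroup.eq_top_iff' _).2 fun c => ?_
  obtain ⟨c, rfl⟩ := QuotientAddGroup.mk_surjective c
  have hof : ∀ x : Nerve (SemiPath C) n, CR.ofSimplex x ∈ foldedSubgroup C n := fun x => by
    obtain ⟨u, hu, hxu⟩ := exists_ofSimplex_eq_box x
    rw [hxu, ← hu true]
    exact ofSimplex_box_mem u n true
  induction c using FreeAbelianGroup.induction_on with
  | zero => exact zero_mem _
  | of x => exact hof x
  | neg x _ => exact neg_mem (hof x)
  | add a b ha hb => exact add_mem ha hb

theorem closure_ofObj_eq_top :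
    AddSubgroup.closure (Set.range fun a : Obj C => CR.ofObj a) = ⊤ := by
  refine (AddSubgroup.eq_top_iff' _).2 fun c => ?_
  obtain ⟨c, rfl⟩ := QuotientAddGroup.mk_surjective c
  have hof : ∀ a : Obj C, CR.ofObj a ∈
      AddSubgroup.closure (Set.range fun a : Obj C => CR.ofObj a) := fun a =>
    AddSubgroup.subset_closure ⟨a, rfl⟩
  induction c using FreeAbelianGroup.induction_on with
  | zero => exact zero_mem _
  | of x => exact hof x
  | neg x _ => exact neg_mem (hof x)
  | add a b ha hb => exact add_mem ha hb

end CR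

theorem CF.hom_ext_zero {C : Type u} [OmegaCategory C] {A : Type v} [AddCommGroup A] {f g : CFGroup C 0 →+ A}
    (h : ∀ a, f (CF.ofObj a) = g (CF.ofObj a)) : f = g :=
  QuotientAddGroup.addMonoidHom_ext _ (FreeAbelianGroup.lift_ext _ _ h)

/-! ### The chain map induced by `□^{gl-}`: existence, uniqueness and naturality. -/

section
variable (C : Type u) [OmegaCategory C] [NonContracting C]

/-- The homomorphisms induced by the operators `□^{gl-}`. -/
noncomputable def boxGroup : ∀ n : ℕ, CFGroup C n →+ CRGroup C n
  | 0 => QuotientAddGroup.lift _ (FreeAbelianGroup.lift (α := CFGens C 0) CR.ofObj)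
      ((AddSubgroup.closure_le _).2 (Set.empty_subset _))
  | n + 1 => CF.desc (fun x => CR.ofSimplex (boxMinus n x.1))
      (fun _ hx => CR.ofSimplex_boxMinus_eq_zero hx)
      (fun _ _ _ h hz => congrArg (fun q => CR.ofSimplex (box n q)) (CR.hMinus_comp_zero h hz))
      (fun _ h1 hr x y _ h hz => CR.ofSimplex_boxMinus_comp h1 hr x.2 y.2 h hz)

theorem boxGroup_ofObj (a : Obj C) : boxGroup C 0 (CF.ofObj a) = CR.ofObj a :=
  FreeAbelianGroup.lift_apply_of (α := CFGens C 0) _ a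

theorem boxGroup_ofPath {n : ℕ} (x : Path C) (hx : DimLE (n + 1) x.val) :
    boxGroup C (n + 1) (CF.ofPath x hx) = CR.ofSimplex (boxMinus n x) :=
  FreeAbelianGroup.lift_apply_of (α := CFGens C (n + 1))
    (fun x : {x : Path C // DimLE (n + 1) x.val} => CR.ofSimplex (boxMinus n x.1)) ⟨x, hx⟩

/-- In degree `1` both composites are `s_0`, because evaluating `□` gives back `h^-(x)`. Above, the
boundary of `□(h^-(x))` is source minus target, and `h^-` commutes with both. -/
theorem CRd_boxGroup (n : ℕ) :
    (CRd C n).comp (boxGroup C (n + 1)) = (boxGroup C n).comp (CFd C n) := by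
  refine CF.hom_ext fun x hx => ?_
  change CRd C n (boxGroup C (n + 1) (CF.ofPath x hx)) = boxGroup C n (CFd C n (CF.ofPath x hx))
  rw [boxGroup_ofPath]
  cases n with
  | zero => rw [CFd_zero, boxGroup_ofObj, CR.CRd_ofSimplex_boxMinus_zero hx]
  | succ n =>
    rw [CFd_succ, map_sub, boxGroup_ofPath, boxGroup_ofPath]
    unfold boxMinus
    rw [CR.CRd_ofSimplex_box, (hMinus C).map_d, (hMinus C).map_d]

/-- The chain map induced by the operators `□^{gl-}`. -/
noncomputable def boxChainMap : CF C ⟶ CR C :=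
  ChainComplex.ofHom (fun n => AddCommGrpCat.ofHom (boxGroup C n)) fun n => by
    rw [CR_d, CF_d]
    exact congrArg AddCommGrpCat.ofHom (CRd_boxGroup C n)

theorem isInducedByBox_boxChainMap : IsInducedByBox (boxChainMap C) :=
  ⟨boxGroup_ofObj C, fun _ x hx => boxGroup_ofPath C x hx⟩

variable {C}

theorem IsInducedByBox.eq {F G : CF C ⟶ CR C} (hF : IsInducedByBox F) (hG : IsInducedByBox G) :
    F = G := by
  refine HomologicalComplex.hom_ext _ _ fun n => AddCommGrpCat.hom_ext ?_
  cases n with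
  | zero => exact CF.hom_ext_zero fun a => (hF.1 a).trans (hG.1 a).symm
  | succ n => exact CF.hom_ext fun x hx => (hF.2 n x hx).trans (hG.2 n x hx).symm

variable {D : Type u} [OmegaCategory D] [NonContracting D]

theorem IsInducedByBox.natural (f : OmegaFunctor C D) (hf : f.IsNonContracting)
    {F : CF C ⟶ CR C} {G : CF D ⟶ CR D} (hF : IsInducedByBox F) (hG : IsInducedByBox G) :
    F ≫ CR.map f hf = CF.map f hf ≫ G := by
  refine HomologicalComplex.hom_ext _ _ fun n => AddCommGrpCat.hom_ext ?_
  cases n with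
  | zero =>
    refine CF.hom_ext_zero fun a => ?_
    change CR.mapGroup f hf 0 ((F.f 0).hom (CF.ofObj a)) =
      (G.f 0).hom (CF.mapGroup f hf 0 (CF.ofObj a))
    rw [hF.1, CF.mapGroup_ofObj, hG.1]
    rfl
  | succ n =>
    refine CF.hom_ext fun x hx => ?_
    change CR.mapGroup f hf (n + 1) ((F.f (n + 1)).hom (CF.ofPath x hx)) =
      (G.f (n + 1)).hom (CF.mapGroup f hf (n + 1) (CF.ofPath x hx))
    rw [hF.2, CF.mapGroup_ofPath, hG.2]
    -- Naturality of `□`, together with the fact that `ℙ^-f` extends `ℙf` along `h^-` by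
    -- construction.
    exact congrArg CR.ofSimplex (box_trans n ((hMinus C).toFun x) (f.semiPath hf))

end
end Globular

theorem mainTheorem9 (C : Type u) [OmegaCategory C] [NonContracting C] :
    -- the classes of the objects of `C` generate `CR_0^{gl-}(C)`
    AddSubgroup.closure (Set.range fun a : Obj C => CR.ofObj a) = ⊤ ∧
    -- the classes of `Φ^{gl-}(h^-(x))`, for `x` in `C_{n+1}`, generate `CR_{n+1}^{gl-}(C)`
    (∀ n : ℕ, AddSubgroup.closure {c : CRGroup C (n + 1) | ∃ x : Globular.Path C,
      HasDim (n + 1) x.val ∧ c = CR.ofSimplex (boxMinus n x)} = ⊤) ∧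
    -- `Φ^{gl-}(h^-(x *_0 y)) = Φ^{gl-}(h^-(x))`
    (∀ (n : ℕ) (x y z : Globular.Path C), DimLE (n + 1) x.val → DimLE (n + 1) y.val →
      Composable 0 x.val y.val → z.val = OmegaCategory.comp 0 x.val y.val →
      boxMinus n z = boxMinus n x) ∧
    -- `Φ^{gl-}(h^-(x *_r y)) = Φ^{gl-}(h^-(x)) + Φ^{gl-}(h^-(y))` in `CR_{n+1}^{gl-}(C)`
    (∀ (n r : ℕ) (x y z : Globular.Path C), 1 ≤ r → r ≤ n →
      DimLE (n + 1) x.val → DimLE (n + 1) y.val →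
      Composable r x.val y.val → z.val = OmegaCategory.comp r x.val y.val →
      CR.ofSimplex (boxMinus n z) = CR.ofSimplex (boxMinus n x) + CR.ofSimplex (boxMinus n y)) ∧
    -- the operators `□^{gl-}` induce a chain map `CF^-(C) → CR^{gl-}(C)`
    (∃! F : CF C ⟶ CR C, IsInducedByBox F) ∧
    -- which is natural in `C`
    (∀ (D : Type u) [OmegaCategory D] [NonContracting D] (f : OmegaFunctor C D)
      (hf : f.IsNonContracting) (F : CF C ⟶ CR C) (G : CF D ⟶ CR D),
      IsInducedByBox F → IsInducedByBox G → F ≫ CR.map f hf = CF.map f hf ≫ G) :=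
  ⟨CR.closure_ofObj_eq_top, fun _ => CR.foldedSubgroup_eq_top,
    fun n _ _ _ _ _ h hz => congrArg (box n) (CR.hMinus_comp_zero h hz),
    fun _ _ _ _ _ h1 hr hx hy h hz => CR.ofSimplex_boxMinus_comp h1 hr hx hy h hz,
    ⟨boxChainMap C, isInducedByBox_boxChainMap C,
      fun _ hF => IsInducedByBox.eq hF (isInducedByBox_boxChainMap C)⟩,
    fun _ _ _ f hf _ _ hF hG => IsInducedByBox.natural f hf hF hG⟩
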